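/- Let $\mathbb{D}=\{z\in\mathbb{C}:|z|<1\}$, let $dA=\frac{dx\,dy}{\pi}$, and let $\mathcal{H}(\mathbb{D})$ be the space of analytic functions in $\mathbb{D}$. A radial weight is a nonnegative function $\omega\in L^1([0,1))$ with $\widehat{\omega}(r)=\int_r^1\omega(s)\,ds>0$ for all $0\le r<1$, extended to $\mathbb{D}$ by $\omega(z)=\omega(|z|)$; also $\widehat{\omega}(z)=\widehat{\omega}(|z|)$. One writes $\omega\in\widehat{\mathcal{D}}$ if there is $C>1$ with $\widehat{\omega}(r)\le C\,\widehat{\omega}\left(\frac{1+r}{2}\right)$ for all $0\le r<1$, and $\omega\in\widecheck{\mathcal{D}}$ if there are $k>1$ and $C>1$ with $\widehat{\omega}(r)\ge C\,\widehat{\omega}\left(1-\frac{1-r}{k}\right)$ for all $0\le r<1$; let $\mathcal{D}=\widehat{\mathcal{D}}\cap\widecheck{\mathcal{D}}$. For $\mu\in\mathcal{D}$ and $f(z)=\sum_{n=0}^\infty\widehat{f}(n)z^n\in\mathcal{H}(\mathbb{D})$ put $$D^\mu(f)(z)=\sum_{n=0}^\infty\frac{\widehat{f}(n)}{\mu_{2n+1}}z^n,\qquad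 \mu_x=\int_0^1 r^x\mu(r)\,dr,$$ and let $\|f\|_{A^p_\omega}^p=\int_{\mathbb{D}}|f(z)|^p\omega(z)\,dA(z)\in[0,\infty]$. Theorem. Let $\omega$ be a radial weight, $0<p<\infty$ and $\mu\in\mathcal{D}$. Then there exists a constant $C=C(\omega,\mu,p)>0$ such that $$\int_{\mathbb{D}}|D^\mu(f)(z)|^p\,\widehat{\mu}(z)^p\,\omega(z)\,dA(z)\le C\,\|f\|_{A^p_\omega}^p\qquad\text{for all } f\in\mathcal{H}(\mathbb{D})$$ if and only if $\omega\in\widehat{\mathcal{D}}$. Moreover, such a constant exists if and only if there exists a constant $C>0$ such that the inequality holds for all monomials $f(z)=z^n$, $n=0,1,2,\dots$ -/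

import Mathlib

open MeasureTheory

noncomputable section

namespace RadialBergman

/-- The tail integral `∫_r^1 ω(s) ds`; it is used for `0 ≤ r < 1`, and at a point `z` of the unit
disc it is evaluated at `r = |z|`. -/
def hat (ω : ℝ → ℝ) (r : ℝ) : ℝ := ∫ s in r..1, ω s

/-- Radial weights on the unit disc, given by their profile on `[0, 1)`: nonnegative integrable
functions on `[0, 1)` with positive tail integrals. The values of `ω` outside `[0, 1)` play no
role. The weight at a point `z` of the disc is `ω ‖z‖`. -/
structure IsRadialWeight (ω : ℝ → ℝ) : Prop where
  nonneg : ∀ r ∈ Set.Ico (0 : ℝ) 1, 0 ≤ ω r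
  integrable : IntegrableOn ω (Set.Ico (0 : ℝ) 1)
  hat_pos : ∀ r ∈ Set.Ico (0 : ℝ) 1, 0 < hat ω r

/-- The class of radial weights with the upper doubling property. -/
def DHat : Set (ℝ → ℝ) :=
  {ω | IsRadialWeight ω ∧
    ∃ C : ℝ, 1 < C ∧ ∀ r ∈ Set.Ico (0 : ℝ) 1, hat ω r ≤ C * hat ω ((1 + r) / 2)}

/-- The class of radial weights with the lower (reverse) doubling property. -/
def DCheck : Set (ℝ → ℝ) :=
  {ω | IsRadialWeight ω ∧
    ∃ k C : ℝ, 1 < k ∧ 1 < C ∧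
      ∀ r ∈ Set.Ico (0 : ℝ) 1, C * hat ω (1 - (1 - r) / k) ≤ hat ω r}

/-- The class of two-sided doubling radial weights. -/
def DClass : Set (ℝ → ℝ) := DHat ∩ DCheck

/-- The moment `∫_0^1 r^x ω(r) dr`. -/
def moment (ω : ℝ → ℝ) (x : ℝ) : ℝ := ∫ r in (0 : ℝ)..1, r ^ x * ω r

/-- The `n`-th Taylor coefficient of `f` at the origin. -/
def taylorCoeff (f : ℂ → ℂ) (n : ℕ) : ℂ := iteratedDeriv n f 0 / (n.factorial : ℂ)

/-- The fractional derivative `∑ₙ f̂(n) / μ_{2n+1} zⁿ` of `f` induced by `μ`. -/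
def fracDeriv (μ : ℝ → ℝ) (f : ℂ → ℂ) (z : ℂ) : ℂ :=
  ∑' n : ℕ, taylorCoeff f n / (moment μ (2 * (n : ℝ) + 1) : ℂ) * z ^ n

/-- Normalized area measure `dx dy / π` on the unit disc, as a measure on `ℂ`. -/
def discArea : Measure ℂ :=
  ENNReal.ofReal (1 / Real.pi) • volume.restrict (Metric.ball (0 : ℂ) 1)

/-- The integral `∫_𝔻 |f(z)|^p ω(|z|) dA(z) ∈ [0, ∞]`. For `f` analytic in the disc this is the
`p`-th power of the norm of `f` in the weighted Bergman space `A^p_ω`, and it is `∞` exactly when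
`f` does not belong to that space. -/
def weightedIntegral (p : ℝ) (ω : ℝ → ℝ) (f : ℂ → ℂ) : ENNReal :=
  ∫⁻ z, ENNReal.ofReal (‖f z‖ ^ p * ω ‖z‖) ∂discArea

/-- `∫_𝔻 |D^μ f|^p μ̂^p ω dA ≤ C ‖f‖^p` for the single function `f`, with the norm of `A^p_ω`. -/
def LPInequality (p : ℝ) (ω μ : ℝ → ℝ) (C : ℝ) (f : ℂ → ℂ) : Prop :=
  weightedIntegral p (fun r => hat μ r ^ p * ω r) (fracDeriv μ f)
    ≤ ENNReal.ofReal C * weightedIntegral p ω f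

end RadialBergman

end

/-! Sufficiency rests on an estimate for circle means. Write `M(r, f)` for the mean of `|f|^p` over
the circle of radius `r`. The core is `pmean_mul_inv_oddMoment_le`: `M(r, D^μ f) μ̂(r)^p ≤ C
M((1+r)/2, f)`. Since `|f|^p` is subharmonic, `M` increases with the radius (`pmean_mono`), and for
increasing functions the dilation `r ↦ (1+r)/2` costs only a constant when integrated against a
weight in `DHat` (`lintegral_comp_half_le`, by comparing superlevel sets). Polar coordinates then
finish `exists_LPInequality`.

The core estimate is a multiplier theorem: the multiplier `e^{-hn}/μ_{2n+1}`, with `h` dyadic and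
comparable to `1 - r`, acts on circle means with norm `O(1/μ̂(1-h))`. It is cut into frequency
blocks of size `1/h` by polynomials in `e^{-hn}`. Upper doubling of `μ` makes `1/μ_{2n+1}` a symbol,
its `j`-th differences gaining `(n+1)^{-j}` (`symb_inv_oddMoment`): differences of moments carry
powers of `1 - r²`, and moments at comparable exponents are comparable. Summation by parts `k` times
then shows that the kernel of a block has size `1/(h μ̂(1-h))` and decays like `(h/|1-z|)^k`
(`kernel_bound`). Convolution with it is bounded by Hölder when `p > 1`. When `p ≤ 1`, a product of
analytic functions has its `L¹` mean controlled by the `L^p` mean on a slightly larger circle; the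
loss `h^{-(1-p)}` is exactly recovered from the `L^p` size of the kernel (`pmean_block_le`). Lower
doubling of `μ` makes `1/μ̂(1-2^{-j})` grow geometrically, so the last block dominates the sum
(`pmean_dyadic_sum_le`).

Necessity uses monomials. Lower doubling of `μ` makes `μ̂/μ_{2n+1}` as large as desired on `|z| < s
= 1 - K/(n+1)` once `K` is large. There the left side exceeds twice the right side, so the mass of
`|z^n|^p ω` inside is controlled by the mass outside, hence by `ω̂(s)`. As `|z^n|^p` is bounded
below on `1 - 4K/(n+1) < |z| < s`, the tail integrals of `ω` are doubling
(`mem_DHat_of_LPInequality_pow`). -/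

namespace RadialBergman

/-! ### The unit circle and normalized arc length. -/

/-- The circle group, with angles modulo `2π`. -/
abbrev UCirc : Type := AddCircle (2 * Real.pi)

instance : Fact (0 < 2 * Real.pi) := ⟨Real.two_pi_pos⟩

/-- Normalized arc length measure. -/
noncomputable abbrev arcMeasure : Measure UCirc := AddCircle.haarAddCircle

/-- The point of the unit circle with a given angle. -/
noncomputable def ev (t : UCirc) : ℂ := (AddCircle.toCircle t : ℂ)

lemma continuous_ev : Continuous ev :=
  continuous_subtype_val.comp AddCircle.continuous_toCircle

@[simp] lemma norm_ev (t : UCirc) : ‖ev t‖ = 1 := Circle.norm_coe _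

@[simp] lemma ev_zero : ev 0 = 1 := by simp [ev]

lemma ev_add (s t : UCirc) : ev (s + t) = ev s * ev t := by
  simp [ev, AddCircle.toCircle_add]

lemma ev_coe (x : ℝ) : ev (x : UCirc) = Complex.exp (x * Complex.I) := by
  simp [ev, AddCircle.toCircle_apply_mk, Circle.coe_exp]

lemma exists_mul_ev (z : ℂ) : ∃ t, (‖z‖ : ℂ) * ev t = z :=
  ⟨(z.arg : UCirc), by rw [ev_coe]; exact Complex.norm_mul_exp_arg_mul_I z⟩

lemma integrable_of_continuous {E : Type*} [NormedAddCommGroup E] [SecondCountableTopology E]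
    {g : UCirc → E} (hg : Continuous g) : Integrable g arcMeasure :=
  hg.integrable_of_hasCompactSupport (HasCompactSupport.of_compactSpace g)

lemma integral_swap_of_continuous {g : UCirc → UCirc → ℝ} (hg : Continuous (Function.uncurry g)) :
    ∫ s, ∫ t, g s t ∂arcMeasure ∂arcMeasure = ∫ t, ∫ s, g s t ∂arcMeasure ∂arcMeasure :=
  integral_integral_swap
    (hg.integrable_of_hasCompactSupport (HasCompactSupport.of_compactSpace _))

lemma continuous_integral {g : UCirc → UCirc → ℝ} (hg : Continuous (Function.uncurry g)) :
    Continuous fun s => ∫ t, g s t ∂arcMeasure := by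
  have := continuous_parametric_integral_of_continuous (μ := arcMeasure) hg isCompact_univ
  simpa using this

lemma circleAverage_eq_integral_ev {E : Type*} [NormedAddCommGroup E] [NormedSpace ℝ E]
    (f : ℂ → E) (c : ℂ) (R : ℝ) :
    Real.circleAverage f c R = ∫ t, f (c + R * ev t) ∂arcMeasure := by
  rw [AddCircle.integral_haarAddCircle, ← AddCircle.intervalIntegral_preimage _ 0, zero_add,
    Real.circleAverage]
  simp [ev_coe, circleMap]

lemma lintegral_Ioo_eq (g : ℂ → ENNReal) :
    ∫⁻ θ in Set.Ioo (-Real.pi) Real.pi, g (Complex.exp (θ * Complex.I)) =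
      ENNReal.ofReal (2 * Real.pi) * ∫⁻ t, g (ev t) ∂arcMeasure := by
  rw [setLIntegral_congr Ioo_ae_eq_Ioc]
  have h := AddCircle.lintegral_preimage (2 * Real.pi) (-Real.pi) (fun t => g (ev t))
  rw [AddCircle.volume_eq_smul_haarAddCircle, lintegral_smul_measure,
    show -Real.pi + 2 * Real.pi = Real.pi by ring] at h
  simp only [ev_coe] at h
  exact h

/-! ### Circle means: subharmonicity and monotonicity in the radius. -/

/-- Circle means of `‖F‖ ^ p`. -/
noncomputable def pmean (p : ℝ) (F : ℂ → ℂ) (r : ℝ) : ℝ :=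
  ∫ t, ‖F (r * ev t)‖ ^ p ∂arcMeasure

lemma pmean_nonneg (p : ℝ) (F : ℂ → ℂ) (r : ℝ) : 0 ≤ pmean p F r :=
  integral_nonneg fun _ => by positivity

lemma integral_norm_rotate (p : ℝ) (F : ℂ → ℂ) (z : ℂ) :
    ∫ t, ‖F (z * ev t)‖ ^ p ∂arcMeasure = pmean p F ‖z‖ := by
  obtain ⟨s, hs⟩ := exists_mul_ev z
  unfold pmean
  rw [← integral_add_left_eq_self (μ := arcMeasure) (fun t => ‖F (‖z‖ * ev t)‖ ^ p) s]
  congr 1; ext t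
  rw [ev_add, ← mul_assoc, hs]

/-- `‖F‖ ^ p` is subharmonic: it satisfies the sub-mean value inequality. -/
lemma norm_rpow_le_integral {p : ℝ} (hp : 0 < p) {F : ℂ → ℂ} {c : ℂ} {R : ℝ} (hR : 0 < R)
    (hF : AnalyticOnNhd ℂ F (Metric.closedBall c R)) :
    ‖F c‖ ^ p ≤ ∫ t, ‖F (c + R * ev t)‖ ^ p ∂arcMeasure := by
  rw [← circleAverage_eq_integral_ev (fun z => ‖F z‖ ^ p)]
  by_cases h0 : F c = 0
  · rw [h0, norm_zero, Real.zero_rpow hp.ne']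
    exact Real.circleAverage_nonneg_of_nonneg fun _ _ => by positivity
  have hFc : 0 < ‖F c‖ := norm_pos_iff.2 h0
  have habs : |R| = R := abs_of_pos hR
  have hF' : AnalyticOnNhd ℂ F (Metric.closedBall c |R|) := by rwa [habs]
  have hsph : Metric.sphere c |R| ⊆ Metric.closedBall c |R| := Metric.sphere_subset_closedBall
  have jensen := AnalyticOnNhd.circleAverage_log_norm hR.ne' hF' h0
  -- In Jensen's formula every zero contributes a nonnegative term, because `log (R / ‖c - u‖) ≥ 0`
  -- for a zero `u` in the disc.
  have hge : Real.log ‖F c‖ ≤ Real.circleAverage (fun z => Real.log ‖F z‖) c R := by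
    rw [jensen]
    have : 0 ≤ ∑ᶠ u, (MeromorphicOn.divisor F (Metric.closedBall c |R|) u : ℝ)
        * Real.log (R * ‖c - u‖⁻¹) := by
      refine finsum_nonneg fun u => ?_
      by_cases hu : u ∈ Metric.closedBall c |R|
      · refine mul_nonneg ?_ ?_
        · exact_mod_cast MeromorphicOn.AnalyticOnNhd.divisor_nonneg hF' u
        · by_cases huc : c = u
          · simp [huc]
          have h1 : 0 < ‖c - u‖ := norm_pos_iff.2 (sub_ne_zero.2 huc)
          refine Real.log_nonneg ?_
          rw [← div_eq_mul_inv, one_le_div h1]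
          rw [Metric.mem_closedBall, dist_comm, dist_eq_norm, habs] at hu
          exact hu
      · rw [Function.locallyFinsuppWithin.apply_eq_zero_of_notMem _ hu]; simp
    linarith
  have hi1 : CircleIntegrable (fun z => Real.log ‖F z‖) c R :=
    MeromorphicOn.circleIntegrable_log_norm
      (fun z hz => (hF' z (hsph hz)).meromorphicAt)
  have hi2 : CircleIntegrable (fun z => ‖F z‖ ^ p) c R := by
    refine ContinuousOn.circleIntegrable hR.le ?_
    refine ContinuousOn.rpow_const ?_ fun _ _ => Or.inr hp.le
    exact (hF.continuousOn.mono Metric.sphere_subset_closedBall).norm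
  set A : ℝ := ‖F c‖ ^ p with hA
  have hApos : 0 < A := by positivity
  set L : ℝ := Real.log ‖F c‖ with hL
  have hi3 : CircleIntegrable (fun z => A * (1 + p * (Real.log ‖F z‖ - L))) c R := by
    have h1 : CircleIntegrable (fun _ : ℂ => A - A * p * L) c R := circleIntegrable_const _ _ _
    have h2 : CircleIntegrable (fun z => (A * p) * Real.log ‖F z‖) c R := hi1.const_mul _
    have := h1.add h2
    refine this.congr fun θ _ => ?_
    simp; ring
  -- Zeros have to be discarded: with `Real.log 0 = 0` the tangent-line bound below may fail there.
  have hcod : ∀ᶠ z in Filter.codiscreteWithin (Metric.closedBall c |R|), F z ≠ 0 := by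
    refine (hF'.eqOn_zero_or_eventually_ne_zero_of_preconnected
      (convex_closedBall c |R|).isPreconnected).resolve_left fun h => h0 ?_
    simpa using h (Metric.mem_closedBall_self (abs_nonneg R))
  have hcod' : ∀ᶠ z in Filter.codiscreteWithin (Metric.sphere c |R|), F z ≠ 0 :=
    Filter.codiscreteWithin_mono hsph hcod
  -- Convexity of `exp` enters through the tangent line `1 + x ≤ exp x` at `x = p (log ‖F‖ - L)`,
  -- which avoids Jensen's inequality and leaves an average linear in `log ‖F‖`.
  have hle : Real.circleAverage (fun z => A * (1 + p * (Real.log ‖F z‖ - L))) c R ≤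
      Real.circleAverage (fun z => ‖F z‖ ^ p) c R := by
    unfold Real.circleAverage
    rw [smul_eq_mul, smul_eq_mul]
    refine mul_le_mul_of_nonneg_left ?_ (by positivity)
    refine intervalIntegral.integral_mono_ae_restrict (by positivity) hi3 hi2 ?_
    have h1 : ∀ᶠ θ in Filter.codiscrete ℝ, F (circleMap c R θ) ≠ 0 :=
      circleMap_preimage_codiscrete hR.ne' hcod'
    have h2 : ∀ᶠ θ in ae (volume.restrict (Set.Icc 0 (2 * Real.pi))), F (circleMap c R θ) ≠ 0 := by
      refine ae_restrict_le_codiscreteWithin measurableSet_Icc ?_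
      exact Filter.codiscreteWithin_mono (Set.subset_univ _) h1
    filter_upwards [h2] with θ hθ
    have hpos : 0 < ‖F (circleMap c R θ)‖ := norm_pos_iff.2 hθ
    have h3 : ‖F (circleMap c R θ)‖ ^ p =
        A * Real.exp (p * (Real.log ‖F (circleMap c R θ)‖ - L)) := by
      rw [hA, hL, Real.rpow_def_of_pos hpos, Real.rpow_def_of_pos hFc, ← Real.exp_add]
      congr 1; ring
    rw [h3]
    have := Real.add_one_le_exp (p * (Real.log ‖F (circleMap c R θ)‖ - L))
    nlinarith
  have heq : Real.circleAverage (fun z => A * (1 + p * (Real.log ‖F z‖ - L))) c R =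
      A * (1 + p * (Real.circleAverage (fun z => Real.log ‖F z‖) c R - L)) := by
    have h1 : CircleIntegrable (fun _ : ℂ => A - A * p * L) c R := circleIntegrable_const _ _ _
    have h2 : CircleIntegrable (fun z => (A * p) • Real.log ‖F z‖) c R := hi1.const_mul _
    have h3 : (fun z => A * (1 + p * (Real.log ‖F z‖ - L))) =
        fun z => (A - A * p * L) + (A * p) • Real.log ‖F z‖ := by
      ext z; simp; ring
    rw [h3, Real.circleAverage_fun_add h1 h2, Real.circleAverage_fun_smul, Real.circleAverage_const,
      smul_eq_mul]
    ring
  rw [heq] at hle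
  have : 0 ≤ p * (Real.circleAverage (fun z => Real.log ‖F z‖) c R - L) :=
    mul_nonneg hp.le (by linarith)
  nlinarith

lemma continuousOn_pmean {p : ℝ} (hp : 0 < p) {F : ℂ → ℂ} {S : Set ℝ}
    (hF : ContinuousOn F {z : ℂ | ‖z‖ ∈ S}) (hS : ∀ r ∈ S, 0 ≤ r) :
    ContinuousOn (pmean p F) S := by
  have h : ContinuousOn (Real.circleAverage (fun z => ‖F z‖ ^ p) 0) S := by
    refine Real.ContinuousOn.circleAverage ?_ hS
    simp only [sub_zero]
    exact hF.norm.rpow_const fun _ _ => Or.inr hp.le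
  refine h.congr fun r _ => ?_
  rw [circleAverage_eq_integral_ev]; simp [pmean]

lemma continuous_norm_rpow_comp {X : Type*} [TopologicalSpace X] {p : ℝ} (hp : 0 < p) {F : ℂ → ℂ}
    {S : Set ℂ} (hF : ContinuousOn F S) {φ : X → ℂ} (hφ : Continuous φ) (hS : ∀ x, φ x ∈ S) :
    Continuous fun x => ‖F (φ x)‖ ^ p :=
  (hF.comp_continuous hφ hS).norm.rpow_const fun _ => Or.inr hp.le

/-- Circle means of `‖F‖ ^ p` increase with the radius. -/
lemma pmean_mono {p : ℝ} (hp : 0 < p) {F : ℂ → ℂ} {R : ℝ}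
    (hF : DiffContOnCl ℂ F (Metric.ball 0 R)) {r : ℝ} (hr : 0 ≤ r) (hrR : r ≤ R) :
    pmean p F r ≤ pmean p F R := by
  rcases hrR.eq_or_lt with rfl | hlt
  · exact le_rfl
  have hR : 0 < R := hr.trans_lt hlt
  have hcl : ContinuousOn F (Metric.closedBall 0 R) := by
    have := hF.continuousOn; rwa [closure_ball _ hR.ne'] at this
  have hcont : ContinuousOn (pmean p F) (Set.Icc 0 R) := by
    refine continuousOn_pmean hp (hcl.mono fun z hz => ?_) fun r hr => hr.1
    simpa using hz.2
  by_contra hcon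
  push Not at hcon
  obtain ⟨x₀, hx₀, hmax⟩ := isCompact_Icc.exists_isMaxOn (Set.nonempty_Icc.2 hR.le) hcont
  set m := pmean p F x₀ with hm
  have hle : ∀ x ∈ Set.Icc 0 R, pmean p F x ≤ m := fun x hx => hmax hx
  have hRm : pmean p F R < m := hcon.trans_le (hle r ⟨hr, hrR⟩)
  -- Maximum principle: if the conclusion fails, the maximum `m` over `[0, R]` is not attained at
  -- `R`, and the largest radius `s < R` attaining it will be contradicted.
  set K := Set.Icc 0 R ∩ pmean p F ⁻¹' {m} with hK
  have hKc : IsCompact K := isCompact_Icc.of_isClosed_subset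
    (hcont.preimage_isClosed_of_isClosed isClosed_Icc isClosed_singleton) Set.inter_subset_left
  obtain ⟨s, hsK, hsmax⟩ := hKc.exists_isMaxOn ⟨x₀, hx₀, rfl⟩ continuousOn_id
  have hs0 : 0 ≤ s := hsK.1.1
  have hsm : pmean p F s = m := hsK.2
  have hsR : s < R := lt_of_le_of_ne hsK.1.2 fun h => by rw [h] at hsm; linarith
  set ε := (R - s) / 2 with hε
  have hεpos : 0 < ε := by rw [hε]; linarith
  have hin : ∀ t : UCirc, ‖(s : ℂ) + ε * ev t‖ ≤ s + ε := fun t => by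
    refine (norm_add_le _ _).trans ?_
    simp [abs_of_nonneg hs0, abs_of_pos hεpos]
  have hsε : s + ε < R := by rw [hε]; linarith
  have hcont2 : Continuous (Function.uncurry fun (u t : UCirc) =>
      ‖F ((s + ε * ev t) * ev u)‖ ^ p) := by
    refine continuous_norm_rpow_comp hp hcl (φ := fun x : UCirc × UCirc =>
      ((s : ℂ) + ε * ev x.2) * ev x.1) ?_ fun x => ?_
    · have := continuous_ev; fun_prop
    · rw [mem_closedBall_zero_iff, norm_mul, norm_ev, mul_one]
      exact (hin _).trans hsε.le
  -- The sub-mean value inequality on circles of radius `ε` about the points of `|z| = s`, averaged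
  -- over rotations, is a mean value inequality for the radial function `pmean p F ‖·‖`.
  have hstep : m ≤ ∫ t, pmean p F ‖(s : ℂ) + ε * ev t‖ ∂arcMeasure := by
    have h1 : ∀ u : UCirc, ‖F (s * ev u)‖ ^ p ≤
        ∫ t, ‖F ((s + ε * ev t) * ev u)‖ ^ p ∂arcMeasure := fun u => by
      have := norm_rpow_le_integral hp (c := s * ev u) (R := ε) (F := F) hεpos ?_
      · refine this.trans (le_of_eq ?_)
        rw [← integral_add_right_eq_self (μ := arcMeasure)
          (fun t => ‖F (s * ev u + ε * ev t)‖ ^ p) u]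
        congr 1; ext t; rw [ev_add]; ring_nf
      · have hsub : Metric.closedBall ((s : ℂ) * ev u) ε ⊆ Metric.ball 0 R := by
          refine Metric.closedBall_subset_ball' ?_
          rw [dist_zero_right, norm_mul, norm_ev, mul_one, Complex.norm_real, Real.norm_eq_abs,
            abs_of_nonneg hs0]
          linarith
        exact (hF.differentiableOn.analyticOnNhd Metric.isOpen_ball).mono hsub
    calc m = ∫ u, ‖F (s * ev u)‖ ^ p ∂arcMeasure := hsm.symm
      _ ≤ ∫ u, ∫ t, ‖F ((s + ε * ev t) * ev u)‖ ^ p ∂arcMeasure ∂arcMeasure := by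
          refine integral_mono (integrable_of_continuous ?_)
            (integrable_of_continuous (continuous_integral hcont2)) h1
          refine continuous_norm_rpow_comp hp hcl (by have := continuous_ev; fun_prop) fun u => ?_
          simpa [abs_of_nonneg hs0] using hsR.le
      _ = ∫ t, ∫ u, ‖F ((s + ε * ev t) * ev u)‖ ^ p ∂arcMeasure ∂arcMeasure :=
          integral_swap_of_continuous hcont2
      _ = _ := by congr 1; ext t; rw [integral_norm_rotate]
  have hcont3 : Continuous fun t : UCirc => pmean p F ‖(s : ℂ) + ε * ev t‖ := by
    refine hcont.comp_continuous (by have := continuous_ev; fun_prop) fun t => ?_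
    exact ⟨norm_nonneg _, (hin t).trans hsε.le⟩
  have hle3 : ∀ t : UCirc, 0 ≤ m - pmean p F ‖(s : ℂ) + ε * ev t‖ := fun t =>
    sub_nonneg.2 (hle _ ⟨norm_nonneg _, (hin t).trans hsε.le⟩)
  have hzero : ∫ t, (m - pmean p F ‖(s : ℂ) + ε * ev t‖) ∂arcMeasure ≤ 0 := by
    rw [integral_sub (integrable_const _) (integrable_of_continuous hcont3)]
    simpa using hstep
  have hcont4 : Continuous fun t : UCirc => m - pmean p F ‖(s : ℂ) + ε * ev t‖ :=
    continuous_const.sub hcont3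
  -- The nonnegative continuous function `m - pmean` has nonpositive mean, so it cannot be positive
  -- at angle `0`. Thus `s + ε` is also a maximizer, against the choice of `s`.
  have hall := (Continuous.integral_pos_of_hasCompactSupport_nonneg_nonzero (μ := arcMeasure)
    (x := 0) hcont4 (HasCompactSupport.of_compactSpace _) hle3 ?_)
  · linarith
  · intro h
    have h5 : pmean p F (s + ε) = m := by
      have h6 : ‖(s : ℂ) + ε * ev 0‖ = s + ε := by
        rw [ev_zero, mul_one, ← Complex.ofReal_add, Complex.norm_real, Real.norm_eq_abs,
          abs_of_nonneg (by linarith)]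
      rw [h6] at h; linarith
    have h7 : s + ε ≤ s := hsmax (⟨⟨by linarith, hsε.le⟩, h5⟩ : s + ε ∈ K)
    linarith

/-! ### Polar coordinates, and `L¹` means controlled by `L^p` means for `p ≤ 1`. -/

/-- Measurability is required in polar coordinates because the weights met later are only a.e.
measurable as functions of the radius. -/
lemma lintegral_polar {g : ℂ → ENNReal}
    (hg : AEMeasurable (fun q : ℝ × ℝ => g (q.1 * Complex.exp (q.2 * Complex.I)))
      ((volume.restrict (Set.Ioi 0)).prod (volume.restrict (Set.Ioo (-Real.pi) Real.pi)))) :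
    ∫⁻ z, g z = ∫⁻ r in Set.Ioi (0 : ℝ),
      ENNReal.ofReal (2 * Real.pi * r) * ∫⁻ t, g (r * ev t) ∂arcMeasure := by
  rw [← Complex.lintegral_comp_polarCoord_symm, polarCoord_target, Measure.volume_eq_prod,
    ← Measure.prod_restrict]
  have h1 : ∀ q : ℝ × ℝ, ENNReal.ofReal q.1 • g (Complex.polarCoord.symm q) =
      ENNReal.ofReal q.1 * g (q.1 * Complex.exp (q.2 * Complex.I)) := fun q => by
    rw [Complex.polarCoord_symm_apply, smul_eq_mul, Complex.exp_mul_I]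
    simp
  simp only [h1]
  rw [lintegral_prod (fun q : ℝ × ℝ =>
    ENNReal.ofReal q.1 * g (q.1 * Complex.exp (q.2 * Complex.I)))
    ((measurable_fst.ennreal_ofReal.aemeasurable).mul hg)]
  refine setLIntegral_congr_fun measurableSet_Ioi fun r hr => ?_
  simp only
  rw [lintegral_const_mul' _ _ ENNReal.ofReal_ne_top,
    lintegral_Ioo_eq (fun w => g (r * w)), ← mul_assoc, ← ENNReal.ofReal_mul (le_of_lt hr),
    mul_comm r]

lemma lintegral_polar_of_measurable {g : ℂ → ENNReal} (hg : Measurable g) :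
    ∫⁻ z, g z = ∫⁻ r in Set.Ioi (0 : ℝ),
      ENNReal.ofReal (2 * Real.pi * r) * ∫⁻ t, g (r * ev t) ∂arcMeasure :=
  lintegral_polar (hg.comp (by fun_prop)).aemeasurable

lemma ofReal_pmean {p : ℝ} {F : ℂ → ℂ} {r : ℝ}
    (h : Continuous fun t : UCirc => ‖F (r * ev t)‖ ^ p) :
    ∫⁻ t, ENNReal.ofReal (‖F (r * ev t)‖ ^ p) ∂arcMeasure = ENNReal.ofReal (pmean p F r) :=
  (ofReal_integral_eq_lintegral_ofReal (integrable_of_continuous h)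
    (Filter.Eventually.of_forall fun _ => by positivity)).symm

lemma lintegral_Ioo_two_pi_mul {d : ℝ} (hd : 0 ≤ d) :
    ∫⁻ r in Set.Ioo 0 d, ENNReal.ofReal (2 * Real.pi * r) = ENNReal.ofReal (Real.pi * d ^ 2) := by
  have hc : Continuous fun r : ℝ => 2 * Real.pi * r := by fun_prop
  rw [setLIntegral_congr Ioo_ae_eq_Ioc, ← ofReal_integral_eq_lintegral_ofReal]
  · rw [← intervalIntegral.integral_of_le hd, intervalIntegral.integral_const_mul, integral_id]
    congr 1; ring
  · exact (hc.integrableOn_Icc (a := 0) (b := d)).mono_set Set.Ioc_subset_Icc_self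
  · refine (ae_restrict_mem measurableSet_Ioc).mono fun r hr => ?_
    have := hr.1; simp only [Pi.zero_apply]; positivity

/-- A pointwise bound on the unit circle by a circle mean over a larger circle. -/
lemma norm_rpow_le_pmean {p : ℝ} (hp : 0 < p) {F : ℂ → ℂ} {δ : ℝ} (hδ : 0 < δ) (hδ1 : δ ≤ 1)
    (hF : DiffContOnCl ℂ F (Metric.ball 0 (1 + δ))) {z : ℂ} (hz : ‖z‖ = 1) :
    ‖F z‖ ^ p ≤ 8 / δ * pmean p F (1 + δ) := by
  have hcont : ContinuousOn F (Metric.ball 0 (1 + δ)) := hF.differentiableOn.continuousOn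
  set g : ℂ → ENNReal :=
    (Metric.ball 0 (1 + δ)).indicator fun w => ENNReal.ofReal (‖F w‖ ^ p) with hg
  have hgm : Measurable g := by
    have hc : ContinuousOn (fun w => ENNReal.ofReal (‖F w‖ ^ p)) (Metric.ball 0 (1 + δ)) :=
      ENNReal.continuous_ofReal.comp_continuousOn
        (hcont.norm.rpow_const fun _ _ => Or.inr hp.le)
    classical
    rw [hg, ← Set.piecewise_eq_indicator]
    exact hc.measurable_piecewise continuousOn_const Metric.isOpen_ball.measurableSet
  -- The sub-mean value inequality is integrated over all radii below `δ`, giving an area mean over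
  -- the disc about `z`.
  have hlow : ENNReal.ofReal (Real.pi * δ ^ 2) * ENNReal.ofReal (‖F z‖ ^ p) ≤
      ∫⁻ w, (Metric.ball z δ).indicator g w := by
    rw [← lintegral_add_left_eq_self _ z, lintegral_polar_of_measurable
      (g := fun x => (Metric.ball z δ).indicator g (z + x))
      ((hgm.indicator Metric.isOpen_ball.measurableSet).comp (measurable_const_add z)),
      ← lintegral_Ioo_two_pi_mul hδ.le, ← lintegral_mul_const _ (by fun_prop)]
    refine le_trans (setLIntegral_mono_ae' measurableSet_Ioo (Filter.Eventually.of_forall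
      fun r hr => ?_)) (lintegral_mono_set Set.Ioo_subset_Ioi_self)
    refine mul_le_mul_right ?_ _
    have hsub : Metric.closedBall z r ⊆ Metric.ball 0 (1 + δ) := by
      refine Metric.closedBall_subset_ball' ?_
      rw [dist_zero_right, hz]; linarith [hr.2]
    have hmem : ∀ t : UCirc, z + r * ev t ∈ Metric.closedBall z r := fun t => by
      simp [abs_of_pos hr.1]
    have hmem' : ∀ t : UCirc, z + r * ev t ∈ Metric.ball z δ := fun t => by
      have := hr.2; simp [abs_of_pos hr.1, this]
    have hval : ∀ t : UCirc, (Metric.ball z δ).indicator g (z + r * ev t) =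
        ENNReal.ofReal (‖F (z + r * ev t)‖ ^ p) := fun t => by
      rw [Set.indicator_of_mem (hmem' t), hg, Set.indicator_of_mem (hsub (hmem t))]
    simp only [hval]
    rw [← ofReal_integral_eq_lintegral_ofReal (integrable_of_continuous ?_)
      (Filter.Eventually.of_forall fun _ => by positivity)]
    · exact ENNReal.ofReal_le_ofReal (norm_rpow_le_integral hp hr.1
        ((hF.differentiableOn.analyticOnNhd Metric.isOpen_ball).mono hsub))
    · exact continuous_norm_rpow_comp hp hcont (by have := continuous_ev; fun_prop)
        fun t => hsub (hmem t)
  -- That disc lies in the annulus `1 - δ < |w| < 1 + δ`, where every circle mean is at most the one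
  -- at `1 + δ`. Dividing the annulus bound by the area `π δ²` leaves one factor `1/δ`.
  have hup : ∫⁻ w, (Metric.ball z δ).indicator g w ≤
      ENNReal.ofReal (2 * Real.pi * (1 + δ) * pmean p F (1 + δ) * (2 * δ)) := by
    have hsub : ∀ w, (Metric.ball z δ).indicator g w ≤
        {w : ℂ | 1 - δ < ‖w‖ ∧ ‖w‖ < 1 + δ}.indicator g w := fun w => by
      refine Set.indicator_le_indicator_of_subset (fun w hw => ?_) (fun _ => zero_le) w
      rw [Metric.mem_ball, dist_eq_norm] at hw
      have h1 := norm_sub_norm_le z w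
      have h2 := norm_sub_norm_le w z
      rw [norm_sub_rev] at h1
      rw [hz] at h1 h2
      exact ⟨by linarith, by linarith⟩
    have hms : MeasurableSet {w : ℂ | 1 - δ < ‖w‖ ∧ ‖w‖ < 1 + δ} :=
      (measurableSet_lt measurable_const measurable_norm).inter
        (measurableSet_lt measurable_norm measurable_const)
    refine (lintegral_mono hsub).trans ?_
    rw [lintegral_polar_of_measurable (hgm.indicator hms)]
    have hb : ∀ r ∈ Set.Ioi (0 : ℝ), ENNReal.ofReal (2 * Real.pi * r) *
        ∫⁻ t, {w : ℂ | 1 - δ < ‖w‖ ∧ ‖w‖ < 1 + δ}.indicator g (r * ev t) ∂arcMeasure ≤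
        (Set.Ioo (1 - δ) (1 + δ)).indicator (fun _ =>
          ENNReal.ofReal (2 * Real.pi * (1 + δ) * pmean p F (1 + δ))) r := fun r hr => by
      have hr0 : (0 : ℝ) < r := hr
      have hn : ∀ t, ‖(r : ℂ) * ev t‖ = r := fun t => by simp [abs_of_pos hr0]
      by_cases hrm : r ∈ Set.Ioo (1 - δ) (1 + δ)
      · rw [Set.indicator_of_mem hrm]
        have hval : ∀ t : UCirc, {w : ℂ | 1 - δ < ‖w‖ ∧ ‖w‖ < 1 + δ}.indicator g (r * ev t) =
            ENNReal.ofReal (‖F (r * ev t)‖ ^ p) := fun t => by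
          rw [Set.indicator_of_mem (by rw [Set.mem_ofPred_eq, hn]; exact hrm), hg,
            Set.indicator_of_mem (by rw [mem_ball_zero_iff, hn]; exact hrm.2)]
        simp only [hval]
        rw [ofReal_pmean, ← ENNReal.ofReal_mul (by positivity)]
        · refine ENNReal.ofReal_le_ofReal ?_
          have := pmean_mono hp hF hr0.le hrm.2.le
          have h0 := pmean_nonneg p F r
          have := hrm.2
          gcongr
        · exact continuous_norm_rpow_comp hp hcont (by have := continuous_ev; fun_prop)
            fun t => by rw [mem_ball_zero_iff, hn]; exact hrm.2
      · have hval : ∀ t : UCirc,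
            {w : ℂ | 1 - δ < ‖w‖ ∧ ‖w‖ < 1 + δ}.indicator g (r * ev t) = 0 := fun t => by
          refine Set.indicator_of_notMem ?_ _
          rw [Set.mem_ofPred_eq, hn]; exact hrm
        simp [hval]
    refine (setLIntegral_mono' measurableSet_Ioi hb).trans ?_
    refine (setLIntegral_le_lintegral _ _).trans ?_
    rw [lintegral_indicator_const measurableSet_Ioo, Real.volume_Ioo, ← ENNReal.ofReal_mul]
    · exact le_of_eq (by congr 1; ring)
    · have := pmean_nonneg p F (1 + δ); positivity
  have h := hlow.trans hup
  have hG := pmean_nonneg p F (1 + δ)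
  rw [← ENNReal.ofReal_mul (by positivity), ENNReal.ofReal_le_ofReal_iff (by positivity)] at h
  rw [div_mul_eq_mul_div, le_div_iff₀ hδ]
  have hpi := Real.pi_pos
  have h2 : (Real.pi * δ) * (‖F z‖ ^ p * δ) ≤ (Real.pi * δ) * (4 * (1 + δ) * pmean p F (1 + δ)) := by
    calc _ = Real.pi * δ ^ 2 * ‖F z‖ ^ p := by ring
      _ ≤ _ := h
      _ = _ := by ring
  have h3 := le_of_mul_le_mul_left h2 (by positivity)
  refine h3.trans ?_
  gcongr; linarith

/-- For `p ≤ 1`, the `L¹` mean on the unit circle is controlled by the `p`-th mean on a larger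
circle. -/
lemma integral_norm_rpow_le_pmean {p : ℝ} (hp : 0 < p) (hp1 : p ≤ 1) {F : ℂ → ℂ} {δ : ℝ}
    (hδ : 0 < δ) (hδ1 : δ ≤ 1) (hF : DiffContOnCl ℂ F (Metric.ball 0 (1 + δ))) :
    (∫ t, ‖F (ev t)‖ ∂arcMeasure) ^ p ≤ (8 / δ) ^ (1 - p) * pmean p F (1 + δ) := by
  set G := pmean p F (1 + δ) with hG
  have hG0 : 0 ≤ G := pmean_nonneg _ _ _
  have hcont : ContinuousOn F (Metric.ball 0 (1 + δ)) := hF.differentiableOn.continuousOn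
  have hev : ∀ t, ev t ∈ Metric.ball (0 : ℂ) (1 + δ) := fun t => by simp [hδ]
  set B := 8 / δ * G with hB
  have hB0 : 0 ≤ B := by positivity
  have hexp : 0 ≤ (1 - p) / p := div_nonneg (by linarith) hp.le
  -- `|F| = |F|^{1-p} |F|^p`, with the pointwise bound `B` applied to the first factor only.
  have h1 : ∀ t : UCirc, ‖F (ev t)‖ ≤ B ^ ((1 - p) / p) * ‖F (ev t)‖ ^ p := fun t => by
    have h2 := norm_rpow_le_pmean hp hδ hδ1 hF (norm_ev t)
    have hn := norm_nonneg (F (ev t))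
    calc ‖F (ev t)‖ = (‖F (ev t)‖ ^ p) ^ ((1 - p) / p) * ‖F (ev t)‖ ^ p := by
          rcases hn.eq_or_lt with h | h
          · rw [← h, Real.zero_rpow hp.ne', mul_zero]
          · rw [← Real.rpow_mul hn, ← Real.rpow_add h, mul_div_cancel₀ _ hp.ne']
            simp
      _ ≤ _ := by gcongr
  have h3 : ∫ t, ‖F (ev t)‖ ∂arcMeasure ≤ B ^ ((1 - p) / p) * G := by
    have hc : Continuous fun t : UCirc => ‖F (ev t)‖ ^ p :=
      continuous_norm_rpow_comp hp hcont continuous_ev hev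
    calc ∫ t, ‖F (ev t)‖ ∂arcMeasure
        ≤ ∫ t, B ^ ((1 - p) / p) * ‖F (ev t)‖ ^ p ∂arcMeasure :=
          integral_mono (integrable_of_continuous (hcont.comp_continuous continuous_ev hev).norm)
            ((integrable_of_continuous hc).const_mul _) h1
      _ = B ^ ((1 - p) / p) * pmean p F 1 := by
          rw [integral_const_mul]; simp [pmean]
      _ ≤ _ := by
          gcongr
          exact pmean_mono hp hF zero_le_one (by linarith)
  calc (∫ t, ‖F (ev t)‖ ∂arcMeasure) ^ p ≤ (B ^ ((1 - p) / p) * G) ^ p :=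
        Real.rpow_le_rpow (integral_nonneg fun _ => norm_nonneg _) h3 hp.le
    _ = (8 / δ) ^ (1 - p) * (G ^ (1 - p) * G ^ p) := by
        rw [Real.mul_rpow (by positivity) hG0, ← Real.rpow_mul hB0, div_mul_cancel₀ _ hp.ne', hB,
          Real.mul_rpow (by positivity) hG0, mul_assoc]
    _ = (8 / δ) ^ (1 - p) * G := by
        rcases hG0.eq_or_lt with h | h
        · rw [← h, Real.zero_rpow hp.ne', mul_zero]
        · rw [← Real.rpow_add h]; simp

/-! ### Power series, Hadamard products as convolutions, and kernels concentrated near `1`. -/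

/-- The sum of a power series. -/
noncomputable def pser (b : ℕ → ℂ) (z : ℂ) : ℂ := ∑' n, b n * z ^ n

lemma norm_term_le {b : ℕ → ℂ} {z : ℂ} (hz : ‖z‖ ≤ 1) (n : ℕ) : ‖b n * z ^ n‖ ≤ ‖b n‖ := by
  rw [norm_mul, norm_pow]
  exact mul_le_of_le_one_right (norm_nonneg _) (pow_le_one₀ (norm_nonneg _) hz)

lemma diffContOnCl_pser {b : ℕ → ℂ} (hb : Summable fun n => ‖b n‖) :
    DiffContOnCl ℂ (pser b) (Metric.ball 0 1) := by
  refine ⟨?_, ?_⟩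
  · refine Complex.differentiableOn_tsum_of_summable_norm hb (fun n => ?_) Metric.isOpen_ball
      fun n w hw => norm_term_le (by simpa using (mem_ball_zero_iff.1 hw).le) n
    fun_prop
  · rw [closure_ball _ one_ne_zero]
    exact continuousOn_tsum (fun n => by fun_prop) hb
      fun n w hw => norm_term_le (by simpa using hw) n

lemma continuousOn_pser {b : ℕ → ℂ} (hb : Summable fun n => ‖b n‖) :
    ContinuousOn (pser b) (Metric.closedBall 0 1) := by
  have := (diffContOnCl_pser hb).continuousOn
  rwa [closure_ball _ one_ne_zero] at this

lemma integral_ev_pow {k : ℕ} (hk : k ≠ 0) : ∫ t, ev t ^ k ∂arcMeasure = 0 := by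
  have h := (circleAverage_eq_integral_ev (fun z : ℂ => z ^ k) 0 1).symm
  simp only [Complex.ofReal_one, one_mul, zero_add] at h
  rw [h, DiffContOnCl.circleAverage, zero_pow hk]
  exact (differentiable_id.pow k).diffContOnCl

lemma integral_ev_pow_mul_conj (n m : ℕ) :
    ∫ t, ev t ^ n * (starRingEnd ℂ) (ev t) ^ m ∂arcMeasure = if n = m then 1 else 0 := by
  have hone : ∀ t, ev t * (starRingEnd ℂ) (ev t) = 1 := fun t => by
    rw [Complex.mul_conj, Complex.normSq_eq_norm_sq]; simp
  rcases lt_trichotomy n m with h | rfl | h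
  · obtain ⟨k, rfl⟩ := Nat.exists_eq_add_of_lt h
    have : ∀ t, ev t ^ n * (starRingEnd ℂ) (ev t) ^ (n + k + 1) =
        (starRingEnd ℂ) (ev t ^ (k + 1)) := fun t => by
      rw [add_assoc, pow_add, ← mul_assoc, ← mul_pow, hone, one_pow, one_mul, map_pow]
    simp only [this]
    rw [integral_conj, integral_ev_pow (by simp), if_neg (by omega), map_zero]
  · simp [← mul_pow, hone]
  · obtain ⟨k, rfl⟩ := Nat.exists_eq_add_of_lt h
    have : ∀ t, ev t ^ (m + k + 1) * (starRingEnd ℂ) (ev t) ^ m = ev t ^ (k + 1) := fun t => by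
      rw [add_assoc, pow_add, mul_right_comm, ← mul_pow, hone, one_pow, one_mul]
    simp only [this]
    rw [integral_ev_pow (by simp), if_neg (by omega)]

/-- The Hadamard product of two power series as a convolution over the unit circle. -/
lemma pser_mul_eq_integral {a b : ℕ → ℂ} (ha : Summable fun n => ‖a n‖)
    (hb : Summable fun n => ‖b n‖) {z : ℂ} (hz : ‖z‖ = 1) :
    pser (fun n => b n * a n) z =
      ∫ t, pser b (z * ev t) * pser a ((starRingEnd ℂ) (ev t)) ∂arcMeasure := by
  set f : ℕ × ℕ → UCirc → ℂ := fun q t =>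
    (b q.1 * (z * ev t) ^ q.1) * (a q.2 * (starRingEnd ℂ) (ev t) ^ q.2) with hf
  have hnorm : ∀ q t, ‖f q t‖ = ‖b q.1‖ * ‖a q.2‖ := fun q t => by simp [hf, hz]
  have hsum : Summable fun q : ℕ × ℕ => ‖b q.1‖ * ‖a q.2‖ := hb.mul_of_nonneg ha
    (fun _ => norm_nonneg _) fun _ => norm_nonneg _
  have h1 : ∀ t, pser b (z * ev t) * pser a ((starRingEnd ℂ) (ev t)) = ∑' q, f q t := fun t => by
    refine tsum_mul_tsum_of_summable_norm ?_ ?_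
    · exact hb.of_nonneg_of_le (fun _ => norm_nonneg _) fun n => norm_term_le (by simp [hz]) n
    · exact ha.of_nonneg_of_le (fun _ => norm_nonneg _) fun n => norm_term_le (by simp) n
  have hfc : ∀ q, Continuous (f q) := fun q => by
    have := continuous_ev
    have h2 : Continuous fun t => (starRingEnd ℂ) (ev t) := Complex.continuous_conj.comp this
    simp only [hf]; fun_prop
  simp only [h1]
  rw [← integral_tsum_of_summable_integral_norm (fun q => integrable_of_continuous (hfc q))
    (by simpa [hnorm] using hsum)]
  have h2 : ∀ q : ℕ × ℕ, ∫ t, f q t ∂arcMeasure =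
      if q.1 = q.2 then b q.1 * a q.1 * z ^ q.1 else 0 := fun q => by
    have : ∀ t, f q t = (b q.1 * a q.2 * z ^ q.1) *
        (ev t ^ q.1 * (starRingEnd ℂ) (ev t) ^ q.2) := fun t => by
      simp only [hf, mul_pow]; ring
    simp only [this]
    rw [integral_const_mul, integral_ev_pow_mul_conj]
    split_ifs with h
    · rw [h]; simp
    · simp
  simp only [h2]
  rw [Summable.tsum_prod]
  · unfold pser
    congr 1; ext n
    rw [tsum_eq_single n fun m hm => if_neg hm.symm]; simp
  · refine Summable.of_norm_bounded hsum fun q => ?_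
    split_ifs with h
    · rw [norm_mul, norm_mul, norm_pow, hz, one_pow, mul_one, ← h]
    · rw [norm_zero]; positivity

/-- Real coefficients commute with conjugation. This removes the conjugate from the convolution
formula inside absolute values, so that the integrand becomes the modulus of an analytic function.
-/
lemma norm_pser_conj (a : ℕ → ℝ) (z : ℂ) :
    ‖pser (fun n => (a n : ℂ)) ((starRingEnd ℂ) z)‖ = ‖pser (fun n => (a n : ℂ)) z‖ := by
  rw [← RCLike.norm_conj (pser (fun n => (a n : ℂ)) z)]
  unfold pser
  rw [Complex.conj_tsum]
  simp

/-- With `ρ = 1/(1+h)` one has `|1 - ρz| ≤ ρ(h + |1 - z|)`, and the mean of `|1 - ρz|^{-2}` is the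
geometric sum `1/(1 - ρ²)`, read off from the convolution formula at `z = 1`. -/
lemma integral_kernel_weight_le {h : ℝ} (hh : 0 < h) :
    ∫ t, (h / (h + ‖1 - ev t‖)) ^ 2 ∂arcMeasure ≤ h / 2 := by
  set ρ : ℝ := (1 + h)⁻¹ with hρ
  have hρ0 : 0 < ρ := by positivity
  have hρ1 : ρ < 1 := inv_lt_one_of_one_lt₀ (by linarith)
  set a : ℕ → ℝ := fun n => ρ ^ n with ha
  have hsum : Summable fun n => ‖((a n : ℝ) : ℂ)‖ := by
    simpa [ha, abs_of_pos hρ0] using summable_geometric_of_lt_one hρ0.le hρ1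
  have hgeo : ∀ z : ℂ, ‖z‖ ≤ 1 → pser (fun n => (a n : ℂ)) z = (1 - ρ * z)⁻¹ := fun z hz => by
    unfold pser
    simp only [ha, Complex.ofReal_pow, ← mul_pow]
    refine tsum_geometric_of_norm_lt_one ?_
    rw [norm_mul, Complex.norm_real, Real.norm_eq_abs, abs_of_pos hρ0]
    nlinarith [norm_nonneg z]
  have hconv := pser_mul_eq_integral hsum hsum (z := 1) norm_one
  have h1 : ∀ t : UCirc, pser (fun n => (a n : ℂ)) (1 * ev t) *
      pser (fun n => (a n : ℂ)) ((starRingEnd ℂ) (ev t)) =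
        ((‖(1 - ρ * ev t)‖⁻¹ ^ 2 : ℝ) : ℂ) := fun t => by
    rw [one_mul, hgeo _ (by simp), hgeo _ (by simp)]
    have : 1 - (ρ : ℂ) * (starRingEnd ℂ) (ev t) = (starRingEnd ℂ) (1 - ρ * ev t) := by simp
    rw [this, ← mul_inv, Complex.mul_conj, Complex.normSq_eq_norm_sq]
    push_cast; rw [inv_pow]
  have h2 : pser (fun n => ((a n : ℝ) : ℂ) * ((a n : ℝ) : ℂ)) 1 = (((1 - ρ ^ 2)⁻¹ : ℝ) : ℂ) := by
    unfold pser
    simp only [ha, one_pow, mul_one]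
    rw [← tsum_geometric_of_lt_one (by positivity) (by nlinarith : ρ ^ 2 < 1), Complex.ofReal_tsum]
    congr 1; ext n; push_cast; ring
  rw [h2] at hconv
  simp only [h1] at hconv
  rw [integral_complex_ofReal] at hconv
  have h3 : ∫ t, ‖(1 - ρ * ev t)‖⁻¹ ^ 2 ∂arcMeasure = (1 - ρ ^ 2)⁻¹ := by exact_mod_cast hconv.symm
  have hne : ∀ t : UCirc, 0 < ‖(1 - ρ * ev t)‖ := fun t => by
    have := norm_sub_norm_le (1 : ℂ) (ρ * ev t)
    simp [abs_of_pos hρ0] at this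
    have h5 : 0 < 1 - ρ := by linarith
    linarith
  have hcev := continuous_ev
  have hc1 : Continuous fun t : UCirc => ‖(1 - ρ * ev t)‖⁻¹ ^ 2 :=
    (Continuous.inv₀ (by fun_prop) fun t => (hne t).ne').pow 2
  have hc2 : Continuous fun t : UCirc => (h / (h + ‖1 - ev t‖)) ^ 2 :=
    (Continuous.div (by fun_prop) (by fun_prop) fun t => by positivity).pow 2
  calc ∫ t, (h / (h + ‖1 - ev t‖)) ^ 2 ∂arcMeasure
      ≤ ∫ t, (h * ρ) ^ 2 * ‖(1 - ρ * ev t)‖⁻¹ ^ 2 ∂arcMeasure := by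
        refine integral_mono (integrable_of_continuous hc2)
          ((integrable_of_continuous hc1).const_mul _) fun t => ?_
        simp only
        rw [← mul_pow]
        have h6 : ‖(1 - ρ * ev t)‖ ≤ ρ * (h + ‖1 - ev t‖) := by
          have h7 : 1 - (ρ : ℂ) * ev t = ρ * (h + (1 - ev t)) := by
            rw [hρ]; push_cast
            have : (1 : ℂ) + h ≠ 0 := by
              exact_mod_cast (by positivity : (1 + h : ℝ) ≠ 0)
            field_simp; ring
          rw [h7, norm_mul, Complex.norm_real, Real.norm_eq_abs, abs_of_pos hρ0]
          gcongr
          refine (norm_add_le _ _).trans ?_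
          simp [abs_of_pos hh]
        gcongr
        rw [div_eq_mul_inv, mul_assoc]
        gcongr
        rw [← div_eq_mul_inv, le_div_iff₀ (hne t), inv_mul_le_iff₀ (by positivity)]
        exact h6.trans (le_of_eq (mul_comm _ _))
    _ = (h * ρ) ^ 2 * (1 - ρ ^ 2)⁻¹ := by rw [integral_const_mul, h3]
    _ ≤ h / 2 := by
        have h8 : (1 : ℝ) - ρ ^ 2 = h * (2 + h) * ρ ^ 2 := by
          rw [hρ]; field_simp; ring
        rw [h8]
        have : (h * ρ) ^ 2 * (h * (2 + h) * ρ ^ 2)⁻¹ = h / (2 + h) := by field_simp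
        rw [this]; gcongr; linarith

/-- The `L^q` mean of a kernel concentrated near `1` at scale `h`. -/
lemma pmean_kernel_le {q : ℝ} (hq : 0 < q) {k : ℕ} (hk : 2 ≤ k * q) {h L : ℝ} (hh : 0 < h)
    {K : ℂ → ℂ} (hK : ContinuousOn K (Metric.closedBall 0 1))
    (h1 : ∀ t, ‖K (ev t)‖ ≤ L / h) (h2 : ∀ t, ‖1 - ev t‖ ^ k * ‖K (ev t)‖ ≤ L * h ^ k / h) :
    pmean q K 1 ≤ 2 * (L / h) ^ q * h := by
  have hL : 0 ≤ L / h := (norm_nonneg _).trans (h1 0)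
  have hcev := continuous_ev
  have hc2 : Continuous fun t : UCirc => (h / (h + ‖1 - ev t‖)) ^ 2 :=
    (Continuous.div (by fun_prop) (by fun_prop) fun t => by positivity).pow 2
  have hc1 : Continuous fun t : UCirc => ‖K (((1 : ℝ) : ℂ) * ev t)‖ ^ q :=
    continuous_norm_rpow_comp hq hK (by fun_prop) fun t => by simp
  calc pmean q K 1 ≤ ∫ t, (L / h) ^ q * 4 * (h / (h + ‖1 - ev t‖)) ^ 2 ∂arcMeasure := by
        refine integral_mono (integrable_of_continuous hc1)
          ((integrable_of_continuous hc2).const_mul _) fun t => ?_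
        simp only [Complex.ofReal_one, one_mul]
        set d := ‖1 - ev t‖ with hd
        have hd0 : 0 ≤ d := norm_nonneg _
        -- Within distance `h` of `1` the size bound suffices; farther away the decay `(h/d)^k` is
        -- raised to the power `q`, and `k q ≥ 2` makes it at most the integrable `(h/d)²`.
        rcases le_or_gt d h with hdh | hdh
        · have : (1 : ℝ) ≤ 4 * (h / (h + d)) ^ 2 := by
            have : 1 / 2 ≤ h / (h + d) := by
              rw [div_le_div_iff₀ two_pos (by positivity)]; linarith
            nlinarith
          calc ‖K (ev t)‖ ^ q ≤ (L / h) ^ q := by gcongr; exact h1 t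
            _ ≤ (L / h) ^ q * (4 * (h / (h + d)) ^ 2) := le_mul_of_one_le_right (by positivity) this
            _ = _ := by ring
        · have hd1 : 0 < d := hh.trans hdh
          have hb : ‖K (ev t)‖ ≤ L / h * (h / d) ^ k := by
            rw [div_pow, ← mul_div_assoc, le_div_iff₀ (by positivity), mul_comm]
            exact (h2 t).trans (le_of_eq (by ring))
          have hx : h / d ≤ 1 := (div_le_one hd1).2 hdh.le
          calc ‖K (ev t)‖ ^ q ≤ (L / h * (h / d) ^ k) ^ q := by gcongr
            _ = (L / h) ^ q * (h / d) ^ (k * q) := by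
                rw [Real.mul_rpow hL (by positivity), ← Real.rpow_natCast, ← Real.rpow_mul
                  (by positivity)]
            _ ≤ (L / h) ^ q * (h / d) ^ (2 : ℝ) := by
                gcongr 1
                exact Real.rpow_le_rpow_of_exponent_ge (by positivity) hx hk
            _ ≤ (L / h) ^ q * (4 * (h / (h + d)) ^ 2) := by
                gcongr 1
                rw [Real.rpow_two, div_pow, div_pow, ← mul_div_assoc, div_le_div_iff₀ (by positivity)
                  (by positivity)]
                have : (h + d) ^ 2 ≤ 4 * d ^ 2 := by nlinarith
                nlinarith [sq_nonneg h]
            _ = _ := by ring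
    _ ≤ (L / h) ^ q * 4 * (h / 2) := by
        rw [integral_const_mul]
        exact mul_le_mul_of_nonneg_left (integral_kernel_weight_le hh) (by positivity)
    _ = _ := by ring

lemma pmean_pser_dilate (p : ℝ) (b : ℕ → ℂ) (ρ r : ℝ) :
    pmean p (pser fun n => b n * (ρ : ℂ) ^ n) r = pmean p (pser b) (ρ * r) := by
  unfold pmean pser
  congr 1; ext t
  congr 3; ext n; push_cast; ring

lemma summable_mul_pow {b : ℕ → ℂ} (hb : Summable fun n => ‖b n‖) {ρ : ℝ} (h0 : 0 ≤ ρ)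
    (h1 : ρ ≤ 1) : Summable fun n => ‖b n * (ρ : ℂ) ^ n‖ :=
  hb.of_nonneg_of_le (fun _ => norm_nonneg _) fun n =>
    norm_term_le (by simpa [abs_of_nonneg h0] using h1) n

lemma summable_hadamard {a b : ℕ → ℂ} (hb : Summable fun n => ‖b n‖)
    (ha : Summable fun n => ‖a n‖) : Summable fun n => ‖b n * a n‖ :=
  (hb.mul_norm ha).comp_injective (i := fun n : ℕ => (n, n)) fun _ _ h => (Prod.mk.inj h).1

/-- Integrating over the rotation first decouples the two factors. The continuity is returned as
well because the callers integrate the inner integral as a function of `s`. -/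
lemma integral_integral_mul_rotate {p : ℝ} (hp : 0 < p) {f g : ℂ → ℂ}
    (hf : ContinuousOn f (Metric.closedBall 0 1)) (hg : ContinuousOn g (Metric.closedBall 0 1))
    {q : ℝ} (hq : 0 < q) {r : ℝ} (hr : 0 ≤ r) (hr1 : r ≤ 1) :
    Continuous (Function.uncurry fun s t : UCirc => ‖f (r * ev s * ev t)‖ ^ p * ‖g (r * ev t)‖ ^ q) ∧
    ∫ s, ∫ t, ‖f (r * ev s * ev t)‖ ^ p * ‖g (r * ev t)‖ ^ q ∂arcMeasure ∂arcMeasure =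
      pmean p f r * pmean q g r := by
  have hcev := continuous_ev
  have hc : Continuous (Function.uncurry fun s t : UCirc =>
      ‖f (r * ev s * ev t)‖ ^ p * ‖g (r * ev t)‖ ^ q) := by
    refine Continuous.mul ?_ ?_
    · exact continuous_norm_rpow_comp hp hf
        (φ := fun x : UCirc × UCirc => (r : ℂ) * ev x.1 * ev x.2) (by fun_prop)
        fun x => by simpa [abs_of_nonneg hr] using hr1
    · exact continuous_norm_rpow_comp hq hg
        (φ := fun x : UCirc × UCirc => (r : ℂ) * ev x.2) (by fun_prop)
        fun x => by simpa [abs_of_nonneg hr] using hr1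
  refine ⟨hc, ?_⟩
  rw [integral_swap_of_continuous hc]
  have : ∀ t : UCirc, ∫ s, ‖f (r * ev s * ev t)‖ ^ p * ‖g (r * ev t)‖ ^ q ∂arcMeasure =
      pmean p f r * ‖g (r * ev t)‖ ^ q := fun t => by
    rw [integral_mul_const]
    congr 1
    have h2 := integral_norm_rotate p f (r * ev t)
    simp only [norm_mul, norm_ev, mul_one, Complex.norm_real, Real.norm_eq_abs,
      abs_of_nonneg hr] at h2
    rw [← h2]
    congr 1; ext s; ring_nf
  simp only [this]
  rw [integral_const_mul]; rfl

/-! ### Hadamard multipliers on circle means. -/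

/-- Hadamard products with a power series `a`, measured in `L^p` for `p ≤ 1`. -/
lemma pmean_hadamard_le_of_le_one {p : ℝ} (hp : 0 < p) (hp1 : p ≤ 1) {h : ℝ} (hh : 0 < h)
    (hh1 : h ≤ 1) {a : ℕ → ℝ} {b : ℕ → ℂ} (ha : Summable fun n => ‖(a n : ℂ)‖)
    (hb : Summable fun n => ‖b n‖) :
    pmean p (pser fun n => (b n * a n) * (Real.exp (-(h / 2)) : ℂ) ^ n) 1 ≤
      (32 / h) ^ (1 - p) * (pmean p (pser b) 1 * pmean p (pser fun n => (a n : ℂ)) 1) := by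
  -- The damping `e^{-hn/2}` is shared equally: `ρ^n` goes to `b` and `ρ^n` to `a`. Since `ρ(1 +
  -- h/4) ≤ 1`, both dilated series are then analytic in the disc of radius `1 + h/4`.
  set ρ : ℝ := Real.exp (-(h / 4)) with hρ
  have hρ0 : 0 < ρ := Real.exp_pos _
  have hρ1 : ρ ≤ 1 := Real.exp_le_one_iff.2 (by linarith)
  have hρ2 : (Real.exp (-(h / 2)) : ℂ) = (ρ : ℂ) * ρ := by
    rw [hρ, ← Complex.ofReal_mul, ← Real.exp_add]; congr 3; ring
  set δ := h / 4 with hδ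
  have hδ0 : 0 < δ := by positivity
  set A := pser fun n => (a n : ℂ) with hA
  set B := pser b with hB
  have hAd := diffContOnCl_pser ha
  have hBd := diffContOnCl_pser hb
  have hcev := continuous_ev
  set r := ρ * (1 + δ) with hr
  have hr0 : 0 ≤ r := by positivity
  have hr1 : r ≤ 1 := by
    have : 1 + δ ≤ Real.exp δ := by linarith [Real.add_one_le_exp δ]
    calc r ≤ ρ * Real.exp δ := mul_le_mul_of_nonneg_left this hρ0.le
      _ = 1 := by rw [hρ, ← Real.exp_add]; simp
  have hdil : ∀ {f : ℂ → ℂ} (u : UCirc), DiffContOnCl ℂ f (Metric.ball 0 1) →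
      DiffContOnCl ℂ (fun w => f (ρ * ev u * w)) (Metric.ball 0 (1 + δ)) := fun {f} u hf => by
    refine hf.comp ((differentiable_const _).mul differentiable_id).diffContOnCl fun w hw => ?_
    rw [mem_ball_zero_iff] at hw ⊢
    rw [norm_mul, norm_mul, norm_ev, mul_one, Complex.norm_real, Real.norm_eq_abs, abs_of_pos hρ0]
    exact (mul_lt_mul_of_pos_left hw hρ0).trans_le hr1
  -- For fixed `s` this product is analytic in `w`, which is what allows its `L¹` mean to be bounded
  -- by an `L^p` mean. The factor `ev 0 = 1` is there so that `hdil` applies to both factors.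
  set F : UCirc → ℂ → ℂ := fun s w => B (ρ * ev s * w) * A (ρ * ev 0 * w) with hF
  have hFd : ∀ s, DiffContOnCl ℂ (F s) (Metric.ball 0 (1 + δ)) := fun s =>
    (hdil s hBd).smul (hdil 0 hAd)
  have hpt : ∀ s : UCirc, ‖pser (fun n => (b n * a n) * (Real.exp (-(h / 2)) : ℂ) ^ n) (ev s)‖ ^ p
      ≤ (8 / δ) ^ (1 - p) * pmean p (F s) (1 + δ) := fun s => by
    refine le_trans ?_ (integral_norm_rpow_le_pmean hp hp1 hδ0 (by rw [hδ]; linarith) (hFd s))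
    refine Real.rpow_le_rpow (norm_nonneg _) ?_ hp.le
    have h1 : (fun n => (b n * a n) * (Real.exp (-(h / 2)) : ℂ) ^ n) =
        fun n => (b n * (ρ : ℂ) ^ n) * ((a n * ρ ^ n : ℝ) : ℂ) := by
      ext n; rw [hρ2, mul_pow]; push_cast; ring
    have h2 : Summable fun n => ‖((a n * ρ ^ n : ℝ) : ℂ)‖ := by
      simpa using summable_mul_pow ha hρ0.le hρ1
    rw [h1, pser_mul_eq_integral h2 (summable_mul_pow hb hρ0.le hρ1) (norm_ev s)]
    refine (norm_integral_le_integral_norm _).trans (le_of_eq ?_)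
    congr 1; ext t
    rw [norm_mul, norm_pser_conj (fun n => a n * ρ ^ n), hF, norm_mul]
    congr 2
    · simp only [hB, pser]; congr 1; ext n; ring
    · simp only [hA, pser]; congr 1; ext n; push_cast; simp; ring
  have hBc := continuousOn_pser hb
  have hAc := continuousOn_pser ha
  obtain ⟨hc, hint⟩ := integral_integral_mul_rotate hp hBc hAc hp hr0 hr1
  have hFm : ∀ s, pmean p (F s) (1 + δ) =
      ∫ t, ‖B (r * ev s * ev t)‖ ^ p * ‖A (r * ev t)‖ ^ p ∂arcMeasure := fun s => by
    unfold pmean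
    congr 1; ext t
    rw [← Real.mul_rpow (norm_nonneg _) (norm_nonneg _), ← norm_mul, hF, hr]
    have e1 : (ρ : ℂ) * ev s * ((1 + δ : ℝ) * ev t) = (ρ * (1 + δ) : ℝ) * ev s * ev t := by
      push_cast; ring
    have e2 : (ρ : ℂ) * ev 0 * ((1 + δ : ℝ) * ev t) = (ρ * (1 + δ) : ℝ) * ev t := by
      rw [ev_zero]; push_cast; ring
    simp only [e1, e2]
  have hle1 : pmean p B r ≤ pmean p B 1 := pmean_mono hp hBd hr0 hr1
  have hle2 : pmean p A r ≤ pmean p A 1 := pmean_mono hp hAd hr0 hr1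
  have h8 : 8 / δ = 32 / h := by rw [hδ]; field_simp; norm_num
  have hsum : Summable fun n => ‖(b n * a n) * (Real.exp (-(h / 2)) : ℂ) ^ n‖ := by
    have h9 : Summable fun n => ‖b n * (a n : ℂ)‖ := summable_hadamard hb ha
    exact summable_mul_pow h9 (Real.exp_pos _).le (Real.exp_le_one_iff.2 (by linarith))
  calc pmean p (pser fun n => (b n * a n) * (Real.exp (-(h / 2)) : ℂ) ^ n) 1
      = ∫ s, ‖pser (fun n => (b n * a n) * (Real.exp (-(h / 2)) : ℂ) ^ n) (ev s)‖ ^ p ∂arcMeasure := by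
        simp [pmean]
    _ ≤ ∫ s, (8 / δ) ^ (1 - p) * ∫ t, ‖B (r * ev s * ev t)‖ ^ p * ‖A (r * ev t)‖ ^ p
          ∂arcMeasure ∂arcMeasure := by
        refine integral_mono (integrable_of_continuous ?_)
          ((integrable_of_continuous (continuous_integral hc)).const_mul _) fun s => ?_
        · exact continuous_norm_rpow_comp hp (continuousOn_pser hsum) hcev fun t => by simp
        · simp only; rw [← hFm]; exact hpt s
    _ = (32 / h) ^ (1 - p) * (pmean p B r * pmean p A r) := by
        rw [integral_const_mul, hint, h8]
    _ ≤ _ := by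
        have := pmean_nonneg p B r
        have := pmean_nonneg p A r
        have := pmean_nonneg p B 1
        gcongr

/-- Hadamard products with a power series `a`, measured in `L^p` for `p ≥ 1`. -/
lemma pmean_hadamard_le_of_one_lt {p : ℝ} (hp1 : 1 < p) {a : ℕ → ℝ} {b : ℕ → ℂ}
    (ha : Summable fun n => ‖(a n : ℂ)‖) (hb : Summable fun n => ‖b n‖) :
    pmean p (pser fun n => b n * a n) 1 ≤
      pmean 1 (pser fun n => (a n : ℂ)) 1 ^ p * pmean p (pser b) 1 := by
  have hp : 0 < p := by linarith
  set A := pser fun n => (a n : ℂ) with hA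
  set B := pser b with hB
  have hAc := continuousOn_pser ha
  have hBc := continuousOn_pser hb
  have hcev := continuous_ev
  obtain ⟨hc, hint⟩ := integral_integral_mul_rotate hp hBc hAc one_pos zero_le_one le_rfl
  simp only [Complex.ofReal_one, one_mul, Real.rpow_one] at hc hint
  set κ := pmean 1 A 1 with hκ
  have hκ0 : 0 ≤ κ := pmean_nonneg _ _ _
  have hsum : Summable fun n => ‖b n * (a n : ℂ)‖ := summable_hadamard hb ha
  have hconj : p.HolderConjugate (p / (p - 1)) := Real.HolderConjugate.conjExponent hp1
  have hpt : ∀ s : UCirc, ‖pser (fun n => b n * a n) (ev s)‖ ^ p ≤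
      κ ^ (p - 1) * ∫ t, ‖B (ev s * ev t)‖ ^ p * ‖A (ev t)‖ ∂arcMeasure := fun s => by
    have hcB : Continuous fun t : UCirc => ‖B (ev s * ev t)‖ :=
      (hBc.comp_continuous (by fun_prop) fun t => by simp).norm
    have hcA : Continuous fun t : UCirc => ‖A (ev t)‖ :=
      (hAc.comp_continuous (by fun_prop) fun t => by simp).norm
    have hq : 0 < p / (p - 1) := div_pos hp (by linarith)
    have hfc : Continuous fun t : UCirc => ‖B (ev s * ev t)‖ * ‖A (ev t)‖ ^ (1 / p) :=
      hcB.mul (hcA.rpow_const fun _ => Or.inr (by positivity))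
    have hgc : Continuous fun t : UCirc => ‖A (ev t)‖ ^ (1 / (p / (p - 1))) :=
      hcA.rpow_const fun _ => Or.inr (by positivity)
    have hmem : ∀ {f : UCirc → ℝ} (_ : Continuous f) (e : ENNReal), MemLp f e arcMeasure :=
      fun {f} hf e => by
        obtain ⟨C, hC⟩ := (isCompact_range hf).isBounded.exists_norm_le
        exact MemLp.of_bound hf.aestronglyMeasurable C
          (Filter.Eventually.of_forall fun t => hC _ ⟨t, rfl⟩)
    -- Hölder for the measure `|A| dt`: the kernel is split as `|A|^{1/p} |A|^{1/q}`, where `q =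
    -- p/(p-1)`.
    have hH := integral_mul_le_Lp_mul_Lq_of_nonneg (μ := arcMeasure) hconj
      (f := fun t : UCirc => ‖B (ev s * ev t)‖ * ‖A (ev t)‖ ^ (1 / p))
      (g := fun t : UCirc => ‖A (ev t)‖ ^ (1 / (p / (p - 1))))
      (Filter.Eventually.of_forall fun t => by positivity)
      (Filter.Eventually.of_forall fun t => by positivity) (hmem hfc _) (hmem hgc _)
    have e1 : ∀ t : UCirc, ‖B (ev s * ev t)‖ * ‖A (ev t)‖ ^ (1 / p) *
        ‖A (ev t)‖ ^ (1 / (p / (p - 1))) = ‖B (ev s * ev t)‖ * ‖A (ev t)‖ := fun t => by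
      rw [mul_assoc]
      congr 1
      rw [← Real.rpow_add_of_nonneg (norm_nonneg _) (by positivity) (by positivity)]
      rw [show 1 / p + 1 / (p / (p - 1)) = 1 by field_simp; ring, Real.rpow_one]
    have e2 : ∀ t : UCirc, (‖B (ev s * ev t)‖ * ‖A (ev t)‖ ^ (1 / p)) ^ p =
        ‖B (ev s * ev t)‖ ^ p * ‖A (ev t)‖ := fun t => by
      rw [Real.mul_rpow (norm_nonneg _) (by positivity), ← Real.rpow_mul (norm_nonneg _),
        one_div_mul_cancel hp.ne', Real.rpow_one]
    have e3 : ∀ t : UCirc, (‖A (ev t)‖ ^ (1 / (p / (p - 1)))) ^ (p / (p - 1)) = ‖A (ev t)‖ :=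
      fun t => by
        rw [← Real.rpow_mul (norm_nonneg _), one_div_mul_cancel hq.ne', Real.rpow_one]
    simp only [e1, e2, e3] at hH
    have hκ' : ∫ t, ‖A (ev t)‖ ∂arcMeasure = κ := by simp [hκ, pmean]
    rw [hκ'] at hH
    set X := ∫ t, ‖B (ev s * ev t)‖ ^ p * ‖A (ev t)‖ ∂arcMeasure with hX
    have hX0 : 0 ≤ X := integral_nonneg fun t => by positivity
    have hle : ‖pser (fun n => b n * a n) (ev s)‖ ≤ X ^ (1 / p) * κ ^ (1 / (p / (p - 1))) := by
      rw [pser_mul_eq_integral ha hb (norm_ev s)]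
      refine (norm_integral_le_integral_norm _).trans (le_trans (le_of_eq ?_) hH)
      congr 1; ext t
      rw [norm_mul, norm_pser_conj]
    calc _ ≤ (X ^ (1 / p) * κ ^ (1 / (p / (p - 1)))) ^ p := by gcongr
      _ = X * κ ^ (p - 1) := by
          rw [Real.mul_rpow (by positivity) (by positivity), ← Real.rpow_mul hX0,
            ← Real.rpow_mul hκ0, one_div_mul_cancel hp.ne', Real.rpow_one]
          congr 2; field_simp
      _ = _ := mul_comm _ _
  calc pmean p (pser fun n => b n * a n) 1
      = ∫ s, ‖pser (fun n => b n * a n) (ev s)‖ ^ p ∂arcMeasure := by simp [pmean]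
    _ ≤ ∫ s, κ ^ (p - 1) * ∫ t, ‖B (ev s * ev t)‖ ^ p * ‖A (ev t)‖ ∂arcMeasure ∂arcMeasure := by
        refine integral_mono (integrable_of_continuous ?_)
          ((integrable_of_continuous (continuous_integral hc)).const_mul _) hpt
        exact continuous_norm_rpow_comp hp (continuousOn_pser hsum) hcev fun t => by simp
    _ = κ ^ (p - 1) * (pmean p B 1 * κ) := by rw [integral_const_mul, hint]
    _ = κ ^ p * pmean p B 1 := by
        have : κ ^ p = κ ^ (p - 1) * κ := by
          nth_rewrite 3 [← Real.rpow_one κ]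
          rw [← Real.rpow_add_of_nonneg hκ0 (by linarith) zero_le_one]; simp
        rw [this]; ring

/-- The multiplier estimate for one frequency block at scale `1 / h`. -/
lemma pmean_block_le {p : ℝ} (hp : 0 < p) {k : ℕ} (hk : 2 ≤ k * min p 1) {h L : ℝ} (hh : 0 < h)
    (hh1 : h ≤ 1) {a : ℕ → ℝ} {b : ℕ → ℂ} (ha : Summable fun n => ‖(a n : ℂ)‖)
    (hb : Summable fun n => ‖b n‖) (h1 : ∀ t, ‖pser (fun n => (a n : ℂ)) (ev t)‖ ≤ L / h)
    (h2 : ∀ t, ‖1 - ev t‖ ^ k * ‖pser (fun n => (a n : ℂ)) (ev t)‖ ≤ L * h ^ k / h) :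
    pmean p (pser fun n => (b n * a n) * (Real.exp (-(h / 2)) : ℂ) ^ n) 1 ≤
      (64 + 2 ^ p) * L ^ p * pmean p (pser b) 1 := by
  have hLh : 0 ≤ L / h := (norm_nonneg _).trans (h1 0)
  have hL : 0 ≤ L := by
    have := mul_nonneg hLh hh.le; rwa [div_mul_cancel₀ _ hh.ne'] at this
  have hB0 := pmean_nonneg p (pser b) 1
  rcases le_or_gt p 1 with hp1 | hp1
  · rw [min_eq_left hp1] at hk
    have hker := pmean_kernel_le hp hk hh (continuousOn_pser ha) h1 h2
    refine (pmean_hadamard_le_of_le_one hp hp1 hh hh1 ha hb).trans ?_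
    calc _ ≤ (32 / h) ^ (1 - p) * (pmean p (pser b) 1 * (2 * (L / h) ^ p * h)) := by gcongr
      -- The powers of `h` cancel: `h^{-(1-p)}` from passing to `L¹` means, `h^{-p}` from the height
      -- of the kernel and `h` from the width of its bump.
      _ = (2 * 32 ^ (1 - p)) * L ^ p * pmean p (pser b) 1 * (h / (h ^ (1 - p) * h ^ p)) := by
          rw [Real.div_rpow (by norm_num) hh.le, Real.div_rpow hL hh.le]
          field_simp
      _ = (2 * 32 ^ (1 - p)) * L ^ p * pmean p (pser b) 1 := by
          rw [← Real.rpow_add hh, sub_add_cancel, Real.rpow_one, div_self hh.ne', mul_one]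
      _ ≤ _ := by
          have h3 : (32 : ℝ) ^ (1 - p) ≤ 32 ^ (1 : ℝ) :=
            Real.rpow_le_rpow_of_exponent_le (by norm_num) (by linarith)
          rw [Real.rpow_one] at h3
          have : (0 : ℝ) ≤ 2 ^ p := by positivity
          gcongr; linarith
  · rw [min_eq_right hp1.le] at hk
    have hker := pmean_kernel_le one_pos hk hh (continuousOn_pser ha) h1 h2
    have hker' : pmean 1 (pser fun n => (a n : ℂ)) 1 ≤ 2 * L := by
      refine hker.trans (le_of_eq ?_); rw [Real.rpow_one]; field_simp
    have hsum : Summable fun n => ‖b n * (a n : ℂ)‖ := summable_hadamard hb ha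
    -- For `p > 1` the damping is not needed: it is a dilation, and dropping it only increases the
    -- mean.
    calc _ = pmean p (pser fun n => b n * a n) (Real.exp (-(h / 2)) * 1) := pmean_pser_dilate _ _ _ _
      _ ≤ pmean p (pser fun n => b n * a n) 1 := by
          refine pmean_mono hp (diffContOnCl_pser hsum) (by positivity) ?_
          rw [mul_one]; exact Real.exp_le_one_iff.2 (by linarith)
      _ ≤ _ := pmean_hadamard_le_of_one_lt hp1 ha hb
      _ ≤ (2 * L) ^ p * pmean p (pser b) 1 := by
          have := pmean_nonneg 1 (pser fun n => (a n : ℂ)) 1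
          gcongr
      _ ≤ _ := by
          rw [Real.mul_rpow (by norm_num) hL]
          gcongr; linarith

/-! ### Symbol calculus for sequences. -/

/-- Forward difference of a sequence. -/
def dif (a : ℕ → ℝ) (n : ℕ) : ℝ := a (n + 1) - a n

/-- Symbol estimates of order `k` with weight `W`, uniform over a family of sequences: the `j`-th
differences are dominated by `W n / (n + 1) ^ j` for `j ≤ k`. -/
def Symb {ι : Type} : ℕ → (ι → ℕ → ℝ) → (ι → ℕ → ℝ) → Prop
  | 0, W, a => (∀ i n, 0 ≤ W i n) ∧ ∃ C : ℝ, 0 ≤ C ∧ ∀ i n, |a i n| ≤ C * W i n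
  | k + 1, W, a => ((∀ i n, 0 ≤ W i n) ∧ ∃ C : ℝ, 0 ≤ C ∧ ∀ i n, |a i n| ≤ C * W i n) ∧
      Symb k (fun i n => W i n / (n + 1)) (fun i => dif (a i))

namespace Symb

variable {ι : Type} {W W' a b : ι → ℕ → ℝ} {k : ℕ}

lemma base (h : Symb k W a) :
    (∀ i n, 0 ≤ W i n) ∧ ∃ C : ℝ, 0 ≤ C ∧ ∀ i n, |a i n| ≤ C * W i n := by
  cases k with
  | zero => exact h
  | succ k => exact h.1

lemma pred (h : Symb (k + 1) W a) : Symb k W a := by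
  induction k generalizing W a with
  | zero => exact h.1
  | succ k ih => exact ⟨h.1, ih h.2⟩

lemma mono (h : Symb k W a) (c : ℝ) (hc : 0 ≤ c) (hW' : ∀ i n, 0 ≤ W' i n)
    (hWW : ∀ i n, W i n ≤ c * W' i n) : Symb k W' a := by
  have key : ∀ {W W' a : ι → ℕ → ℝ}, (∀ i n, 0 ≤ W' i n) → (∀ i n, W i n ≤ c * W' i n) →
      ((∀ i n, 0 ≤ W i n) ∧ ∃ C : ℝ, 0 ≤ C ∧ ∀ i n, |a i n| ≤ C * W i n) →
      ((∀ i n, 0 ≤ W' i n) ∧ ∃ C : ℝ, 0 ≤ C ∧ ∀ i n, |a i n| ≤ C * W' i n) := by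
    rintro W W' a h1 h2 ⟨_, C, hC, h⟩
    exact ⟨h1, C * c, by positivity, fun i n => (h i n).trans <| by
      rw [mul_assoc]; exact mul_le_mul_of_nonneg_left (h2 i n) hC⟩
  induction k generalizing W W' a with
  | zero => exact key hW' hWW h
  | succ k ih =>
    refine ⟨key hW' hWW h.1, ih h.2 (fun i n => by have := hW' i n; positivity) fun i n => ?_⟩
    rw [← mul_div_assoc]; gcongr; exact hWW i n

lemma add (ha : Symb k W a) (hb : Symb k W b) : Symb k W (fun i n => a i n + b i n) := by
  have key : ∀ {W a b : ι → ℕ → ℝ},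
      ((∀ i n, 0 ≤ W i n) ∧ ∃ C : ℝ, 0 ≤ C ∧ ∀ i n, |a i n| ≤ C * W i n) →
      ((∀ i n, 0 ≤ W i n) ∧ ∃ C : ℝ, 0 ≤ C ∧ ∀ i n, |b i n| ≤ C * W i n) →
      ((∀ i n, 0 ≤ W i n) ∧ ∃ C : ℝ, 0 ≤ C ∧ ∀ i n, |a i n + b i n| ≤ C * W i n) := by
    rintro W a b ⟨h, C, hC, h1⟩ ⟨_, D, hD, h2⟩
    refine ⟨h, C + D, by positivity, fun i n => (abs_add_le _ _).trans ?_⟩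
    rw [add_mul]; exact add_le_add (h1 i n) (h2 i n)
  induction k generalizing W a b with
  | zero => exact key ha hb
  | succ k ih =>
    refine ⟨key ha.1 hb.1, ?_⟩
    have := ih ha.2 hb.2
    convert this using 3 with i n
    simp only [dif]; ring

/-- Discrete Leibniz rule `Δ(ab) = a Δb + b Δa + Δa Δb`; the last term carries one more factor
`1/(n+1)` than is needed. -/
lemma mul (ha : Symb k W a) (hb : Symb k W' b) :
    Symb k (fun i n => W i n * W' i n) (fun i n => a i n * b i n) := by
  have key : ∀ {W W' a b : ι → ℕ → ℝ},
      ((∀ i n, 0 ≤ W i n) ∧ ∃ C : ℝ, 0 ≤ C ∧ ∀ i n, |a i n| ≤ C * W i n) →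
      ((∀ i n, 0 ≤ W' i n) ∧ ∃ C : ℝ, 0 ≤ C ∧ ∀ i n, |b i n| ≤ C * W' i n) →
      ((∀ i n, 0 ≤ W i n * W' i n) ∧
        ∃ C : ℝ, 0 ≤ C ∧ ∀ i n, |a i n * b i n| ≤ C * (W i n * W' i n)) := by
    rintro W W' a b ⟨h, C, hC, h1⟩ ⟨h', D, hD, h2⟩
    refine ⟨fun i n => mul_nonneg (h i n) (h' i n), C * D, by positivity, fun i n => ?_⟩
    rw [abs_mul, mul_mul_mul_comm]
    exact mul_le_mul (h1 i n) (h2 i n) (abs_nonneg _) (mul_nonneg hC (h i n))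
  induction k generalizing W W' a b with
  | zero => exact key ha hb
  | succ k ih =>
    refine ⟨key ha.1 hb.1, ?_⟩
    have hW := ha.1.1
    have hW' := hb.1.1
    have hnn : ∀ i (n : ℕ), 0 ≤ W i n * W' i n / (n + 1) := fun i n => by
      have := hW i n; have := hW' i n; positivity
    have h1 := (ih ha.pred hb.2).mono (W' := fun i n => W i n * W' i n / (n + 1)) 1 zero_le_one hnn
      fun i n => le_of_eq (by ring)
    have h2 := (ih ha.2 hb.pred).mono (W' := fun i n => W i n * W' i n / (n + 1)) 1 zero_le_one hnn
      fun i n => le_of_eq (by ring)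
    have h3 := (ih ha.2 hb.2).mono (W' := fun i n => W i n * W' i n / (n + 1)) 1 zero_le_one hnn
      fun i n => by
        have h4 := hnn i n
        rw [one_mul, div_mul_div_comm, mul_comm ((n : ℝ) + 1), ← div_div]
        exact div_le_self h4 (by simp)
    convert (h1.add h2).add h3 using 3 with i n
    simp only [dif]; ring

/-- The recursive definition suits the algebra, while explicit iterated differences suit concrete
estimates; `of_iterate` and `iterate` pass between them. -/
lemma of_iterate (hW : ∀ i n, 0 ≤ W i n)
    (h : ∀ j ≤ k, ∃ C : ℝ, 0 ≤ C ∧ ∀ i n, |dif^[j] (a i) n| ≤ C * (W i n / ((n : ℝ) + 1) ^ j)) :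
    Symb k W a := by
  have h0 : (∀ i n, 0 ≤ W i n) ∧ ∃ C : ℝ, 0 ≤ C ∧ ∀ i n, |a i n| ≤ C * W i n := by
    obtain ⟨C, hC, hb⟩ := h 0 (Nat.zero_le _)
    exact ⟨hW, C, hC, fun i n => by simpa using hb i n⟩
  induction k generalizing W a with
  | zero => exact h0
  | succ k ih =>
    have h' : ∀ j ≤ k, ∃ C : ℝ, 0 ≤ C ∧ ∀ i n,
        |dif^[j] (dif (a i)) n| ≤ C * ((W i n / (n + 1)) / ((n : ℝ) + 1) ^ j) := fun j hj => by
      obtain ⟨C, hC, hb⟩ := h (j + 1) (by omega)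
      exact ⟨C, hC, fun i n => (hb i n).trans (le_of_eq (by rw [div_div, ← pow_succ']))⟩
    have hW1 : ∀ i (n : ℕ), 0 ≤ W i n / ((n : ℝ) + 1) := fun i n => by
      have := hW i n; positivity
    refine ⟨h0, ih hW1 h' ?_⟩
    obtain ⟨C, hC, hb⟩ := h' 0 (Nat.zero_le _)
    exact ⟨hW1, C, hC, fun i n => by simpa using hb i n⟩

lemma iterate (h : Symb k W a) : ∃ C : ℝ, 0 ≤ C ∧ ∀ j ≤ k, ∀ i n,
    |dif^[j] (a i) n| ≤ C * (W i n / ((n : ℝ) + 1) ^ j) := by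
  induction k generalizing W a with
  | zero =>
    obtain ⟨_, C, hC, hb⟩ := h
    exact ⟨C, hC, fun j hj i n => by simpa [Nat.le_zero.1 hj] using hb i n⟩
  | succ k ih =>
    obtain ⟨⟨hW, C, hC, hb⟩, h2⟩ := h
    obtain ⟨D, hD, hd⟩ := ih h2
    refine ⟨C + D, by positivity, fun j hj i n => ?_⟩
    have hw := hW i n
    rcases j with _ | j
    · simp only [Function.iterate_zero, id, pow_zero, div_one]
      refine (hb i n).trans ?_
      gcongr; linarith
    · rw [Function.iterate_succ_apply]
      refine (hd j (by omega) i n).trans ?_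
      rw [div_div, ← pow_succ']
      gcongr; linarith

lemma const (w : ι → ℝ) (hw : ∀ i, 0 ≤ w i) : Symb k (fun i _ => w i) (fun i _ => w i) := by
  refine of_iterate (fun i _ => hw i) fun j _ => ⟨1, zero_le_one, fun i n => ?_⟩
  rcases j with _ | j
  · simp [abs_of_nonneg (hw i)]
  · have : dif (fun _ => w i) = fun _ => 0 := by ext; simp [dif]
    have h0 : ∀ j : ℕ, dif^[j] (fun _ => (0 : ℝ)) = fun _ => 0 := fun j => by
      induction j with
      | zero => rfl
      | succ j ih => rw [Function.iterate_succ_apply', ih]; ext; simp [dif]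
    rw [Function.iterate_succ_apply, this, h0, abs_zero]
    have := hw i; positivity

lemma const_mul (h : Symb k W a) (c : ℝ) : Symb k W (fun i n => c * a i n) := by
  have h1 : ∀ (c : ℝ), 0 ≤ c → Symb k W (fun i n => c * a i n) := fun c hc =>
    ((const (ι := ι) (k := k) (fun _ => c) fun _ => hc).mul h).mono c hc h.base.1
      fun i n => le_rfl
  rcases le_total 0 c with hc | hc
  · exact h1 c hc
  · have hneg : Symb k W (fun i n => -a i n) := by
      clear h1
      induction k generalizing W a with
      | zero => simpa [Symb] using h
      | succ k ih =>
        refine ⟨by simpa using h.1, ?_⟩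
        convert ih h.2 using 3 with i n
        simp only [dif]; ring
    have h2 : Symb k W (fun i n => -c * -a i n) :=
      ((const (ι := ι) (k := k) (fun _ => -c) fun _ => by linarith).mul hneg).mono (-c)
        (by linarith) h.base.1 fun i n => le_rfl
    simpa using h2

lemma pow (h : Symb k W a) (m : ℕ) : Symb k (fun i n => W i n ^ m) (fun i n => a i n ^ m) := by
  induction m with
  | zero => simpa using const (ι := ι) (k := k) (fun _ => 1) fun _ => zero_le_one
  | succ m ih => simpa only [pow_succ] using ih.mul h

lemma sum {m : ℕ} {f : ℕ → ι → ℕ → ℝ} (hW : ∀ i n, 0 ≤ W i n) (h : ∀ j < m, Symb k W (f j)) :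
    Symb k W (fun i n => ∑ j ∈ Finset.range m, f j i n) := by
  induction m with
  | zero =>
    simp only [Finset.range_zero, Finset.sum_empty]
    exact (const (ι := ι) (k := k) (fun _ => 0) fun _ => le_rfl).mono 0 le_rfl hW (by simp)
  | succ m ih =>
    simp only [Finset.sum_range_succ]
    exact (ih fun j hj => h j (by omega)).add (h m (by omega))

/-- The reciprocal of a positive slowly varying symbol is a symbol. -/
lemma inv {m : ι → ℕ → ℝ} (hm : ∀ i n, 0 < m i n) (c : ℝ) (hc : ∀ i n, m i n ≤ c * m i (n + 1))
    (h : Symb k m m) : Symb k (fun i n => (m i n)⁻¹) (fun i n => (m i n)⁻¹) := by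
  have h0 : ∀ {m : ι → ℕ → ℝ}, (∀ i n, 0 < m i n) → (∀ i n, 0 ≤ (m i n)⁻¹) ∧
      ∃ C : ℝ, 0 ≤ C ∧ ∀ i n, |(m i n)⁻¹| ≤ C * (m i n)⁻¹ := fun hm =>
    ⟨fun i n => (inv_pos.2 (hm i n)).le, 1, zero_le_one, fun i n => by
      rw [one_mul, abs_of_pos (inv_pos.2 (hm i n))]⟩
  induction k generalizing m with
  | zero => exact h0 hm
  | succ k ih =>
    refine ⟨h0 hm, ?_⟩
    have hc0 : ∀ i (n : ℕ), 0 ≤ c := fun i n => by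
      by_contra hneg
      push Not at hneg
      have := hc i n
      nlinarith [hm i n, hm i (n + 1)]
    -- The sign of `c` is forced only if the family has a member.
    rcases isEmpty_or_nonempty ι with hι | ⟨⟨i₀⟩⟩
    · refine of_iterate (fun i => hι.elim i) fun j _ => ⟨0, le_rfl, fun i => hι.elim i⟩
    have hc0 := hc0 i₀ 0
    have hshift : Symb k m (fun i n => m i (n + 1)) := by
      have h1 := h.2.mono (W' := m) 1 zero_le_one (fun i n => (hm i n).le) fun i n => by
        rw [one_mul]; exact div_le_self (hm i n).le (by simp)
      convert h.pred.add h1 using 3 with i n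
      simp [dif]
    have hshift' := hshift.mono (W' := fun i n => m i (n + 1)) c hc0 (fun i n => (hm i _).le) hc
    have i1 := ih hm hc h.pred
    have i2 := ih (m := fun i n => m i (n + 1)) (fun i n => hm i _) (fun i n => hc i _) hshift'
    -- `Δ(1/m)_n = -Δm_n / (m_n m_{n+1})`. The induction hypothesis is applied to `m` and to its
    -- shift, and slow variation replaces `1/m_{n+1}` by `c/m_n`.
    have := ((h.2.mul (i1.mul i2)).const_mul (-1)).mono
      (W' := fun i n => (m i n)⁻¹ / ((n : ℝ) + 1)) c hc0
      (fun i n => by have := hm i n; positivity) fun i n => by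
        have h1 := hm i n
        have h2 := hm i (n + 1)
        have h3 : (m i (n + 1))⁻¹ ≤ c * (m i n)⁻¹ := by
          rw [← div_eq_mul_inv, le_div_iff₀ h1, inv_mul_le_iff₀ h2, mul_comm]; exact hc i n
        calc _ = (m i (n + 1))⁻¹ * (1 / ((n : ℝ) + 1)) := by field_simp
          _ ≤ c * (m i n)⁻¹ * (1 / ((n : ℝ) + 1)) := by gcongr
          _ = _ := by ring
    convert this using 3 with i n
    have h1 := (hm i n).ne'
    have h2 := (hm i (n + 1)).ne'
    simp only [dif]; field_simp; ring

end Symb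

/-! ### Exponential symbols and summation by parts. -/

lemma pow_mul_exp_neg_le {c : ℝ} (hc : 0 < c) (m : ℕ) {x : ℝ} (hx : 0 ≤ x) :
    x ^ m * Real.exp (-(c * x)) ≤ m.factorial / c ^ m := by
  have h := Real.pow_div_factorial_le_exp (c * x) (by positivity) m
  rw [Real.exp_neg, ← div_eq_mul_inv, div_le_div_iff₀ (Real.exp_pos _) (by positivity)]
  rw [div_le_iff₀ (by positivity), mul_pow] at h
  linarith

/-- Differences of a geometric sequence are explicit: the `j`-th one multiplies it by `(e^{-ch} -
1)^j = O(h^j)`. Half of the exponential pays for `(h(n+1))^j`, and the other half remains as the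
weight. -/
lemma symb_exp {ι : Type} {h : ι → ℝ} (hh : ∀ i, 0 < h i ∧ h i ≤ 1) {c : ℝ} (hc : 0 < c) (k : ℕ) :
    Symb k (fun i n => Real.exp (-(c / 2 * h i * n))) (fun i n => Real.exp (-(c * h i * n))) := by
  refine Symb.of_iterate (fun i n => (Real.exp_pos _).le) fun j _ =>
    ⟨c ^ j * (Real.exp (c / 2) * (j.factorial / (c / 2) ^ j)), by positivity, fun i n => ?_⟩
  obtain ⟨h0, h1⟩ := hh i
  have hit : ∀ j : ℕ, dif^[j] (fun n : ℕ => Real.exp (-(c * h i * n))) =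
      fun n : ℕ => (Real.exp (-(c * h i)) - 1) ^ j * Real.exp (-(c * h i * n)) := fun j => by
    induction j with
    | zero => ext; simp
    | succ j ih =>
      rw [Function.iterate_succ_apply', ih]
      ext n
      have : Real.exp (-(c * h i * ((n + 1 : ℕ) : ℝ))) =
          Real.exp (-(c * h i)) * Real.exp (-(c * h i * n)) := by
        rw [← Real.exp_add]; congr 1; push_cast; ring
      simp only [dif, this]; ring
  rw [hit, abs_mul, abs_pow, abs_of_pos (Real.exp_pos _)]
  have h2 : |Real.exp (-(c * h i)) - 1| ≤ c * h i := by
    have := Real.add_one_le_exp (-(c * h i))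
    have h3 : Real.exp (-(c * h i)) ≤ 1 := Real.exp_le_one_iff.2 (by nlinarith)
    rw [abs_of_nonpos (by linarith)]; linarith
  have hn : (0 : ℝ) < (n : ℝ) + 1 := by positivity
  rw [← mul_div_assoc, le_div_iff₀ (by positivity)]
  have hsplit : Real.exp (-(c * h i * n)) = Real.exp (c / 2 * h i) *
      Real.exp (-(c / 2 * (h i * (n + 1)))) * Real.exp (-(c / 2 * h i * n)) := by
    rw [← Real.exp_add, ← Real.exp_add]; congr 1; ring
  calc |Real.exp (-(c * h i)) - 1| ^ j * Real.exp (-(c * h i * n)) * ((n : ℝ) + 1) ^ j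
      ≤ (c * h i) ^ j * Real.exp (-(c * h i * n)) * ((n : ℝ) + 1) ^ j := by gcongr
    _ = c ^ j * (Real.exp (c / 2 * h i) * ((h i * (n + 1)) ^ j *
          Real.exp (-(c / 2 * (h i * (n + 1)))))) * Real.exp (-(c / 2 * h i * n)) := by
        rw [hsplit, mul_pow (h i), mul_pow c]; ring
    _ ≤ _ := by
        gcongr
        · nlinarith
        · exact pow_mul_exp_neg_le (by positivity) j (by positivity)

/-- The first difference is `(1 - e^{-h}) e^{-hn}`, a symbol of size `h`, and the weight divided by
`n + 1` is `h`. Order `k + 1` is treated in order to separate the value from the differences for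
every `k`. -/
lemma symb_one_sub_exp {ι : Type} {h : ι → ℝ} (hh : ∀ i, 0 < h i ∧ h i ≤ 1) (k : ℕ) :
    Symb k (fun i n => ((n : ℝ) + 1) * h i) (fun i n => 1 - Real.exp (-(h i * n))) := by
  suffices Symb (k + 1) (fun i n => ((n : ℝ) + 1) * h i) (fun i n => 1 - Real.exp (-(h i * n))) from
    this.pred
  have hnn : ∀ i (n : ℕ), 0 ≤ ((n : ℝ) + 1) * h i := fun i n => by
    have := (hh i).1; positivity
  refine ⟨⟨hnn, 1, zero_le_one, fun i n => ?_⟩, ?_⟩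
  · have h0 := (hh i).1
    have := Real.add_one_le_exp (-(h i * n))
    have h3 : Real.exp (-(h i * n)) ≤ 1 := Real.exp_le_one_iff.2 (by
      have : 0 ≤ h i * n := by positivity
      linarith)
    rw [abs_of_nonneg (by linarith)]; linarith
  · have hw : ∀ i, 0 ≤ 1 - Real.exp (-(h i)) := fun i => by
      have := Real.exp_le_one_iff.2 (show -(h i) ≤ 0 by linarith [(hh i).1]); linarith
    have h1 := (Symb.const (k := k) (fun i => 1 - Real.exp (-(h i))) hw).mul
      (symb_exp hh one_pos k)
    have h2 := h1.mono (W' := fun i (n : ℕ) => ((n : ℝ) + 1) * h i / ((n : ℝ) + 1)) 1 zero_le_one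
      (fun i n => div_nonneg (hnn i n) (by positivity)) fun i n => by
        have h0 := (hh i).1
        have h4 : ((n : ℝ) + 1) * h i / ((n : ℝ) + 1) = h i := by field_simp
        rw [h4, one_mul]
        have h5 : Real.exp (-(1 / 2 * h i * n)) ≤ 1 := Real.exp_le_one_iff.2 (by
          have : 0 ≤ 1 / 2 * h i * n := by positivity
          linarith)
        have := Real.add_one_le_exp (-(h i))
        have := hw i
        calc _ ≤ (1 - Real.exp (-(h i))) * 1 := by gcongr
          _ ≤ h i := by linarith
    convert h2 using 3 with i n
    have : Real.exp (-(h i * ((n + 1 : ℕ) : ℝ))) =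
        Real.exp (-(h i)) * Real.exp (-(1 * h i * n)) := by
      rw [← Real.exp_add]; congr 1; push_cast; ring
    simp only [dif, this, one_mul]; ring

lemma summable_dif {a : ℕ → ℝ} (ha : Summable fun n => |a n|) : Summable fun n => |dif a n| := by
  have h1 : Summable fun n => |a (n + 1)| := (summable_nat_add_iff 1).2 ha
  refine (h1.add ha).of_nonneg_of_le (fun _ => abs_nonneg _) fun n => ?_
  exact abs_sub _ _

/-- Repeated summation by parts on the unit circle. -/
lemma norm_one_sub_pow_mul_pser_le {a : ℕ → ℝ} (ha : Summable fun n => |a n|) {z : ℂ}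
    (hz : ‖z‖ = 1) (k : ℕ) :
    ‖1 - z‖ ^ k * ‖pser (fun n => (a n : ℂ)) z‖ ≤
      2 ^ k * ∑ j ∈ Finset.range k, |dif^[j] a 0| + ∑' n, |dif^[k] a n| := by
  induction k generalizing a with
  | zero =>
    simp only [pow_zero, one_mul, Finset.range_zero, Finset.sum_empty, mul_zero, zero_add,
      Function.iterate_zero, id, pser]
    have : ∀ n, ‖(a n : ℂ) * z ^ n‖ = |a n| := fun n => by simp [hz]
    refine (norm_tsum_le_tsum_norm (by simpa only [this] using ha)).trans (le_of_eq ?_)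
    simp only [this]
  | succ k ih =>
    have hs : ∀ {b : ℕ → ℝ}, (Summable fun n => |b n|) → Summable fun n => (b n : ℂ) * z ^ n :=
      fun hb => Summable.of_norm (by simpa [hz] using hb)
    -- One summation by parts: multiplying by `1 - z` turns coefficients into their differences, up
    -- to the boundary term `a 0`.
    have hid : (1 - z) * pser (fun n => (a n : ℂ)) z =
        a 0 + z * pser (fun n => (dif a n : ℂ)) z := by
      have h1 : Summable fun n => (a (n + 1) : ℂ) * z ^ n :=
        hs (b := fun n => a (n + 1)) ((summable_nat_add_iff 1).2 ha)
      have h2 : pser (fun n => (a n : ℂ)) z = a 0 + z * ∑' n, (a (n + 1) : ℂ) * z ^ n := by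
        unfold pser
        rw [(hs ha).tsum_eq_zero_add, ← tsum_mul_left]
        simp only [pow_zero, mul_one]
        congr 1; congr 1; ext n; ring
      have h3 : pser (fun n => (dif a n : ℂ)) z =
          ∑' n, (a (n + 1) : ℂ) * z ^ n - pser (fun n => (a n : ℂ)) z := by
        unfold pser
        rw [← h1.tsum_sub (hs ha)]
        congr 1; ext n; simp only [dif]; push_cast; ring
      rw [h3, sub_mul, one_mul]
      nth_rewrite 1 [h2]; ring
    have hd : ‖1 - z‖ ≤ 2 := (norm_sub_le _ _).trans (by rw [hz, norm_one]; norm_num)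
    calc ‖1 - z‖ ^ (k + 1) * ‖pser (fun n => (a n : ℂ)) z‖
        = ‖1 - z‖ ^ k * ‖(1 - z) * pser (fun n => (a n : ℂ)) z‖ := by rw [norm_mul]; ring
      _ ≤ ‖1 - z‖ ^ k * (|a 0| + ‖pser (fun n => (dif a n : ℂ)) z‖) := by
          gcongr
          rw [hid]
          refine (norm_add_le _ _).trans ?_
          simp [hz]
      _ = ‖1 - z‖ ^ k * |a 0| + ‖1 - z‖ ^ k * ‖pser (fun n => (dif a n : ℂ)) z‖ := by ring
      _ ≤ 2 ^ k * |a 0| + (2 ^ k * ∑ j ∈ Finset.range k, |dif^[j] (dif a) 0| +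
            ∑' n, |dif^[k] (dif a) n|) := by
          gcongr
          exact ih (summable_dif ha)
      _ ≤ _ := by
          rw [Finset.sum_range_succ', ← add_assoc, ← mul_add, add_comm |a 0|]
          simp only [Function.iterate_succ_apply, Function.iterate_zero, id]
          gcongr
          · norm_num
          · simp

/-! ### Tail integrals and moments of weights. -/

namespace IsRadialWeight

variable {ω : ℝ → ℝ}

lemma integrableOn_Icc (hω : IsRadialWeight ω) : IntegrableOn ω (Set.Icc 0 1) := by
  have := hω.integrable
  rwa [integrableOn_Ico_iff_integrableOn_Ioo, ← integrableOn_Icc_iff_integrableOn_Ioo] at this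

lemma integrableOn_mul (hω : IsRadialWeight ω) {φ : ℝ → ℝ} (hφ : Continuous φ) {S : Set ℝ}
    (hS : S ⊆ Set.Icc 0 1) : IntegrableOn (fun r => φ r * ω r) S :=
  (hω.integrableOn_Icc.continuousOn_mul hφ.continuousOn isCompact_Icc).mono_set hS

lemma hat_eq {r : ℝ} (hr : r ≤ 1) : hat ω r = ∫ s in Set.Ioo r 1, ω s := by
  rw [hat, intervalIntegral.integral_of_le hr, integral_Ioc_eq_integral_Ioo]

lemma nonneg_Ioo (hω : IsRadialWeight ω) {r s : ℝ} (hr : 0 ≤ r) (hs : s ∈ Set.Ioo r 1) : 0 ≤ ω s :=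
  hω.nonneg s ⟨hr.trans hs.1.le, hs.2⟩

lemma Ioo_subset {r : ℝ} (hr : 0 ≤ r) : Set.Ioo r 1 ⊆ Set.Icc 0 1 :=
  fun _ hs => ⟨hr.trans hs.1.le, hs.2.le⟩

lemma hat_anti (hω : IsRadialWeight ω) {r s : ℝ} (hr : 0 ≤ r) (hrs : r ≤ s) (hs : s ≤ 1) :
    hat ω s ≤ hat ω r := by
  rw [hat_eq hs, hat_eq (hrs.trans hs)]
  refine setIntegral_mono_set (hω.integrableOn_Icc.mono_set (Ioo_subset hr)) ?_
    (Set.Ioo_subset_Ioo_left hrs).eventuallyLE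
  exact (ae_restrict_mem measurableSet_Ioo).mono fun x hx => hω.nonneg_Ioo hr hx

/-- The moments with natural exponents. -/
lemma moment_nat (n : ℕ) : moment ω n = ∫ r in Set.Ioo 0 1, r ^ n * ω r := by
  rw [moment, intervalIntegral.integral_of_le zero_le_one, integral_Ioc_eq_integral_Ioo]
  simp only [Real.rpow_natCast]

/-- By Bernoulli's inequality `r^{2n+1} ≥ 1/2` on the interval over which the tail is taken. -/
lemma hat_le_two_mul_moment (hω : IsRadialWeight ω) (n : ℕ) :
    hat ω (1 - 1 / (4 * (n + 1))) ≤ 2 * moment ω ((2 * n + 1 : ℕ) : ℝ) := by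
  set s : ℝ := 1 / (4 * (n + 1)) with hs
  have hs0 : 0 < s := by positivity
  have hs1 : s ≤ 1 / 4 := by
    rw [hs]; exact one_div_le_one_div_of_le (by norm_num) (by have : (0:ℝ) ≤ n := by positivity
                                                              linarith)
  have hb : (1 : ℝ) / 2 ≤ (1 - s) ^ (2 * n + 1) := by
    have h := one_add_mul_le_pow (show (-2 : ℝ) ≤ -s by linarith) (2 * n + 1)
    refine le_trans ?_ (h.trans_eq (by ring))
    have : ((2 * n + 1 : ℕ) : ℝ) * s ≤ 1 / 2 := by
      rw [hs, mul_one_div, div_le_div_iff₀ (by positivity) two_pos]; push_cast; linarith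
    linarith
  rw [moment_nat, hat_eq (by linarith)]
  have h1 : ∫ r in Set.Ioo (1 - s) 1, (1 / 2) * ω r ≤
      ∫ r in Set.Ioo (1 - s) 1, r ^ (2 * n + 1) * ω r := by
    refine setIntegral_mono_on ((hω.integrableOn_Icc.mono_set
      (Ioo_subset (by linarith))).const_mul _) (hω.integrableOn_mul (by fun_prop)
      (Ioo_subset (by linarith))) measurableSet_Ioo fun r hr => ?_
    have := hω.nonneg_Ioo (by linarith) hr
    gcongr
    exact hb.trans (pow_le_pow_left₀ (by linarith) hr.1.le _)
  have h2 : ∫ r in Set.Ioo (1 - s) 1, r ^ (2 * n + 1) * ω r ≤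
      ∫ r in Set.Ioo 0 1, r ^ (2 * n + 1) * ω r := by
    refine setIntegral_mono_set (hω.integrableOn_mul (by fun_prop) (Ioo_subset le_rfl)) ?_
      (Set.Ioo_subset_Ioo_left (by linarith)).eventuallyLE
    exact (ae_restrict_mem measurableSet_Ioo).mono fun x hx =>
      mul_nonneg (pow_nonneg hx.1.le _) (hω.nonneg_Ioo le_rfl hx)
  rw [integral_const_mul] at h1
  linarith

lemma moment_pos (hω : IsRadialWeight ω) (n : ℕ) : 0 < moment ω ((2 * n + 1 : ℕ) : ℝ) := by
  have h := hω.hat_le_two_mul_moment n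
  have : 0 < hat ω (1 - 1 / (4 * (n + 1))) := by
    refine hω.hat_pos _ ⟨?_, ?_⟩
    · rw [sub_nonneg, div_le_one (by positivity)]
      have : (0:ℝ) ≤ n := by positivity
      linarith
    · simp only [sub_lt_self_iff]; positivity
  linarith

end IsRadialWeight

/-- Doubling is iterated `m + 1` times, where `2^m ≤ t < 2^{m+1}`; with the constant below `2^b`
this costs at most `(2^{m+1})^b ≤ (2t)^b`. -/
lemma hat_doubling_pow {ω : ℝ → ℝ} (hω : ω ∈ DHat) : ∃ b : ℕ, ∀ h t : ℝ, 0 < h → h ≤ 1 → 1 ≤ t →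
    hat ω (1 - h) ≤ (2 * t) ^ b * hat ω (1 - h / t) := by
  obtain ⟨hw, C, hC, hd⟩ := hω
  obtain ⟨b, hb⟩ := pow_unbounded_of_one_lt C (one_lt_two)
  refine ⟨b, fun h t h0 h1 ht => ?_⟩
  have hiter : ∀ m : ℕ, hat ω (1 - h) ≤ C ^ m * hat ω (1 - h / 2 ^ m) := fun m => by
    induction m with
    | zero => simp
    | succ m ih =>
      have hm : h / 2 ^ m ≤ 1 := (div_le_self h0.le (one_le_pow₀ one_le_two)).trans h1
      have hm0 : 0 < h / 2 ^ m := by positivity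
      have h2 := hd (1 - h / 2 ^ m) ⟨by linarith, by linarith⟩
      have e : (1 + (1 - h / 2 ^ m)) / 2 = 1 - h / 2 ^ (m + 1) := by rw [pow_succ]; field_simp; ring
      rw [e] at h2
      calc _ ≤ C ^ m * hat ω (1 - h / 2 ^ m) := ih
        _ ≤ C ^ m * (C * hat ω (1 - h / 2 ^ (m + 1))) := by gcongr
        _ = _ := by ring
  obtain ⟨m, hm1, hm2⟩ := exists_nat_pow_near ht one_lt_two
  have hle : h / 2 ^ (m + 1) ≤ h / t := by gcongr
  have hnn : 0 < hat ω (1 - h / t) :=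
    hw.hat_pos _ ⟨by have := div_le_self h0.le ht; linarith, by
      have : 0 < h / t := by positivity
      linarith⟩
  calc hat ω (1 - h) ≤ C ^ (m + 1) * hat ω (1 - h / 2 ^ (m + 1)) := hiter _
    _ ≤ C ^ (m + 1) * hat ω (1 - h / t) := by
        gcongr
        refine hw.hat_anti ?_ (by linarith) ?_
        · have := div_le_self h0.le ht; linarith
        · have : 0 < h / 2 ^ (m + 1) := by positivity
          linarith
    _ ≤ (2 ^ b) ^ (m + 1) * hat ω (1 - h / t) := by gcongr
    _ = (2 ^ (m + 1)) ^ b * hat ω (1 - h / t) := by rw [← pow_mul, ← pow_mul, mul_comm b]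
    _ ≤ _ := by gcongr; rw [pow_succ]; linarith

/-- The form `2 + 8x` is `2t` for `t = 1 + 4x`, the dilation factor used in `inv_oddMoment_le`. -/
lemma exists_poly_mul_exp_le (m : ℕ) {c : ℝ} (hc : 0 < c) :
    ∃ C : ℝ, 0 < C ∧ ∀ x : ℝ, 0 ≤ x → (2 + 8 * x) ^ m * Real.exp (-(c * x)) ≤ C := by
  refine ⟨Real.exp (c / 4) * (m.factorial / (c / 8) ^ m), by positivity, fun x hx => ?_⟩
  have h := pow_mul_exp_neg_le (c := c / 8) (by positivity) m (x := 2 + 8 * x) (by positivity)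
  have e : Real.exp (-(c * x)) = Real.exp (c / 4) * Real.exp (-(c / 8 * (2 + 8 * x))) := by
    rw [← Real.exp_add]; congr 1; ring
  rw [e]
  calc _ = Real.exp (c / 4) * ((2 + 8 * x) ^ m * Real.exp (-(c / 8 * (2 + 8 * x)))) := by ring
    _ ≤ _ := by gcongr

/-- Where `(1 - r)(n + 1)` lies in `[j, j + 1)`, `r^n ≤ e^{1-j}`. The tail integral from `1 -
(j+1)/(n+1)` exceeds the one from `1 - 1/(n+1)` by at most a power of `j + 1`, which the exponential
makes summable. -/
lemma moment_le_hat {ω : ℝ → ℝ} (hω : ω ∈ DHat) : ∃ C : ℝ, 0 < C ∧ ∀ n : ℕ,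
    moment ω n ≤ C * hat ω (1 - 1 / (n + 1)) := by
  obtain ⟨b, hb⟩ := hat_doubling_pow hω
  have hw := hω.1
  set c : ℕ → ℝ := fun j => Real.exp (1 - j) * (2 * (j + 1)) ^ b with hc
  have hcs : Summable c := by
    obtain ⟨D, hD, hD'⟩ := exists_poly_mul_exp_le b (c := 1 / 2) (by norm_num)
    have hg : Summable fun j : ℕ => (Real.exp 1 * D) * Real.exp (-(1 / 2)) ^ j :=
      (summable_geometric_of_lt_one (Real.exp_pos _).le
        (Real.exp_lt_one_iff.2 (by norm_num))).mul_left _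
    refine hg.of_nonneg_of_le (fun j => by positivity) fun j => ?_
    have e : Real.exp (1 - j) = Real.exp 1 * Real.exp (-(1 / 2 * j)) * Real.exp (-(1 / 2)) ^ j := by
      rw [← Real.exp_nat_mul, ← Real.exp_add, ← Real.exp_add]; congr 1; ring
    have h1 : (2 * ((j : ℝ) + 1)) ^ b ≤ (2 + 8 * j) ^ b := by
      gcongr; have : (0:ℝ) ≤ j := by positivity
      linarith
    calc c j = Real.exp 1 * ((2 * ((j : ℝ) + 1)) ^ b * Real.exp (-(1 / 2 * j))) *
          Real.exp (-(1 / 2)) ^ j := by rw [hc]; simp only [e]; ring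
      _ ≤ Real.exp 1 * ((2 + 8 * j) ^ b * Real.exp (-(1 / 2 * j))) * Real.exp (-(1 / 2)) ^ j := by
          gcongr
      _ ≤ _ := by gcongr; exact hD' j (by positivity)
  have hc0 : ∀ j, 0 < c j := fun j => by simp only [hc]; positivity
  refine ⟨∑' j, c j, hcs.tsum_pos (fun j => (hc0 j).le) 0 (hc0 0), fun n => ?_⟩
  set N : ℝ := (n : ℝ) + 1 with hN
  have hN0 : 0 < N := by positivity
  set S : ℕ → Set ℝ := fun j => Set.Ioo (1 - (j + 1) / N) 1 with hS
  have hpt : ∀ r ∈ Set.Ioo (0 : ℝ) 1, r ^ n * ω r ≤ ∑ j ∈ Finset.range (n + 1),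
      (S j).indicator (fun r => Real.exp (1 - j) * ω r) r := fun r hr => by
    have hωr := hw.nonneg_Ioo le_rfl hr
    set x := (1 - r) * N with hx
    have hx0 : 0 ≤ x := mul_nonneg (by linarith [hr.2]) hN0.le
    set j := ⌊x⌋₊ with hj
    have hj1 : (j : ℝ) ≤ x := Nat.floor_le hx0
    have hj2 : x < j + 1 := Nat.lt_floor_add_one x
    have hjn : j ∈ Finset.range (n + 1) := by
      rw [Finset.mem_range]
      have h1 : x < N := by rw [hx]; nlinarith [hr.1]
      have : (j : ℝ) < ((n + 1 : ℕ) : ℝ) := by push_cast; linarith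
      exact_mod_cast this
    have hmem : r ∈ S j := by
      refine ⟨?_, hr.2⟩
      have : (1 - r) < (j + 1) / N := by rw [lt_div_iff₀ hN0]; exact hj2
      linarith
    have hle : r ^ n ≤ Real.exp (1 - j) := by
      have h1 : r ≤ Real.exp (-(1 - r)) := by have := Real.add_one_le_exp (-(1 - r)); linarith
      calc r ^ n ≤ Real.exp (-(1 - r)) ^ n := pow_le_pow_left₀ hr.1.le h1 _
        _ = Real.exp (n * -(1 - r)) := by rw [← Real.exp_nat_mul]
        _ ≤ Real.exp (1 - j) := by
            refine Real.exp_le_exp.2 ?_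
            have : x = (1 - r) * n + (1 - r) := by rw [hx, hN]; ring
            linarith [hr.1]
    calc r ^ n * ω r ≤ Real.exp (1 - j) * ω r := by gcongr
      _ = (S j).indicator (fun r => Real.exp (1 - j) * ω r) r := by
          rw [Set.indicator_of_mem hmem]
      _ ≤ _ := by
          refine Finset.single_le_sum (f := fun j : ℕ =>
            (S j).indicator (fun r => Real.exp (1 - j) * ω r) r) (fun i _ => ?_) hjn
          rw [Set.indicator_apply]
          split_ifs <;> positivity
  have hint : ∀ j : ℕ, IntegrableOn ((S j).indicator fun r => Real.exp (1 - j) * ω r)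
      (Set.Ioo 0 1) := fun j => by
    refine Integrable.indicator ?_ measurableSet_Ioo
    exact (hw.integrableOn_Icc.mono_set Set.Ioo_subset_Icc_self).const_mul _
  rw [IsRadialWeight.moment_nat]
  calc ∫ r in Set.Ioo 0 1, r ^ n * ω r
      ≤ ∫ r in Set.Ioo 0 1, ∑ j ∈ Finset.range (n + 1),
          (S j).indicator (fun r => Real.exp (1 - j) * ω r) r := by
        refine setIntegral_mono_on (hw.integrableOn_mul (by fun_prop) Set.Ioo_subset_Icc_self)
          (integrable_finsetSum _ fun j _ => hint j) measurableSet_Ioo hpt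
    _ = ∑ j ∈ Finset.range (n + 1), Real.exp (1 - j) * hat ω (1 - (j + 1) / N) := by
        rw [integral_finsetSum _ fun j _ => hint j]
        refine Finset.sum_congr rfl fun j hj => ?_
        have hjN : ((j : ℝ) + 1) / N ≤ 1 := by
          rw [div_le_one hN0, hN]
          have : j + 1 ≤ n + 1 := Finset.mem_range.1 hj
          exact_mod_cast this
        rw [setIntegral_indicator measurableSet_Ioo, integral_const_mul, IsRadialWeight.hat_eq
          (by have : 0 < ((j : ℝ) + 1) / N := by positivity
              linarith), Set.inter_eq_right.2]
        exact Set.Ioo_subset_Ioo_left (by linarith)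
    _ ≤ ∑ j ∈ Finset.range (n + 1), c j * hat ω (1 - 1 / N) := by
        refine Finset.sum_le_sum fun j hj => ?_
        have hjN : ((j : ℝ) + 1) / N ≤ 1 := by
          rw [div_le_one hN0, hN]
          have : j + 1 ≤ n + 1 := Finset.mem_range.1 hj
          exact_mod_cast this
        have h1 := hb (((j : ℝ) + 1) / N) ((j : ℝ) + 1) (by positivity) hjN
          (by have : (0:ℝ) ≤ j := by positivity
              linarith)
        have e : ((j : ℝ) + 1) / N / ((j : ℝ) + 1) = 1 / N := by field_simp
        rw [e] at h1
        simp only [hc]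
        rw [mul_assoc]
        gcongr
    _ = (∑ j ∈ Finset.range (n + 1), c j) * hat ω (1 - 1 / N) := by rw [Finset.sum_mul]
    _ ≤ _ := by
        have : 0 ≤ hat ω (1 - 1 / N) := (hw.hat_pos _ ⟨by
          rw [sub_nonneg, div_le_one hN0, hN]; simp, by simp [hN0]⟩).le
        gcongr
        exact hcs.sum_le_tsum _ fun j _ => (hc0 j).le

/-! ### The odd moments and their reciprocals as symbols. -/

/-- The odd moments. -/
noncomputable def oddMoment (ω : ℝ → ℝ) (n : ℕ) : ℝ := moment ω ((2 * n + 1 : ℕ) : ℝ)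

lemma oddMoment_pos {ω : ℝ → ℝ} (hω : IsRadialWeight ω) (n : ℕ) : 0 < oddMoment ω n :=
  hω.moment_pos n

lemma iterate_dif_oddMoment {ω : ℝ → ℝ} (hω : IsRadialWeight ω) (j n : ℕ) :
    dif^[j] (oddMoment ω) n =
      ∫ r in Set.Ioo 0 1, (r ^ (2 * n + 1) * (r ^ 2 - 1) ^ j) * ω r := by
  induction j generalizing n with
  | zero => rw [Function.iterate_zero, id, oddMoment, IsRadialWeight.moment_nat]; simp
  | succ j ih =>
    rw [Function.iterate_succ_apply', dif, ih, ih, ← integral_sub]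
    · congr 1; ext r; ring
    · exact hω.integrableOn_mul (by fun_prop) Set.Ioo_subset_Icc_self
    · exact hω.integrableOn_mul (by fun_prop) Set.Ioo_subset_Icc_self

lemma oddMoment_le_moment {ω : ℝ → ℝ} (hω : IsRadialWeight ω) (n : ℕ) :
    oddMoment ω n ≤ moment ω n := by
  rw [oddMoment, IsRadialWeight.moment_nat, IsRadialWeight.moment_nat]
  refine setIntegral_mono_on (hω.integrableOn_mul (by fun_prop) Set.Ioo_subset_Icc_self)
    (hω.integrableOn_mul (by fun_prop) Set.Ioo_subset_Icc_self) measurableSet_Ioo fun r hr => ?_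
  have := hω.nonneg_Ioo le_rfl hr
  gcongr ?_ * _
  exact pow_le_pow_of_le_one hr.1.le hr.2.le (by omega)

/-- Upper doubling lets the exponent more than double at bounded cost. The first bound recovers the
odd moment after part of `r^{2n+1}` has been spent; the second gives the slow variation that
`Symb.inv` requires. -/
lemma moment_le_oddMoment_succ {ω : ℝ → ℝ} (hω : ω ∈ DHat) : ∃ C : ℝ, 0 < C ∧ ∀ n : ℕ,
    moment ω n ≤ C * oddMoment ω n ∧ moment ω n ≤ C * oddMoment ω (n + 1) := by
  obtain ⟨b, hb⟩ := hat_doubling_pow hω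
  obtain ⟨C, hC, hm⟩ := moment_le_hat hω
  have hw := hω.1
  refine ⟨C * (16 ^ b * 2), by positivity, fun n => ?_⟩
  have hn : (0 : ℝ) ≤ n := by positivity
  -- The factor `8` covers `4(m + 1) ≤ 8(n + 1)` for both `m = n` and `m = n + 1`.
  have h1 := hb (1 / (n + 1)) 8 (by positivity)
    (by rw [div_le_one (by positivity)]; linarith) (by norm_num)
  rw [div_div, show (2 : ℝ) * 8 = 16 by norm_num] at h1
  have key : ∀ m : ℕ, (m : ℝ) + 1 ≤ 2 * (n + 1) →
      moment ω n ≤ C * (16 ^ b * 2) * oddMoment ω m := fun m hmn => by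
    have h2 : hat ω (1 - 1 / ((n + 1) * 8)) ≤ hat ω (1 - 1 / (4 * (m + 1))) := by
      have e : (1 : ℝ) / ((n + 1) * 8) ≤ 1 / (4 * (m + 1)) :=
        one_div_le_one_div_of_le (by positivity) (by linarith)
      have e2 : (1 : ℝ) / (4 * (m + 1)) ≤ 1 := by
        rw [div_le_one (by positivity)]
        have : (0 : ℝ) ≤ m := by positivity
        linarith
      refine hw.hat_anti (by linarith) (by linarith) ?_
      have : (0 : ℝ) < 1 / ((n + 1) * 8) := by positivity
      linarith
    calc moment ω n ≤ C * hat ω (1 - 1 / (n + 1)) := hm n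
      _ ≤ C * (16 ^ b * (2 * oddMoment ω m)) := by
          gcongr
          refine h1.trans ?_
          gcongr
          exact h2.trans (hw.hat_le_two_mul_moment m)
      _ = _ := by ring
  exact ⟨key n (by linarith), key (n + 1) (by push_cast; linarith)⟩

/-- Each difference inserts a factor `r² - 1`. Of `r^{2n+1}`, the part `r^{n+1}` absorbs `(1 - r)^j`
and yields `(n+1)^{-j}`, and `r^n` is kept for the moment. -/
lemma symb_oddMoment {ω : ℝ → ℝ} (hω : ω ∈ DHat) (ι : Type) (k : ℕ) :
    Symb k (fun (_ : ι) n => oddMoment ω n) (fun _ n => oddMoment ω n) := by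
  obtain ⟨C, hC, hm⟩ := moment_le_oddMoment_succ hω
  have hw := hω.1
  refine Symb.of_iterate (fun _ n => (oddMoment_pos hw n).le) fun j _ =>
    ⟨2 ^ j * j.factorial * C, by positivity, fun _ n => ?_⟩
  rw [iterate_dif_oddMoment hw]
  have hn : (0 : ℝ) < (n : ℝ) + 1 := by positivity
  have hpt : ∀ r ∈ Set.Ioo (0 : ℝ) 1, |(r ^ (2 * n + 1) * (r ^ 2 - 1) ^ j) * ω r| ≤
      (2 ^ j * j.factorial / ((n : ℝ) + 1) ^ j) * (r ^ n * ω r) := fun r hr => by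
    have hωr := hw.nonneg_Ioo le_rfl hr
    have h0 := hr.1
    have h1 := hr.2
    have e1 : |r ^ 2 - 1| = (1 - r) * (1 + r) := by
      rw [abs_of_nonpos (by nlinarith)]; ring
    have e2 : |r ^ 2 - 1| ≤ 2 * (1 - r) := by rw [e1]; nlinarith
    have e3 : r ^ (n + 1) ≤ Real.exp (-(1 * ((n + 1) * (1 - r)))) := by
      have h1 : r ≤ Real.exp (-(1 - r)) := by have := Real.add_one_le_exp (-(1 - r)); linarith
      calc r ^ (n + 1) ≤ Real.exp (-(1 - r)) ^ (n + 1) := pow_le_pow_left₀ h0.le h1 _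
        _ = _ := by rw [← Real.exp_nat_mul]; congr 1; push_cast; ring
    have e4 := pow_mul_exp_neg_le one_pos j (x := (n + 1) * (1 - r))
      (mul_nonneg hn.le (by linarith))
    rw [one_pow, div_one] at e4
    have e5 : r ^ (n + 1) * (1 - r) ^ j ≤ j.factorial / ((n : ℝ) + 1) ^ j := by
      rw [le_div_iff₀ (by positivity)]
      have h2 : 0 ≤ (1 - r) ^ j := pow_nonneg (by linarith) _
      calc r ^ (n + 1) * (1 - r) ^ j * ((n : ℝ) + 1) ^ j
          ≤ Real.exp (-(1 * ((n + 1) * (1 - r)))) * (1 - r) ^ j * ((n : ℝ) + 1) ^ j := by gcongr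
        _ = ((n + 1) * (1 - r)) ^ j * Real.exp (-(1 * ((n + 1) * (1 - r)))) := by
            rw [mul_pow]; ring
        _ ≤ _ := e4
    rw [abs_mul, abs_mul, abs_pow, abs_pow, abs_of_pos h0, abs_of_nonneg hωr]
    calc r ^ (2 * n + 1) * |r ^ 2 - 1| ^ j * ω r
        ≤ r ^ (2 * n + 1) * (2 * (1 - r)) ^ j * ω r := by gcongr
      _ = 2 ^ j * (r ^ (n + 1) * (1 - r) ^ j) * (r ^ n * ω r) := by
          rw [mul_pow, show 2 * n + 1 = (n + 1) + n by ring, pow_add]; ring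
      _ ≤ 2 ^ j * (j.factorial / ((n : ℝ) + 1) ^ j) * (r ^ n * ω r) := by gcongr
      _ = _ := by ring
  calc |∫ r in Set.Ioo 0 1, (r ^ (2 * n + 1) * (r ^ 2 - 1) ^ j) * ω r|
      ≤ ∫ r in Set.Ioo 0 1, |(r ^ (2 * n + 1) * (r ^ 2 - 1) ^ j) * ω r| :=
        abs_integral_le_integral_abs
    _ ≤ ∫ r in Set.Ioo 0 1, (2 ^ j * j.factorial / ((n : ℝ) + 1) ^ j) * (r ^ n * ω r) := by
        refine setIntegral_mono_on ?_ ?_ measurableSet_Ioo hpt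
        · exact (hw.integrableOn_mul (by fun_prop) Set.Ioo_subset_Icc_self).abs
        · exact (hw.integrableOn_mul (by fun_prop) Set.Ioo_subset_Icc_self).const_mul _
    _ = (2 ^ j * j.factorial / ((n : ℝ) + 1) ^ j) * moment ω n := by
        rw [integral_const_mul, IsRadialWeight.moment_nat]
    _ ≤ (2 ^ j * j.factorial / ((n : ℝ) + 1) ^ j) * (C * oddMoment ω n) := by
        gcongr; exact (hm n).1
    _ = _ := by ring

lemma symb_inv_oddMoment {ω : ℝ → ℝ} (hω : ω ∈ DHat) (ι : Type) (k : ℕ) :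
    Symb k (fun (_ : ι) n => (oddMoment ω n)⁻¹) (fun _ n => (oddMoment ω n)⁻¹) := by
  obtain ⟨C, hC, hm⟩ := moment_le_oddMoment_succ hω
  exact Symb.inv (fun _ n => oddMoment_pos hω.1 n) C
    (fun _ n => (oddMoment_le_moment hω.1 n).trans (hm n).2) (symb_oddMoment hω ι k)

/-- Relative to `1/μ̂(1 - h)` the multiplier grows only polynomially in `(n + 1)h`, so exponential
damping at scale `1/h` absorbs it. -/
lemma inv_oddMoment_le {ω : ℝ → ℝ} (hω : ω ∈ DHat) : ∃ b : ℕ, ∀ h : ℝ, 0 < h → h ≤ 1 → ∀ n : ℕ,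
    (oddMoment ω n)⁻¹ ≤ 2 * (2 + 8 * ((n + 1) * h)) ^ b / hat ω (1 - h) := by
  obtain ⟨b, hb⟩ := hat_doubling_pow hω
  have hw := hω.1
  refine ⟨b, fun h h0 h1 n => ?_⟩
  -- Chosen so that `t ≥ 1` and `h / t ≤ 1/(4(n + 1))`, the distance from `1` at which the tail is
  -- compared with the moment.
  set t : ℝ := 1 + 4 * ((n + 1) * h) with ht
  have htn : 0 < 4 * (((n : ℝ) + 1) * h) := by positivity
  have ht1 : 1 ≤ t := by linarith
  have h2 := hb h t h0 h1 ht1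
  have h3 : hat ω (1 - h / t) ≤ hat ω (1 - 1 / (4 * (n + 1))) := by
    have e : h / t ≤ 1 / (4 * (n + 1)) := by
      rw [div_le_div_iff₀ (by positivity) (by positivity)]; linarith
    have e2 : (1 : ℝ) / (4 * (n + 1)) ≤ 1 := by
      rw [div_le_one (by positivity)]
      have : (0 : ℝ) ≤ n := by positivity
      linarith
    refine hw.hat_anti (by linarith) (by linarith) ?_
    have : 0 < h / t := by positivity
    linarith
  have h4 := hw.hat_le_two_mul_moment n
  have hpos : 0 < hat ω (1 - h) := hw.hat_pos _ ⟨by linarith, by linarith⟩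
  rw [inv_le_comm₀ (oddMoment_pos hw n) (by positivity), inv_div, div_le_iff₀ (by positivity)]
  calc hat ω (1 - h) ≤ (2 * t) ^ b * hat ω (1 - h / t) := h2
    _ ≤ (2 * t) ^ b * (2 * oddMoment ω n) := by gcongr; exact h3.trans h4
    _ = _ := by rw [ht]; ring

/-! ### Kernels and multipliers at a single scale. -/

/-- Kernel estimates at scale `1 / h` for the multiplier `e / μ_{2n+1}`. -/
lemma kernel_bound {ω : ℝ → ℝ} (hω : ω ∈ DHat) {ι : Type} {h : ι → ℝ}
    (hh : ∀ i, 0 < h i ∧ h i ≤ 1) {k : ℕ} {e : ι → ℕ → ℝ}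
    (he : Symb k (fun i n => (((n : ℝ) + 1) * h i) ^ k) e) :
    ∃ C : ℝ, 0 < C ∧ ∀ i,
      (Summable fun n : ℕ => |Real.exp (-(1 / 4 * h i * n)) * e i n * (oddMoment ω n)⁻¹|) ∧
      (∀ t, ‖pser (fun n : ℕ => ((Real.exp (-(1 / 4 * h i * n)) * e i n * (oddMoment ω n)⁻¹ : ℝ) :
        ℂ)) (ev t)‖ ≤ C / hat ω (1 - h i) / h i) ∧
      ∀ t, ‖1 - ev t‖ ^ k * ‖pser (fun n : ℕ => ((Real.exp (-(1 / 4 * h i * n)) * e i n *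
        (oddMoment ω n)⁻¹ : ℝ) : ℂ)) (ev t)‖ ≤ C / hat ω (1 - h i) * h i ^ k / h i := by
  obtain ⟨b, hb⟩ := inv_oddMoment_le hω
  have hw := hω.1
  set a : ι → ℕ → ℝ := fun i n => Real.exp (-(1 / 4 * h i * n)) * e i n * (oddMoment ω n)⁻¹ with ha
  have hsym := ((symb_exp hh (show (0 : ℝ) < 1 / 4 by norm_num) k).mul he).mul
    (symb_inv_oddMoment hω ι k)
  obtain ⟨D, hD, hit⟩ := hsym.iterate
  change ∀ j ≤ k, ∀ (i : ι) (n : ℕ), |dif^[j] (a i) n| ≤ _ at hit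
  obtain ⟨E, hE, hpe⟩ := exists_poly_mul_exp_le (b + k) (c := 1 / 16) (by norm_num)
  -- Part of the exponential absorbs all polynomial growth; what is left is a geometric sequence of
  -- ratio `e^{-h/16}`, whose sum is `O(1/h)`. It is needed with `m = k` for the sequence itself and
  -- `m = 0` for its `k`-th difference.
  have hbound : ∀ i (n m : ℕ), m ≤ k → (((n : ℝ) + 1) * h i) ^ m *
      (Real.exp (-(1 / 4 / 2 * h i * n)) * (oddMoment ω n)⁻¹) ≤
      4 * E / hat ω (1 - h i) * Real.exp (-(1 / 16 * h i)) ^ n := fun i n m hm => by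
    obtain ⟨h0, h1⟩ := hh i
    have hpos : 0 < hat ω (1 - h i) := hw.hat_pos _ ⟨by linarith, by linarith⟩
    set x := ((n : ℝ) + 1) * h i with hx
    have hx0 : 0 < x := by positivity
    have e1 : x ^ m ≤ (2 + 8 * x) ^ k := by
      calc x ^ m ≤ (2 + 8 * x) ^ m := by gcongr; linarith
        _ ≤ (2 + 8 * x) ^ k := pow_le_pow_right₀ (by linarith) hm
    have e2 : Real.exp (-(1 / 4 / 2 * h i * n)) = Real.exp (1 / 16 * h i) *
        Real.exp (-(1 / 16 * x)) * Real.exp (-(1 / 16 * h i)) ^ n := by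
      rw [← Real.exp_nat_mul, ← Real.exp_add, ← Real.exp_add, hx]; congr 1; ring
    have e3 : Real.exp (1 / 16 * h i) ≤ 2 := by
      have h5 : Real.exp (1 / 16 * h i) ≤ Real.exp (1 / 16) := Real.exp_le_exp.2 (by linarith)
      have h6 : Real.exp (1 / 16) ^ 16 < 2.7182818286 := by
        rw [← Real.exp_nat_mul]; norm_num [Real.exp_one_lt_d9]
        linarith [Real.exp_one_lt_d9]
      by_contra hcon
      push Not at hcon
      have h7 : (2 : ℝ) ^ 16 ≤ Real.exp (1 / 16) ^ 16 :=
        pow_le_pow_left₀ (by norm_num) (hcon.le.trans h5) _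
      norm_num at h7 h6; linarith
    calc x ^ m * (Real.exp (-(1 / 4 / 2 * h i * n)) * (oddMoment ω n)⁻¹)
        ≤ (2 + 8 * x) ^ k * (Real.exp (-(1 / 4 / 2 * h i * n)) *
            (2 * (2 + 8 * x) ^ b / hat ω (1 - h i))) := by
          have := inv_pos.2 (oddMoment_pos hw n)
          gcongr; exact hb (h i) h0 h1 n
      _ = 2 * Real.exp (1 / 16 * h i) * ((2 + 8 * x) ^ (b + k) * Real.exp (-(1 / 16 * x))) /
            hat ω (1 - h i) * Real.exp (-(1 / 16 * h i)) ^ n := by rw [e2, pow_add]; ring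
      _ ≤ 2 * 2 * E / hat ω (1 - h i) * Real.exp (-(1 / 16 * h i)) ^ n := by
          gcongr; exact hpe x hx0.le
      _ = _ := by ring
  have hgeo : ∀ i, HasSum (fun n : ℕ => Real.exp (-(1 / 16 * h i)) ^ n)
      (1 - Real.exp (-(1 / 16 * h i)))⁻¹ := fun i =>
    hasSum_geometric_of_lt_one (Real.exp_pos _).le
      (Real.exp_lt_one_iff.2 (by linarith [(hh i).1]))
  have hgeo' : ∀ i, (1 - Real.exp (-(1 / 16 * h i)))⁻¹ ≤ 32 / h i := fun i => by
    obtain ⟨h0, h1⟩ := hh i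
    have h2 := Real.add_one_le_exp (1 / 16 * h i)
    have h3 : Real.exp (-(1 / 16 * h i)) ≤ (1 / 16 * h i + 1)⁻¹ := by
      rw [Real.exp_neg]; gcongr
    have h4 : h i / 32 ≤ 1 - (1 / 16 * h i + 1)⁻¹ := by
      have : 1 - (1 / 16 * h i + 1)⁻¹ = h i / (h i + 16) := by field_simp; ring
      rw [this]; gcongr; linarith
    rw [inv_le_comm₀ (by linarith) (by positivity), inv_div]; linarith
  set C₁ : ℝ := D * (4 * E) * 32 with hC₁
  have hC₁0 : 0 ≤ C₁ := by positivity
  have hsum : ∀ i (f : ℕ → ℝ) (w : ℝ), 0 ≤ w → (∀ n, |f n| ≤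
      w * (D * (4 * E / hat ω (1 - h i) * Real.exp (-(1 / 16 * h i)) ^ n))) →
      (Summable fun n => |f n|) ∧ ∑' n, |f n| ≤ w * (C₁ / hat ω (1 - h i) / h i) :=
    fun i f w hw0 hf => by
      obtain ⟨h0, h1⟩ := hh i
      have hpos : 0 < hat ω (1 - h i) := hw.hat_pos _ ⟨by linarith, by linarith⟩
      have hs := (((hgeo i).mul_left (4 * E / hat ω (1 - h i))).mul_left D).mul_left w
      have hsf := hs.summable.of_nonneg_of_le (fun n => abs_nonneg (f n)) hf
      refine ⟨hsf, (hsf.tsum_le_tsum hf hs.summable).trans ?_⟩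
      rw [hs.tsum_eq]
      calc w * (D * (4 * E / hat ω (1 - h i) * (1 - Real.exp (-(1 / 16 * h i)))⁻¹))
          ≤ w * (D * (4 * E / hat ω (1 - h i) * (32 / h i))) := by gcongr; exact hgeo' i
        _ = _ := by rw [hC₁]; field_simp
  have ha0 : ∀ i, (Summable fun n => |a i n|) ∧
      ∑' n, |a i n| ≤ 1 * (C₁ / hat ω (1 - h i) / h i) := fun i => by
    refine hsum i (a i) 1 zero_le_one fun n => ?_
    have h1 := hit 0 (Nat.zero_le _) i n
    simp only [Function.iterate_zero, id, pow_zero, div_one] at h1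
    refine h1.trans ?_
    rw [one_mul]
    exact mul_le_mul_of_nonneg_left ((le_of_eq (by ring)).trans (hbound i n k le_rfl)) hD
  -- In the `k`-th difference the weight `((n+1)h)^k` is divided by `(n+1)^k`, which leaves exactly
  -- `h^k`.
  have hak : ∀ i, (Summable fun n => |dif^[k] (a i) n|) ∧
      ∑' n, |dif^[k] (a i) n| ≤ h i ^ k * (C₁ / hat ω (1 - h i) / h i) := fun i => by
    have h0 := (hh i).1
    refine hsum i (dif^[k] (a i)) (h i ^ k) (by positivity) fun n => ?_
    refine (hit k le_rfl i n).trans ?_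
    rw [mul_left_comm]
    refine mul_le_mul_of_nonneg_left ?_ hD
    have h2 := hbound i n 0 (Nat.zero_le _)
    rw [pow_zero, one_mul] at h2
    refine le_trans (le_of_eq ?_) (mul_le_mul_of_nonneg_left h2 (by positivity))
    rw [mul_pow]; field_simp
  set C₂ : ℝ := 2 ^ k * (k * (D * (4 * E))) + C₁ with hC₂
  have hC₂0 : C₁ ≤ C₂ := by rw [hC₂]; have : 0 ≤ 2 ^ k * (k * (D * (4 * E))) := by positivity
                            linarith
  refine ⟨C₂ + 1, by linarith, fun i => ?_⟩
  obtain ⟨h0, h1⟩ := hh i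
  have hpos : 0 < hat ω (1 - h i) := hw.hat_pos _ ⟨by linarith, by linarith⟩
  refine ⟨(ha0 i).1, fun t => ?_, fun t => ?_⟩
  · have h2 := norm_one_sub_pow_mul_pser_le (ha0 i).1 (norm_ev t) 0
    simp only [pow_zero, one_mul, Finset.range_zero, Finset.sum_empty, mul_zero, zero_add,
      Function.iterate_zero, id] at h2
    refine (h2.trans (ha0 i).2).trans ?_
    rw [one_mul]
    gcongr; linarith
  · refine (norm_one_sub_pow_mul_pser_le (ha0 i).1 (norm_ev t) k).trans ?_
    -- At `n = 0` the weight `((n+1)h)^k` is `h^k`, so the boundary terms of the summation by parts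
    -- carry the full power of `h` too.
    have h3 : ∑ j ∈ Finset.range k, |dif^[j] (a i) 0| ≤
        k * (D * (h i ^ k * (4 * E / hat ω (1 - h i)))) := by
      refine (Finset.sum_le_card_nsmul _ _ _ fun j hj => ?_).trans (le_of_eq (by
        rw [Finset.card_range, nsmul_eq_mul]))
      have h4 := hit j (Finset.mem_range.1 hj).le i 0
      have h5 := hbound i 0 0 (Nat.zero_le _)
      simp only [Nat.cast_zero, mul_zero, neg_zero, Real.exp_zero, zero_add, one_mul, pow_zero,
        mul_one, one_pow, div_one] at h4 h5
      refine h4.trans ?_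
      gcongr
    calc _ ≤ 2 ^ k * (k * (D * (h i ^ k * (4 * E / hat ω (1 - h i))))) +
          h i ^ k * (C₁ / hat ω (1 - h i) / h i) := by
          gcongr
          exact (hak i).2
      _ ≤ 2 ^ k * (k * (D * (h i ^ k * (4 * E / hat ω (1 - h i)))) / h i) +
          h i ^ k * (C₁ / hat ω (1 - h i) / h i) := by
          gcongr
          exact le_div_self (by positivity) h0 h1
      _ = C₂ / hat ω (1 - h i) * h i ^ k / h i := by rw [hC₂]; field_simp
      _ ≤ _ := by gcongr; linarith

/-- A multiplier with symbol estimates at scale `1 / h`, composed with division by the odd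
moments, acts on circle means with norm `O(1 / hat ω (1 - h))`. -/
lemma pmean_symb_block_le {ω : ℝ → ℝ} (hω : ω ∈ DHat) {p : ℝ} (hp : 0 < p) {k : ℕ}
    (hk : 2 ≤ k * min p 1) {ι : Type} {h : ι → ℝ} (hh : ∀ i, 0 < h i ∧ h i ≤ 1) {e : ι → ℕ → ℝ}
    (he : Symb k (fun i n => (((n : ℝ) + 1) * h i) ^ k) e) :
    ∃ D : ℝ, 0 < D ∧ ∀ i (b : ℕ → ℂ), (Summable fun n => ‖b n‖) →
      (Summable fun n : ℕ => ‖b n *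
        ((Real.exp (-(3 / 4 * h i * n)) * e i n * (oddMoment ω n)⁻¹ : ℝ) : ℂ)‖) ∧
      pmean p (pser fun n : ℕ => b n *
        ((Real.exp (-(3 / 4 * h i * n)) * e i n * (oddMoment ω n)⁻¹ : ℝ) : ℂ)) 1 ≤
        (D / hat ω (1 - h i)) ^ p * pmean p (pser b) 1 := by
  obtain ⟨C, hC, hker⟩ := kernel_bound hω hh he
  set A : ℝ := 64 + 2 ^ p with hA
  have hA0 : 0 < A := by positivity
  refine ⟨A ^ p⁻¹ * C, by positivity, fun i b hb => ?_⟩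
  obtain ⟨h0, h1⟩ := hh i
  obtain ⟨hs, hk1, hk2⟩ := hker i
  have hpos : 0 < hat ω (1 - h i) := hω.1.hat_pos _ ⟨by linarith, by linarith⟩
  set a : ℕ → ℝ := fun n => Real.exp (-(1 / 4 * h i * n)) * e i n * (oddMoment ω n)⁻¹ with ha
  have hs' : Summable fun n => ‖(a n : ℂ)‖ := by
    simpa only [Complex.norm_real, Real.norm_eq_abs] using hs
  -- Of the exponent `3/4`, the part `1/4` stays in the kernel and `1/2` is the damping built into
  -- `pmean_block_le`. The blocks below supply the missing `1/4` inside `e`.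
  have hfun : ∀ n : ℕ, b n *
      ((Real.exp (-(3 / 4 * h i * n)) * e i n * (oddMoment ω n)⁻¹ : ℝ) : ℂ) =
      (b n * a n) * (Real.exp (-(h i / 2)) : ℂ) ^ n := fun n => by
    have : Real.exp (-(3 / 4 * h i * n)) =
        Real.exp (-(1 / 4 * h i * n)) * Real.exp (-(h i / 2)) ^ n := by
      rw [← Real.exp_nat_mul, ← Real.exp_add]; congr 1; ring
    rw [this, ha]; push_cast; ring
  simp only [hfun]
  refine ⟨?_, ?_⟩
  · have h2 : Summable fun n : ℕ =>
        ‖b n * (a n : ℂ) * ((Real.exp (-(h i / 2)) : ℝ) : ℂ) ^ n‖ :=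
      summable_mul_pow (summable_hadamard hb hs') (Real.exp_pos _).le
        (Real.exp_le_one_iff.2 (by linarith))
    exact h2
  · refine (pmean_block_le hp hk h0 h1 hs' hb hk1 hk2).trans (le_of_eq ?_)
    rw [mul_div_assoc, Real.mul_rpow (by positivity) (by positivity), ← Real.rpow_mul hA0.le,
      inv_mul_cancel₀ hp.ne', Real.rpow_one]

/-! ### Cutoffs and the low, middle and high frequency blocks. -/

/-- A smooth cutoff, built from a polynomial. -/
def cutoff (k : ℕ) (y : ℝ) : ℝ := 1 - (1 - y) ^ k

lemma cutoff_eq (k : ℕ) (y : ℝ) : cutoff k y = y * ∑ i ∈ Finset.range k, (1 - y) ^ i := by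
  have := geom_sum_mul (1 - y) k
  rw [cutoff]; linarith

/-- With `y = e^{-hn}`, passing to `y²` doubles `h`. The factor `(1 - y)^k` gives vanishing of order
`k` at low frequencies, and the factor `y` gives decay at high ones. -/
lemma cutoff_sub_cutoff_sq (k : ℕ) (y : ℝ) :
    cutoff k y - cutoff k (y ^ 2) = y * ((1 - y) ^ k * ∑ i ∈ Finset.range k, (1 + y) ^ i) := by
  have h := geom_sum_mul (1 + y) k
  have e : (1 - y ^ 2) ^ k = (1 - y) ^ k * (1 + y) ^ k := by rw [← mul_pow]; congr 1; ring
  rw [cutoff, cutoff, e]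
  have h' : (1 + y) ^ k = (∑ i ∈ Finset.range k, (1 + y) ^ i) * y + 1 := by linarith
  rw [h']; ring

section families

variable {ι : Type} {h : ι → ℝ}

lemma symb_exp_one (hh : ∀ i, 0 < h i ∧ h i ≤ 1) {c : ℝ} (hc : 0 < c) (k : ℕ) :
    Symb k (fun _ _ => (1 : ℝ)) (fun i (n : ℕ) => Real.exp (-(c * h i * n))) :=
  (symb_exp hh hc k).mono 1 zero_le_one (fun _ _ => zero_le_one) fun i n => by
    have := (hh i).1
    rw [one_mul]
    exact Real.exp_le_one_iff.2 (neg_nonpos.2 (by positivity))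

lemma symb_geom_sum {k : ℕ} {a : ι → ℕ → ℝ} (ha : Symb k (fun _ _ => (1 : ℝ)) a) (m : ℕ) :
    Symb k (fun _ _ => (1 : ℝ)) (fun i n => ∑ j ∈ Finset.range m, a i n ^ j) :=
  Symb.sum (f := fun j i n => a i n ^ j) (fun _ _ => zero_le_one) fun j _ => by
    simpa using ha.pow j

lemma symb_one_add_mul_exp (hh : ∀ i, 0 < h i ∧ h i ≤ 1) (s : ℝ) (k : ℕ) :
    Symb k (fun _ _ => (1 : ℝ)) (fun i (n : ℕ) => 1 + s * Real.exp (-(h i * n))) := by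
  have h1 := (Symb.const (ι := ι) (k := k) (fun _ => 1) fun _ => zero_le_one).add
    ((symb_exp_one hh one_pos k).const_mul s)
  simpa only [one_mul] using h1

end families

/-- At the single scale `h = 1` the weight `(n + 1)^k` is at least `1`, so no vanishing at low
frequencies is required of the cutoff. -/
lemma pmean_low_block_le {ω : ℝ → ℝ} (hω : ω ∈ DHat) {p : ℝ} (hp : 0 < p) {k : ℕ}
    (hk : 2 ≤ k * min p 1) :
    ∃ D : ℝ, 0 < D ∧ ∀ b : ℕ → ℂ, (Summable fun n => ‖b n‖) →
      (Summable fun n : ℕ => ‖b n *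
        ((cutoff k (Real.exp (-(1 * n))) * (oddMoment ω n)⁻¹ : ℝ) : ℂ)‖) ∧
      pmean p (pser fun n : ℕ => b n *
        ((cutoff k (Real.exp (-(1 * n))) * (oddMoment ω n)⁻¹ : ℝ) : ℂ)) 1 ≤
        (D / hat ω (1 - 1)) ^ p * pmean p (pser b) 1 := by
  have hh : ∀ _ : Unit, (0 : ℝ) < 1 ∧ (1 : ℝ) ≤ 1 := fun _ => ⟨one_pos, le_rfl⟩
  have hsym := (symb_exp_one (h := fun _ : Unit => 1) hh (c := 1 / 4) (by norm_num) k).mul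
    (symb_geom_sum (symb_one_add_mul_exp hh (-1) k) k)
  have hsym' := hsym.mono (W' := fun _ n => (((n : ℝ) + 1) * 1) ^ k) 1 zero_le_one
    (fun _ _ => by positivity) fun _ n => by
      rw [one_mul, one_mul, mul_one]; exact one_le_pow₀ (by simp)
  obtain ⟨D, hD, hb⟩ := pmean_symb_block_le hω hp hk hh hsym'
  refine ⟨D, hD, fun b hbs => ?_⟩
  have := hb () b hbs
  have e : ∀ n : ℕ, Real.exp (-(3 / 4 * 1 * n)) * (Real.exp (-(1 / 4 * 1 * n)) *
      ∑ j ∈ Finset.range k, (1 + -1 * Real.exp (-(1 * n))) ^ j) =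
      cutoff k (Real.exp (-(1 * n))) := fun n => by
    rw [cutoff_eq, ← mul_assoc, ← Real.exp_add]
    congr 2
    · ring
    · ext j; ring
  simpa only [e] using this

lemma pmean_middle_block_le {ω : ℝ → ℝ} (hω : ω ∈ DHat) {p : ℝ} (hp : 0 < p) {k : ℕ}
    (hk : 2 ≤ k * min p 1) :
    ∃ D : ℝ, 0 < D ∧ ∀ h : ℝ, 0 < h → h ≤ 1 → ∀ b : ℕ → ℂ, (Summable fun n => ‖b n‖) →
      (Summable fun n : ℕ => ‖b n * (((cutoff k (Real.exp (-(h * n))) -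
        cutoff k (Real.exp (-(2 * h * n)))) * (oddMoment ω n)⁻¹ : ℝ) : ℂ)‖) ∧
      pmean p (pser fun n : ℕ => b n * (((cutoff k (Real.exp (-(h * n))) -
        cutoff k (Real.exp (-(2 * h * n)))) * (oddMoment ω n)⁻¹ : ℝ) : ℂ)) 1 ≤
        (D / hat ω (1 - h)) ^ p * pmean p (pser b) 1 := by
  have hh : ∀ i : Set.Ioc (0 : ℝ) 1, (0 : ℝ) < i.1 ∧ i.1 ≤ 1 := fun i => i.2
  have hsym := (symb_exp_one hh (c := 1 / 4) (by norm_num) k).mul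
    (((symb_one_sub_exp hh k).pow k).mul (symb_geom_sum (symb_one_add_mul_exp hh 1 k) k))
  simp only [one_mul, mul_one] at hsym
  obtain ⟨D, hD, hb⟩ := pmean_symb_block_le hω hp hk hh hsym
  refine ⟨D, hD, fun h h0 h1 b hbs => ?_⟩
  have := hb ⟨h, h0, h1⟩ b hbs
  have e : ∀ n : ℕ, Real.exp (-(3 / 4 * h * n)) * (Real.exp (-(1 / 4 * h * n)) *
      ((1 - Real.exp (-(h * n))) ^ k * ∑ j ∈ Finset.range k, (1 + Real.exp (-(h * n))) ^ j)) =
      cutoff k (Real.exp (-(h * n))) - cutoff k (Real.exp (-(2 * h * n))) := fun n => by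
    have e2 : Real.exp (-(2 * h * n)) = Real.exp (-(h * n)) ^ 2 := by
      rw [← Real.exp_nat_mul]; congr 1; push_cast; ring
    rw [e2, cutoff_sub_cutoff_sq, ← mul_assoc, ← Real.exp_add]
    congr 2; ring
  simpa only [e] using this

/-- Here `1 - cutoff = (1 - y)^k` supplies the vanishing at low frequencies. All frequencies above
`1/h` are treated together, the decay coming from `e^{-hn}`. -/
lemma pmean_high_block_le {ω : ℝ → ℝ} (hω : ω ∈ DHat) {p : ℝ} (hp : 0 < p) {k : ℕ}
    (hk : 2 ≤ k * min p 1) :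
    ∃ D : ℝ, 0 < D ∧ ∀ h : ℝ, 0 < h → h ≤ 1 → ∀ b : ℕ → ℂ, (Summable fun n => ‖b n‖) →
      (Summable fun n : ℕ => ‖b n * ((Real.exp (-(h * n)) *
        (1 - cutoff k (Real.exp (-(h * n)))) * (oddMoment ω n)⁻¹ : ℝ) : ℂ)‖) ∧
      pmean p (pser fun n : ℕ => b n * ((Real.exp (-(h * n)) *
        (1 - cutoff k (Real.exp (-(h * n)))) * (oddMoment ω n)⁻¹ : ℝ) : ℂ)) 1 ≤
        (D / hat ω (1 - h)) ^ p * pmean p (pser b) 1 := by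
  have hh : ∀ i : Set.Ioc (0 : ℝ) 1, (0 : ℝ) < i.1 ∧ i.1 ≤ 1 := fun i => i.2
  have hsym := (symb_exp_one hh (c := 1 / 4) (by norm_num) k).mul ((symb_one_sub_exp hh k).pow k)
  simp only [one_mul] at hsym
  obtain ⟨D, hD, hb⟩ := pmean_symb_block_le hω hp hk hh hsym
  refine ⟨D, hD, fun h h0 h1 b hbs => ?_⟩
  have := hb ⟨h, h0, h1⟩ b hbs
  have e : ∀ n : ℕ, Real.exp (-(3 / 4 * h * n)) * (Real.exp (-(1 / 4 * h * n)) *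
      (1 - Real.exp (-(h * n))) ^ k) =
      Real.exp (-(h * n)) * (1 - cutoff k (Real.exp (-(h * n)))) := fun n => by
    rw [cutoff, ← mul_assoc, ← Real.exp_add, sub_sub_cancel]
    congr 2; ring
  simpa only [e] using this

/-! ### Summation of the blocks. -/

lemma pser_sum {I : Finset ℕ} {b : ℕ → ℕ → ℂ} (hb : ∀ i ∈ I, Summable fun n => ‖b i n‖) {z : ℂ}
    (hz : ‖z‖ ≤ 1) : pser (fun n => ∑ i ∈ I, b i n) z = ∑ i ∈ I, pser (b i) z := by
  unfold pser
  rw [← Summable.tsum_finsetSum fun i hi => Summable.of_norm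
    ((hb i hi).of_nonneg_of_le (fun _ => norm_nonneg _) fun n => norm_term_le hz n)]
  simp only [Finset.sum_mul]

lemma pmean_sum_le_aux {p : ℝ} (hp : 0 < p) {I : Finset ℕ} {b : ℕ → ℕ → ℂ} {c : ℕ → ℝ}
    (hb : ∀ i ∈ I, Summable fun n => ‖b i n‖)
    (hpt : ∀ t : UCirc, ‖∑ i ∈ I, pser (b i) (ev t)‖ ^ p ≤ ∑ i ∈ I, c i * ‖pser (b i) (ev t)‖ ^ p) :
    pmean p (pser fun n => ∑ i ∈ I, b i n) 1 ≤ ∑ i ∈ I, c i * pmean p (pser (b i)) 1 := by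
  have hc : ∀ i ∈ I, Continuous fun t : UCirc => ‖pser (b i) (ev t)‖ ^ p := fun i hi =>
    continuous_norm_rpow_comp hp (continuousOn_pser (hb i hi)) continuous_ev fun t => by simp
  have hcs : Continuous fun t : UCirc => ‖∑ i ∈ I, pser (b i) (ev t)‖ ^ p := by
    refine Continuous.rpow_const (Continuous.norm ?_) fun _ => Or.inr hp.le
    exact continuous_finsetSum _ fun i hi =>
      (continuousOn_pser (hb i hi)).comp_continuous continuous_ev fun t => by simp
  simp only [pmean, Complex.ofReal_one, one_mul]
  have h1 : ∀ t : UCirc, pser (fun n => ∑ i ∈ I, b i n) (ev t) = ∑ i ∈ I, pser (b i) (ev t) :=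
    fun t => pser_sum hb (by simp)
  simp only [h1]
  calc _ ≤ ∫ t, ∑ i ∈ I, c i * ‖pser (b i) (ev t)‖ ^ p ∂arcMeasure :=
        integral_mono (integrable_of_continuous hcs) (integrable_finsetSum _ fun i hi =>
          (integrable_of_continuous (hc i hi)).const_mul _) hpt
    _ = _ := by
        rw [integral_finsetSum _ fun i hi => (integrable_of_continuous (hc i hi)).const_mul _]
        simp only [integral_const_mul]

lemma sum_rpow_le_sum_rpow {p : ℝ} (hp : 0 < p) (hp1 : p ≤ 1) (I : Finset ℕ) {f : ℕ → ℝ}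
    (hf : ∀ i, 0 ≤ f i) : (∑ i ∈ I, f i) ^ p ≤ ∑ i ∈ I, f i ^ p := by
  classical
  induction I using Finset.induction_on with
  | empty => simp [Real.zero_rpow hp.ne']
  | insert a s ha ih =>
    rw [Finset.sum_insert ha, Finset.sum_insert ha]
    exact (Real.rpow_add_le_add_rpow (hf a) (Finset.sum_nonneg fun i _ => hf i) hp.le hp1).trans
      (by gcongr)

lemma pmean_sum_le_of_le_one {p : ℝ} (hp : 0 < p) (hp1 : p ≤ 1) {I : Finset ℕ} {b : ℕ → ℕ → ℂ}
    (hb : ∀ i ∈ I, Summable fun n => ‖b i n‖) {w : ℕ → ℝ} {Q : ℝ}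
    (hw : ∀ i ∈ I, pmean p (pser (b i)) 1 ≤ w i ^ p * Q) :
    pmean p (pser fun n => ∑ i ∈ I, b i n) 1 ≤ (∑ i ∈ I, w i ^ p) * Q := by
  refine (pmean_sum_le_aux hp (c := fun _ => 1) hb fun t => ?_).trans ?_
  · simp only [one_mul]
    refine le_trans ?_ (sum_rpow_le_sum_rpow hp hp1 I fun i => norm_nonneg _)
    gcongr; exact norm_sum_le _ _
  · rw [Finset.sum_mul]
    exact Finset.sum_le_sum fun i hi => by rw [one_mul]; exact hw i hi

/-- Hölder with the weights `w i` replaces Minkowski: `(∑ w f)^p ≤ (∑ w)^{p-1} ∑ w f^p`, applied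
with `f = ‖pser (b i)‖ / w i`. -/
lemma pmean_sum_le_of_one_le {p : ℝ} (hp1 : 1 ≤ p) {I : Finset ℕ} {b : ℕ → ℕ → ℂ}
    (hb : ∀ i ∈ I, Summable fun n => ‖b i n‖) {w : ℕ → ℝ} (hw0 : ∀ i, 0 < w i) {Q : ℝ}
    (hw : ∀ i ∈ I, pmean p (pser (b i)) 1 ≤ w i ^ p * Q) :
    pmean p (pser fun n => ∑ i ∈ I, b i n) 1 ≤ (∑ i ∈ I, w i) ^ p * Q := by
  have hp : 0 < p := by linarith
  have hW : 0 ≤ ∑ i ∈ I, w i := Finset.sum_nonneg fun i _ => (hw0 i).le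
  refine (pmean_sum_le_aux hp
    (c := fun i => (∑ i ∈ I, w i) ^ (p - 1) * w i ^ (1 - p)) hb fun t => ?_).trans ?_
  · set f : ℕ → ℝ := fun i => ‖pser (b i) (ev t)‖ / w i with hf
    have hf0 : ∀ i, 0 ≤ f i := fun i => div_nonneg (norm_nonneg _) (hw0 i).le
    have hwf : ∀ i, w i * f i = ‖pser (b i) (ev t)‖ := fun i => by
      rw [hf]; field_simp [(hw0 i).ne']
    have h1 := Real.inner_le_weight_mul_Lp_of_nonneg I hp1 w f (fun i => (hw0 i).le) hf0
    have hX : 0 ≤ ∑ i ∈ I, w i * f i ^ p := Finset.sum_nonneg fun i _ =>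
      mul_nonneg (hw0 i).le (Real.rpow_nonneg (hf0 i) _)
    calc ‖∑ i ∈ I, pser (b i) (ev t)‖ ^ p ≤ (∑ i ∈ I, w i * f i) ^ p := by
          gcongr; simp only [hwf]; exact norm_sum_le _ _
      _ ≤ ((∑ i ∈ I, w i) ^ (1 - p⁻¹) * (∑ i ∈ I, w i * f i ^ p) ^ p⁻¹) ^ p := by
          refine Real.rpow_le_rpow (Finset.sum_nonneg fun i _ => mul_nonneg (hw0 i).le (hf0 i)) h1
            hp.le
      _ = (∑ i ∈ I, w i) ^ (p - 1) * ∑ i ∈ I, w i * f i ^ p := by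
          rw [Real.mul_rpow (by positivity) (by positivity), ← Real.rpow_mul hW,
            ← Real.rpow_mul hX, inv_mul_cancel₀ hp.ne', Real.rpow_one]
          congr 2; field_simp
      _ = _ := by
          rw [Finset.mul_sum]
          refine Finset.sum_congr rfl fun i _ => ?_
          rw [hf, Real.div_rpow (norm_nonneg _) (hw0 i).le, Real.rpow_sub (hw0 i), Real.rpow_one]
          field_simp
  · calc ∑ i ∈ I, (∑ i ∈ I, w i) ^ (p - 1) * w i ^ (1 - p) * pmean p (pser (b i)) 1
        ≤ ∑ i ∈ I, (∑ i ∈ I, w i) ^ (p - 1) * w i * Q := by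
          refine Finset.sum_le_sum fun i hi => ?_
          have h2 : w i ^ (1 - p) * w i ^ p = w i := by
            rw [← Real.rpow_add (hw0 i)]; simp
          have h3 : 0 ≤ w i ^ (1 - p) := Real.rpow_nonneg (hw0 i).le _
          calc _ ≤ (∑ i ∈ I, w i) ^ (p - 1) * w i ^ (1 - p) * (w i ^ p * Q) := by
                gcongr; exact hw i hi
            _ = (∑ i ∈ I, w i) ^ (p - 1) * (w i ^ (1 - p) * w i ^ p) * Q := by ring
            _ = _ := by rw [h2]
      _ = ((∑ i ∈ I, w i) ^ (p - 1) * ∑ i ∈ I, w i) * Q := by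
          rw [← Finset.sum_mul, ← Finset.mul_sum]
      _ = _ := by
          congr 1
          nth_rewrite 2 [← Real.rpow_one (∑ i ∈ I, w i)]
          rw [← Real.rpow_add_of_nonneg hW (by linarith) zero_le_one]; simp

/-- The last `m` terms are each at most `s J`; the earlier ones are covered by induction at `J - m`,
where `s` is smaller by the factor `θ`, and `θ m/(1 - θ) + m = m/(1 - θ)`. A negative `θ` forces `s
= 0`. -/
lemma sum_le_of_geometric {s : ℕ → ℝ} (hs : Monotone s) (hs0 : ∀ j, 0 ≤ s j) {m : ℕ}
    {θ : ℝ} (hθ1 : θ < 1) (h : ∀ j, s j ≤ θ * s (j + m)) (J : ℕ) :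
    ∑ j ∈ Finset.range (J + 1), s j ≤ m / (1 - θ) * s J ∨ m = 0 := by
  rcases Nat.eq_zero_or_pos m with hm | hm
  · exact Or.inr hm
  left
  have hθ : 0 < 1 - θ := by linarith
  by_cases hθ0 : 0 ≤ θ
  · induction J using Nat.strong_induction_on with
    | _ J ih =>
      have hlast : ∀ N : ℕ, N ≤ m → ∀ f : ℕ → ℕ, (∀ i < N, f i ≤ J) →
          ∑ i ∈ Finset.range N, s (f i) ≤ m * s J := fun N hN f hf => by
        refine (Finset.sum_le_card_nsmul _ _ (s J) fun i hi =>
          hs (hf i (Finset.mem_range.1 hi))).trans ?_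
        rw [Finset.card_range, nsmul_eq_mul]
        have := hs0 J
        gcongr
      rcases lt_or_ge J m with hJ | hJ
      · refine (hlast (J + 1) hJ id fun i hi => Nat.lt_succ_iff.1 hi).trans ?_
        have := hs0 J
        gcongr
        exact le_div_self (by positivity) hθ (by linarith)
      · obtain ⟨d, rfl⟩ := Nat.exists_eq_add_of_le' hJ
        rw [show d + m + 1 = (d + 1) + m by ring, Finset.sum_range_add]
        have h1 := ih d (by omega)
        have h2 := hlast m le_rfl (fun i => d + 1 + i) fun i hi => by omega
        calc _ ≤ m / (1 - θ) * s d + m * s (d + m) := add_le_add h1 h2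
          _ ≤ m / (1 - θ) * (θ * s (d + m)) + m * s (d + m) := by gcongr; exact h d
          _ = _ := by field_simp; ring
  · have hz : ∀ j, s j = 0 := fun j => by
      refine le_antisymm ((h j).trans ?_) (hs0 j)
      nlinarith [hs0 (j + m)]
    simp [hz]

/-- The tail integrals at dyadic distances from `1` grow geometrically. -/
lemma sum_hat_inv_rpow_le {ω : ℝ → ℝ} (hω : ω ∈ DCheck) {q : ℝ} (hq : 0 < q) :
    ∃ K : ℝ, 0 < K ∧ ∀ J : ℕ, ∑ j ∈ Finset.range (J + 1), (hat ω (1 - (1 / 2) ^ j))⁻¹ ^ q ≤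
      K * (hat ω (1 - (1 / 2) ^ J))⁻¹ ^ q := by
  obtain ⟨hw, k, C, hk, hC, hd⟩ := hω
  -- Since `2^m > k`, one step of the lower doubling condition is contained in `m` dyadic steps.
  obtain ⟨m, hm⟩ := pow_unbounded_of_one_lt k one_lt_two
  have hm0 : m ≠ 0 := by rintro rfl; simp at hm; linarith
  have hpow : ∀ j : ℕ, (0 : ℝ) < (1 / 2) ^ j ∧ ((1 : ℝ) / 2) ^ j ≤ 1 := fun j =>
    ⟨by positivity, pow_le_one₀ (by norm_num) (by norm_num)⟩
  have hpos : ∀ j : ℕ, 0 < hat ω (1 - (1 / 2) ^ j) := fun j =>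
    hw.hat_pos _ ⟨by linarith [(hpow j).2], by linarith [(hpow j).1]⟩
  have hC0 : 0 < C := by linarith
  have hθ : C⁻¹ ^ q < 1 := Real.rpow_lt_one (by positivity) (inv_lt_one_of_one_lt₀ hC) hq
  refine ⟨m / (1 - C⁻¹ ^ q), div_pos (by positivity) (by linarith), fun J => ?_⟩
  refine (sum_le_of_geometric (s := fun j => (hat ω (1 - (1 / 2) ^ j))⁻¹ ^ q) (m := m) ?_ ?_ hθ ?_
    J).resolve_right hm0
  · intro i j hij
    have h1 : hat ω (1 - (1 / 2) ^ j) ≤ hat ω (1 - (1 / 2) ^ i) := by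
      refine hw.hat_anti (by linarith [(hpow i).2]) ?_ (by linarith [(hpow j).1])
      have : ((1 : ℝ) / 2) ^ j ≤ (1 / 2) ^ i :=
        pow_le_pow_of_le_one (by norm_num) (by norm_num) hij
      linarith
    have := hpos i
    have := hpos j
    simp only
    gcongr
  · intro j; have := hpos j; positivity
  · intro j
    have h1 := hd (1 - (1 / 2) ^ j) ⟨by linarith [(hpow j).2], by linarith [(hpow j).1]⟩
    rw [sub_sub_cancel] at h1
    have h2 : hat ω (1 - (1 / 2) ^ (j + m)) ≤ hat ω (1 - (1 / 2) ^ j / k) := by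
      have e : ((1 : ℝ) / 2) ^ (j + m) ≤ (1 / 2) ^ j / k := by
        rw [pow_add, div_eq_mul_inv _ k]
        gcongr
        rw [one_div, inv_pow]; exact inv_anti₀ (by linarith) hm.le
      have e2 : (1 / 2 : ℝ) ^ j / k ≤ 1 := (div_le_self (hpow j).1.le hk.le).trans (hpow j).2
      exact hw.hat_anti (by linarith) (by linarith) (by linarith [(hpow (j + m)).1])
    have h3 := hpos j
    have h4 := hpos (j + m)
    rw [← Real.mul_rpow (by positivity) (by positivity)]
    gcongr
    rw [← mul_inv]
    gcongr
    exact (mul_le_mul_of_nonneg_left h2 hC0.le).trans h1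

/-- The block bounds form a geometric progression, summed in `p`-th powers when `p ≤ 1` and in first
powers when `p ≥ 1`. The minimum occurs because the last two blocks, middle and high, share the
scale `2^{-J}`. -/
lemma pmean_dyadic_sum_le {ω : ℝ → ℝ} (hω : ω ∈ DCheck) {p : ℝ} (hp : 0 < p) :
    ∃ K : ℝ, 0 < K ∧ ∀ (J : ℕ) (b : ℕ → ℕ → ℂ) (D Q : ℝ), 0 < D → 0 ≤ Q →
      (∀ i ∈ Finset.range (J + 2), Summable fun n => ‖b i n‖) →
      (∀ i ∈ Finset.range (J + 2), pmean p (pser (b i)) 1 ≤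
        (D * (hat ω (1 - (1 / 2) ^ (min i J)))⁻¹) ^ p * Q) →
      pmean p (pser fun n => ∑ i ∈ Finset.range (J + 2), b i n) 1 ≤
        (K * D * (hat ω (1 - (1 / 2) ^ J))⁻¹) ^ p * Q := by
  have hpos : ∀ j : ℕ, 0 < hat ω (1 - (1 / 2) ^ j) := fun j => by
    have h1 : ((1 : ℝ) / 2) ^ j ≤ 1 := pow_le_one₀ (by norm_num) (by norm_num)
    have h2 : (0 : ℝ) < (1 / 2) ^ j := by positivity
    exact hω.1.hat_pos _ ⟨by linarith, by linarith⟩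
  have hsum : ∀ q : ℝ, 0 < q → ∃ K : ℝ, 0 < K ∧ ∀ (J : ℕ) (D : ℝ), 0 < D →
      ∑ i ∈ Finset.range (J + 2), (D * (hat ω (1 - (1 / 2) ^ (min i J)))⁻¹) ^ q ≤
        K * (D * (hat ω (1 - (1 / 2) ^ J))⁻¹) ^ q := fun q hq => by
    obtain ⟨K, hK, h⟩ := sum_hat_inv_rpow_le hω hq
    refine ⟨K + 1, by linarith, fun J D hD => ?_⟩
    rw [Finset.sum_range_succ, add_mul, one_mul, min_eq_right (Nat.le_succ J)]
    gcongr
    calc _ = ∑ i ∈ Finset.range (J + 1), D ^ q * (hat ω (1 - (1 / 2) ^ i))⁻¹ ^ q := by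
          refine Finset.sum_congr rfl fun i hi => ?_
          rw [min_eq_left (Nat.lt_succ_iff.1 (Finset.mem_range.1 hi)),
            Real.mul_rpow hD.le (inv_nonneg.2 (hpos i).le)]
      _ ≤ D ^ q * (K * (hat ω (1 - (1 / 2) ^ J))⁻¹ ^ q) := by
          rw [← Finset.mul_sum]
          gcongr
          exact h J
      _ = _ := by
          rw [Real.mul_rpow hD.le (inv_nonneg.2 (hpos J).le)]; ring
  rcases le_total p 1 with hp1 | hp1
  · obtain ⟨K, hK, h⟩ := hsum p hp
    refine ⟨K ^ p⁻¹, by positivity, fun J b D Q hD hQ hb hw => ?_⟩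
    refine (pmean_sum_le_of_le_one hp hp1 hb hw).trans ?_
    have := hpos J
    rw [mul_assoc (K ^ p⁻¹), Real.mul_rpow (by positivity) (by positivity), ← Real.rpow_mul hK.le,
      inv_mul_cancel₀ hp.ne', Real.rpow_one]
    gcongr
    exact h J D hD
  · obtain ⟨K, hK, h⟩ := hsum 1 one_pos
    simp only [Real.rpow_one] at h
    refine ⟨K, hK, fun J b D Q hD hQ hb hw => ?_⟩
    have hw0 : ∀ i, 0 < D * (hat ω (1 - (1 / 2) ^ (min i J)))⁻¹ := fun i =>
      mul_pos hD (inv_pos.2 (hpos _))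
    refine (pmean_sum_le_of_one_le hp1 hb hw0 hw).trans ?_
    rw [mul_assoc K]
    have := Finset.sum_nonneg fun i (_ : i ∈ Finset.range (J + 2)) => (hw0 i).le
    gcongr
    exact h J D hD

/-! ### Division by the odd moments on circle means. -/

/-- Division by the odd moments, regularised at a dyadic scale `h`, has norm `O(1 / hat ω (1 - h))`
on circle means. -/
lemma pmean_exp_mul_inv_oddMoment_le {ω : ℝ → ℝ} (hω : ω ∈ DClass) {p : ℝ} (hp : 0 < p) :
    ∃ C : ℝ, 0 < C ∧ ∀ (J : ℕ) (b : ℕ → ℂ), (Summable fun n => ‖b n‖) →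
      (Summable fun n : ℕ => ‖b n *
        ((Real.exp (-((1 / 2) ^ J * n)) * (oddMoment ω n)⁻¹ : ℝ) : ℂ)‖) ∧
      pmean p (pser fun n : ℕ => b n *
        ((Real.exp (-((1 / 2) ^ J * n)) * (oddMoment ω n)⁻¹ : ℝ) : ℂ)) 1 ≤
        (C * (hat ω (1 - (1 / 2) ^ J))⁻¹) ^ p * pmean p (pser b) 1 := by
  obtain ⟨k, hk⟩ := exists_nat_ge (2 / min p 1)
  have hmin : 0 < min p 1 := lt_min hp one_pos
  rw [div_le_iff₀ hmin] at hk
  obtain ⟨D₁, hD₁, hlow⟩ := pmean_low_block_le hω.1 hp hk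
  obtain ⟨D₂, hD₂, hmid⟩ := pmean_middle_block_le hω.1 hp hk
  obtain ⟨D₃, hD₃, hhigh⟩ := pmean_high_block_le hω.1 hp hk
  obtain ⟨K, hK, hsum⟩ := pmean_dyadic_sum_le hω.2 hp
  set D := D₁ + D₂ + D₃ with hD
  have hD0 : 0 < D := by positivity
  refine ⟨K * D, by positivity, fun J b hb => ?_⟩
  have hpow : ∀ j : ℕ, (0 : ℝ) < (1 / 2) ^ j ∧ ((1 : ℝ) / 2) ^ j ≤ 1 := fun j =>
    ⟨by positivity, pow_le_one₀ (by norm_num) (by norm_num)⟩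
  have hpos : ∀ j : ℕ, 0 < hat ω (1 - (1 / 2) ^ j) := fun j =>
    hω.1.1.hat_pos _ ⟨by linarith [(hpow j).2], by linarith [(hpow j).1]⟩
  set ρ : ℝ := Real.exp (-(1 / 2) ^ J) with hρ
  have hρ1 : ρ ≤ 1 := Real.exp_le_one_iff.2 (by linarith [(hpow J).1])
  have hX : ∀ n : ℕ, Real.exp (-((1 / 2) ^ J * n)) = ρ ^ n := fun n => by
    rw [hρ, ← Real.exp_nat_mul]; congr 1; ring
  -- In the low and middle blocks the factor `e^{-hn}` is moved into the coefficients, where it only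
  -- lowers the mean; in the high block it stays in the multiplier, which needs its decay.
  set b' : ℕ → ℂ := fun n => b n * (ρ : ℂ) ^ n with hb'
  have hbs' : Summable fun n => ‖b' n‖ := summable_mul_pow hb (Real.exp_pos _).le hρ1
  have hQ : pmean p (pser b') 1 ≤ pmean p (pser b) 1 := by
    rw [hb', pmean_pser_dilate, mul_one]
    exact pmean_mono hp (diffContOnCl_pser hb) (Real.exp_pos _).le hρ1
  have hQ0 : 0 ≤ pmean p (pser b) 1 := pmean_nonneg _ _ _
  -- The shift by one, with `Ψ 0 = 0`, makes the low block the first difference, so the blocks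
  -- telescope to `Ψ (J + 1)`; the high block carries `1 - Ψ (J + 1)`.
  set Ψ : ℕ → ℕ → ℝ := fun j n =>
    Nat.casesOn j 0 fun i => cutoff k (Real.exp (-((1 / 2) ^ i * n))) with hΨ
  set B : ℕ → ℕ → ℂ := fun i n => if i = J + 1
    then b n * ((Real.exp (-((1 / 2) ^ J * n)) * (1 - Ψ (J + 1) n) * (oddMoment ω n)⁻¹ : ℝ) : ℂ)
    else b' n * (((Ψ (i + 1) n - Ψ i n) * (oddMoment ω n)⁻¹ : ℝ) : ℂ) with hB
  have hblock : ∀ i ∈ Finset.range (J + 2), (Summable fun n => ‖B i n‖) ∧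
      pmean p (pser (B i)) 1 ≤
        (D * (hat ω (1 - (1 / 2) ^ (min i J)))⁻¹) ^ p * pmean p (pser b) 1 := fun i hi => by
    have hi' : i < J + 2 := Finset.mem_range.1 hi
    have hle : ∀ {D' Q : ℝ} {j : ℕ}, 0 < D' → D' ≤ D → Q ≤ pmean p (pser b) 1 →
        (D' / hat ω (1 - (1 / 2) ^ j)) ^ p * Q ≤
          (D * (hat ω (1 - (1 / 2) ^ j))⁻¹) ^ p * pmean p (pser b) 1 :=
      fun {D' Q j} h0 hD' hQ' => by
        have := hpos j
        rw [div_eq_mul_inv]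
        refine (mul_le_mul_of_nonneg_left hQ' (by positivity)).trans ?_
        gcongr
    by_cases hiJ : i = J + 1
    · have hBi : B i = fun n : ℕ => b n * ((Real.exp (-((1 / 2) ^ J * n)) *
          (1 - Ψ (J + 1) n) * (oddMoment ω n)⁻¹ : ℝ) : ℂ) := by
        ext n; rw [hB]; simp only [hiJ, if_true]
      rw [hBi, hiJ, min_eq_right (Nat.le_succ J)]
      obtain ⟨h1, h2⟩ := hhigh _ (hpow J).1 (hpow J).2 b hb
      exact ⟨h1, h2.trans (hle hD₃ (by linarith) le_rfl)⟩
    · have hBi : B i = fun n : ℕ =>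
          b' n * (((Ψ (i + 1) n - Ψ i n) * (oddMoment ω n)⁻¹ : ℝ) : ℂ) := by
        ext n; rw [hB]; simp only [hiJ, if_false]
      rw [hBi, min_eq_left (by omega)]
      rcases i with _ | j
      · obtain ⟨h1, h2⟩ := hlow b' hbs'
        have e : ∀ n, Ψ 1 n - Ψ 0 n = cutoff k (Real.exp (-(1 * n))) := fun n => by simp [hΨ]
        simp only [zero_add, e, pow_zero]
        refine ⟨h1, h2.trans ?_⟩
        simpa using hle (j := 0) hD₁ (by linarith) hQ
      · obtain ⟨h1, h2⟩ := hmid _ (hpow (j + 1)).1 (hpow (j + 1)).2 b' hbs'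
        have e : ∀ n, Ψ (j + 1 + 1) n - Ψ (j + 1) n =
            cutoff k (Real.exp (-((1 / 2) ^ (j + 1) * n))) -
              cutoff k (Real.exp (-(2 * (1 / 2) ^ (j + 1) * n))) := fun n => by
          simp only [hΨ]
          congr 5; ring
        simp only [e]
        exact ⟨h1, h2.trans (hle hD₂ (by linarith) hQ)⟩
  have hsumB : ∀ n, ∑ i ∈ Finset.range (J + 2), B i n =
      b n * ((Real.exp (-((1 / 2) ^ J * n)) * (oddMoment ω n)⁻¹ : ℝ) : ℂ) := fun n => by
    rw [Finset.sum_range_succ]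
    have h1 : ∑ i ∈ Finset.range (J + 1), B i n =
        b' n * ((Ψ (J + 1) n * (oddMoment ω n)⁻¹ : ℝ) : ℂ) := by
      have h2 := Finset.sum_range_sub (fun i => Ψ i n) (J + 1)
      have h3 : Ψ 0 n = 0 := rfl
      rw [h3, sub_zero] at h2
      rw [← h2, Finset.sum_mul, Complex.ofReal_sum, Finset.mul_sum]
      refine Finset.sum_congr rfl fun i hi => ?_
      have : i ≠ J + 1 := (Finset.mem_range.1 hi).ne
      simp only [hB, this, if_false]
    rw [h1]
    simp only [hB, if_true, hb', hX]
    push_cast; ring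
  simp only [← hsumB]
  refine ⟨?_, hsum J B D _ hD0 hQ0 (fun i hi => (hblock i hi).1) fun i hi => (hblock i hi).2⟩
  exact (summable_sum fun i hi => (hblock i hi).1).of_nonneg_of_le (fun _ => norm_nonneg _)
    fun n => norm_sum_le _ _

/-- Circle means of the fractional derivative, compared with those of the function on a slightly
larger circle. -/
lemma pmean_mul_inv_oddMoment_le {ω : ℝ → ℝ} (hω : ω ∈ DClass) {p : ℝ} (hp : 0 < p) :
    ∃ C : ℝ, 0 < C ∧ ∀ b : ℕ → ℂ, (∀ t : ℝ, 0 ≤ t → t < 1 → Summable fun n => ‖b n‖ * t ^ n) →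
      ∀ r : ℝ, 0 ≤ r → r < 1 →
        (Summable fun n : ℕ => ‖b n * (((oddMoment ω n)⁻¹ : ℝ) : ℂ)‖ * r ^ n) ∧
        pmean p (pser fun n : ℕ => b n * (((oddMoment ω n)⁻¹ : ℝ) : ℂ)) r * hat ω r ^ p ≤
          C * pmean p (pser b) ((1 + r) / 2) := by
  obtain ⟨C, hC, hmain⟩ := pmean_exp_mul_inv_oddMoment_le hω hp
  obtain ⟨d, hd⟩ := hat_doubling_pow hω.1
  refine ⟨(C * 8 ^ d) ^ p, by positivity, fun b hb r hr0 hr1 => ?_⟩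
  obtain ⟨m, hm1, hm2⟩ := exists_nat_pow_near_of_lt_one (sub_pos.2 hr1) (by linarith : 1 - r ≤ 1)
    (by norm_num : (0 : ℝ) < 1 / 2) (by norm_num)
  -- Two extra halvings place `h` between `(1 - r)/4` and `(1 - r)/2`.
  set J := m + 2 with hJ
  set h : ℝ := (1 / 2) ^ J with hh
  have hh1 : (1 - r) / 4 ≤ h := by
    rw [hh, hJ, pow_add]; norm_num; norm_num at hm2; linarith
  have hh2 : h ≤ (1 - r) / 2 := by
    rw [hh, hJ, pow_add]; rw [pow_succ] at hm1; norm_num at hm1 ⊢; linarith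
  have hh0 : 0 < h := by positivity
  -- Since `ρ^n e^{-hn} = r^n`, the regularised multiplier applied to the dilate by `ρ` gives the
  -- fractional derivative on the circle of radius `r`; the bound on `h` keeps `ρ ≤ (1 + r)/2`.
  set ρ : ℝ := r * Real.exp h with hρ
  have hρ0 : 0 ≤ ρ := by positivity
  have hρ1 : ρ ≤ (1 + r) / 2 := by
    have h3 : Real.exp h * ((1 + r) / 2) ≤ 1 := by
      calc _ ≤ Real.exp h * Real.exp (-h) := by
            gcongr; linarith [Real.add_one_le_exp (-h)]
        _ = 1 := by rw [← Real.exp_add]; simp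
    nlinarith [sq_nonneg (1 - r), Real.exp_pos h]
  have hρlt : ρ < 1 := by linarith
  set b' : ℕ → ℂ := fun n => b n * (ρ : ℂ) ^ n with hb'
  have hbs : Summable fun n => ‖b' n‖ := by
    simpa [hb', norm_mul, abs_of_nonneg hρ0] using hb ρ hρ0 hρlt
  obtain ⟨h1, h2⟩ := hmain J b' hbs
  have e : ∀ n : ℕ, b' n * ((Real.exp (-((1 / 2) ^ J * n)) * (oddMoment ω n)⁻¹ : ℝ) : ℂ) =
      b n * (((oddMoment ω n)⁻¹ : ℝ) : ℂ) * (r : ℂ) ^ n := fun n => by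
    have : ρ ^ n * Real.exp (-((1 / 2) ^ J * n)) = r ^ n := by
      rw [hρ, mul_pow, mul_assoc, ← Real.exp_nat_mul, ← Real.exp_add]
      rw [← hh, mul_comm, mul_comm h, add_neg_cancel, Real.exp_zero, one_mul]
    have h3 : (ρ : ℂ) ^ n * (Real.exp (-((1 / 2) ^ J * n)) : ℂ) = (r : ℂ) ^ n := by
      exact_mod_cast this
    rw [hb', ← h3]; push_cast; ring
  simp only [e] at h1 h2
  refine ⟨by simpa [norm_mul, abs_of_nonneg hr0] using h1, ?_⟩
  rw [pmean_pser_dilate, mul_one] at h2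
  have hb2 : pmean p (pser b') 1 ≤ pmean p (pser b) ((1 + r) / 2) := by
    set R : ℝ := (1 + r) / 2 with hR
    have hR0 : 0 < R := by linarith
    have hbR : Summable fun n => ‖b n * (R : ℂ) ^ n‖ := by
      simpa [norm_mul, abs_of_pos hR0] using hb R hR0.le (by linarith)
    have h3 := pmean_mono hp (diffContOnCl_pser hbR) (by positivity) ((div_le_one hR0).2 hρ1)
    rw [pmean_pser_dilate, pmean_pser_dilate, mul_one, mul_div_cancel₀ _ hR0.ne'] at h3
    rwa [hb', pmean_pser_dilate, mul_one]
  have hhat : hat ω r ≤ 8 ^ d * hat ω (1 - h) := by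
    have h3 := hd (1 - r) 4 (by linarith) (by linarith) (by norm_num)
    rw [sub_sub_cancel] at h3
    norm_num at h3
    refine h3.trans ?_
    gcongr
    exact hω.1.1.hat_anti (by linarith) (by linarith) (by linarith)
  have hpos : 0 < hat ω (1 - h) := hω.1.1.hat_pos _ ⟨by linarith, by linarith⟩
  have hposr : 0 < hat ω r := hω.1.1.hat_pos _ ⟨hr0, hr1⟩
  calc _ ≤ ((C * (hat ω (1 - h))⁻¹) ^ p * pmean p (pser b) ((1 + r) / 2)) *
        (8 ^ d * hat ω (1 - h)) ^ p := by
        have := pmean_nonneg p (pser b) ((1 + r) / 2)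
        gcongr
        exact h2.trans (by gcongr)
    _ = _ := by
        rw [mul_right_comm, ← Real.mul_rpow (by positivity) (by positivity)]
        congr 2; field_simp

/-! ### Area integrals of radial weights, and dilation of increasing functions. -/

lemma IsRadialWeight.aemeasurable {ω : ℝ → ℝ} (hω : IsRadialWeight ω) :
    AEMeasurable ω (volume.restrict (Set.Ioo 0 1)) :=
  (hω.integrableOn_Icc.mono_set Set.Ioo_subset_Icc_self).aemeasurable

/-- The weighted area integral in polar coordinates. -/
lemma weightedIntegral_eq {p : ℝ} (hp : 0 < p) {w : ℝ → ℝ}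
    (hw : AEMeasurable w (volume.restrict (Set.Ioo 0 1))) {F : ℂ → ℂ}
    (hF : ContinuousOn F (Metric.ball 0 1)) :
    weightedIntegral p w F = ∫⁻ r in Set.Ioo (0 : ℝ) 1,
      ENNReal.ofReal (2 * r * pmean p F r) * ENNReal.ofReal (w r) := by
  classical
  -- Extension by zero makes the integrand measurable on the whole plane and removes the
  -- uncontrolled values of `F` and `w` outside the disc.
  set G : ℂ → ℂ := (Metric.ball 0 1).piecewise F 0 with hG
  have hGm : Measurable G :=
    hF.measurable_piecewise continuousOn_const Metric.isOpen_ball.measurableSet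
  have hGin : ∀ z : ℂ, ‖z‖ < 1 → G z = F z := fun z hz =>
    Set.piecewise_eq_of_mem _ _ _ (mem_ball_zero_iff.2 hz)
  have hGout : ∀ z : ℂ, ¬ ‖z‖ < 1 → G z = 0 := fun z hz =>
    Set.piecewise_eq_of_notMem _ _ _ fun h => hz (mem_ball_zero_iff.1 h)
  set g : ℂ → ENNReal := fun z => ENNReal.ofReal (‖G z‖ ^ p) * ENNReal.ofReal (w ‖z‖) with hg
  have h1 : weightedIntegral p w F = ENNReal.ofReal (1 / Real.pi) * ∫⁻ z, g z := by
    rw [weightedIntegral, discArea, lintegral_smul_measure, smul_eq_mul,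
      ← lintegral_indicator Metric.isOpen_ball.measurableSet]
    congr 2
    ext z
    by_cases hz : ‖z‖ < 1
    · rw [Set.indicator_of_mem (mem_ball_zero_iff.2 hz), hg]
      simp only
      rw [hGin z hz, ENNReal.ofReal_mul (by positivity)]
    · rw [Set.indicator_of_notMem fun h => hz (mem_ball_zero_iff.1 h), hg]
      simp only
      rw [hGout z hz]
      simp [Real.zero_rpow hp.ne']
  have hgm : AEMeasurable (fun q : ℝ × ℝ => g (q.1 * Complex.exp (q.2 * Complex.I)))
      ((volume.restrict (Set.Ioi 0)).prod (volume.restrict (Set.Ioo (-Real.pi) Real.pi))) := by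
    have hw' : AEMeasurable ((Set.Ioo (0 : ℝ) 1).indicator w) (volume.restrict (Set.Ioi 0)) :=
      ((aemeasurable_indicator_iff measurableSet_Ioo).2 hw).restrict
    have h2 : AEMeasurable (fun q : ℝ × ℝ =>
        ENNReal.ofReal (‖G (q.1 * Complex.exp (q.2 * Complex.I))‖ ^ p) *
          ENNReal.ofReal ((Set.Ioo (0 : ℝ) 1).indicator w q.1))
        ((volume.restrict (Set.Ioi 0)).prod (volume.restrict (Set.Ioo (-Real.pi) Real.pi))) := by
      refine AEMeasurable.mul (Measurable.aemeasurable ?_) hw'.comp_fst.ennreal_ofReal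
      exact ((hGm.comp (by fun_prop)).norm.pow_const p).ennreal_ofReal
    refine h2.congr ?_
    rw [Measure.prod_restrict]
    refine (ae_restrict_mem (measurableSet_Ioi.prod measurableSet_Ioo)).mono fun q hq => ?_
    have hq1 : 0 < q.1 := hq.1
    have hn : ‖(q.1 : ℂ) * Complex.exp (q.2 * Complex.I)‖ = q.1 := by
      rw [norm_mul, Complex.norm_exp_ofReal_mul_I, mul_one, Complex.norm_real,
        Real.norm_of_nonneg hq1.le]
    simp only [hg, hn]
    by_cases h : q.1 < 1
    · rw [Set.indicator_of_mem (show q.1 ∈ Set.Ioo (0 : ℝ) 1 from ⟨hq1, h⟩)]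
    · rw [hGout _ (by rwa [hn])]
      simp [Real.zero_rpow hp.ne']
  rw [h1, lintegral_polar hgm, ← lintegral_const_mul' _ _ ENNReal.ofReal_ne_top,
    ← lintegral_indicator measurableSet_Ioi, ← lintegral_indicator measurableSet_Ioo]
  congr 1
  ext r
  by_cases hr0 : 0 < r
  swap
  · rw [Set.indicator_of_notMem (by simpa using hr0),
      Set.indicator_of_notMem fun h => hr0 h.1]
  have hn : ∀ t : UCirc, ‖(r : ℂ) * ev t‖ = r := fun t => by simp [abs_of_pos hr0]
  rw [Set.indicator_of_mem (show r ∈ Set.Ioi (0 : ℝ) from hr0)]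
  by_cases hr1 : r < 1
  · rw [Set.indicator_of_mem (show r ∈ Set.Ioo (0 : ℝ) 1 from ⟨hr0, hr1⟩)]
    have hgr : ∀ t : UCirc, g (r * ev t) =
        ENNReal.ofReal (‖F (r * ev t)‖ ^ p) * ENNReal.ofReal (w r) := fun t => by
      simp only [hg, hn]; rw [hGin _ (by rwa [hn])]
    simp only [hgr]
    rw [lintegral_mul_const' _ _ ENNReal.ofReal_ne_top, ofReal_pmean
      (continuous_norm_rpow_comp hp hF (continuous_const.mul continuous_ev)
        fun t => by rwa [mem_ball_zero_iff, hn]), ← mul_assoc, ← mul_assoc,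
      ← ENNReal.ofReal_mul (by positivity), ← ENNReal.ofReal_mul (by positivity)]
    congr 2
    field_simp
  · rw [Set.indicator_of_notMem fun h => hr1 h.2]
    have hgr : ∀ t : UCirc, g (r * ev t) = 0 := fun t => by
      simp only [hg]; rw [hGout _ (by rwa [hn])]
      simp [Real.zero_rpow hp.ne']
    simp [hgr]

/-- The measure on `(0, 1)` with density `ω`. -/
noncomputable def profileMeasure (ω : ℝ → ℝ) : Measure ℝ :=
  (volume.restrict (Set.Ioo 0 1)).withDensity fun r => ENNReal.ofReal (ω r)

lemma lintegral_profileMeasure {ω : ℝ → ℝ} (hω : IsRadialWeight ω) {g : ℝ → ENNReal}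
    (hg : AEMeasurable g (volume.restrict (Set.Ioo 0 1))) :
    ∫⁻ r, g r ∂profileMeasure ω = ∫⁻ r in Set.Ioo 0 1, g r * ENNReal.ofReal (ω r) := by
  rw [profileMeasure, lintegral_withDensity_eq_lintegral_mul₀ hω.aemeasurable.ennreal_ofReal hg]
  simp only [Pi.mul_apply, mul_comm]

lemma profileMeasure_Ioo {ω : ℝ → ℝ} (hω : IsRadialWeight ω) {a : ℝ} (h0 : 0 ≤ a) (h1 : a ≤ 1) :
    profileMeasure ω (Set.Ioo a 1) = ENNReal.ofReal (hat ω a) := by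
  rw [profileMeasure, withDensity_apply _ measurableSet_Ioo,
    Measure.restrict_restrict measurableSet_Ioo, Set.inter_eq_left.2 (Set.Ioo_subset_Ioo_left h0),
    IsRadialWeight.hat_eq h1, ofReal_integral_eq_lintegral_ofReal
      (hω.integrableOn_Icc.mono_set (IsRadialWeight.Ioo_subset h0))]
  exact (ae_restrict_mem measurableSet_Ioo).mono fun x hx => hω.nonneg_Ioo h0 hx

lemma profileMeasure_inter_Ioo (ω : ℝ → ℝ) (s : Set ℝ) :
    profileMeasure ω (s ∩ Set.Ioo 0 1) = profileMeasure ω s := by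
  have h : profileMeasure ω (Set.Ioo 0 1)ᶜ = 0 := by
    rw [profileMeasure, withDensity_apply _ measurableSet_Ioo.compl,
      Measure.restrict_restrict measurableSet_Ioo.compl]
    simp
  exact measure_inter_conull' (measure_mono_null (Set.sdiff_subset_compl _ _) h)

/-- The dilation property of monotone functions with respect to doubling weights. -/
lemma lintegral_comp_half_le {ω : ℝ → ℝ} (hω : ω ∈ DHat) : ∃ C : ℝ, 0 < C ∧ ∀ H : ℝ → ℝ,
    MonotoneOn H (Set.Ico 0 1) → (∀ r ∈ Set.Ico (0 : ℝ) 1, 0 ≤ H r) →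
      ∫⁻ r in Set.Ioo 0 1, ENNReal.ofReal (H ((1 + r) / 2)) * ENNReal.ofReal (ω r) ≤
        ENNReal.ofReal C * ∫⁻ r in Set.Ioo 0 1, ENNReal.ofReal (H r) * ENNReal.ofReal (ω r) := by
  obtain ⟨hw, C, hC, hd⟩ := hω
  refine ⟨C, by linarith, fun H hH hH0 => ?_⟩
  have hφ : ∀ r ∈ Set.Ioo (0 : ℝ) 1, (1 + r) / 2 ∈ Set.Ico (0 : ℝ) 1 := fun r hr =>
    ⟨by linarith [hr.1], by linarith [hr.2]⟩
  have hm1 : AEMeasurable H (volume.restrict (Set.Ioo 0 1)) :=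
    aemeasurable_restrict_of_monotoneOn measurableSet_Ioo (hH.mono Set.Ioo_subset_Ico_self)
  have hm2 : AEMeasurable (fun r => H ((1 + r) / 2)) (volume.restrict (Set.Ioo 0 1)) :=
    aemeasurable_restrict_of_monotoneOn measurableSet_Ioo fun x hx y hy hxy =>
      hH (hφ x hx) (hφ y hy) (by linarith)
  have hac : profileMeasure ω ≪ volume.restrict (Set.Ioo 0 1) :=
    withDensity_absolutelyContinuous _ _
  -- Layer-cake formula: it suffices to compare the measures of the superlevel sets of the two
  -- functions at each height.
  rw [← lintegral_profileMeasure hw hm1.ennreal_ofReal,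
    ← lintegral_profileMeasure hw hm2.ennreal_ofReal,
    lintegral_eq_lintegral_meas_lt _ (hac.ae_le ((ae_restrict_mem measurableSet_Ioo).mono
      fun r hr => hH0 r ⟨hr.1.le, hr.2⟩)) (hm1.mono_ac hac),
    lintegral_eq_lintegral_meas_lt _ (hac.ae_le ((ae_restrict_mem measurableSet_Ioo).mono
      fun r hr => hH0 _ (hφ r hr))) (hm2.mono_ac hac),
    ← lintegral_const_mul' _ _ ENNReal.ofReal_ne_top]
  refine lintegral_mono fun t => ?_
  simp only
  rw [← profileMeasure_inter_Ioo ω {a | t < H ((1 + a) / 2)}]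
  rcases Set.eq_empty_or_nonempty ({a | t < H ((1 + a) / 2)} ∩ Set.Ioo 0 1) with he | ⟨x, hx⟩
  · simp [he]
  set A : Set ℝ := {a | t < H a} ∩ Set.Ico 0 1 with hA
  have hAne : A.Nonempty := ⟨_, hx.1, hφ x hx.2⟩
  have hAbdd : BddBelow A := ⟨0, fun a ha => ha.2.1⟩
  set a := sInf A with ha
  have ha0 : 0 ≤ a := le_csInf hAne fun y hy => hy.2.1
  have ha1 : a < 1 := (csInf_le hAbdd ⟨hx.1, hφ x hx.2⟩).trans_lt (hφ x hx.2).2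
  have hsup : Set.Ioo a 1 ⊆ {a | t < H a} := fun y hy => by
    obtain ⟨z, hz, hzy⟩ := exists_lt_of_csInf_lt hAne hy.1
    exact lt_of_lt_of_le hz.1 (hH hz.2 ⟨ha0.trans hy.1.le, hy.2⟩ hzy.le)
  -- The superlevel set of `H` contains `(a, 1)`, and that of the dilated function lies in `[s, 1)`.
  -- The maximum with `0` handles `a < 1/2`; in all cases `a ≤ (1 + s)/2`, so doubling at `s`
  -- applies.
  set s : ℝ := max (2 * a - 1) 0 with hs
  have hs0 : 0 ≤ s := le_max_right _ _
  have hs1 : s < 1 := max_lt (by linarith) one_pos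
  have hsub : {a | t < H ((1 + a) / 2)} ∩ Set.Ioo 0 1 ⊆ {s} ∪ Set.Ioo s 1 := fun y hy => by
    have h1 : a ≤ (1 + y) / 2 := csInf_le hAbdd ⟨hy.1, hφ y hy.2⟩
    have h2 : s ≤ y := max_le (by linarith) hy.2.1.le
    rcases h2.eq_or_lt with h | h
    · exact Or.inl h.symm
    · exact Or.inr ⟨h, hy.2.2⟩
  have hnull : profileMeasure ω {s} = 0 := hac (by simp)
  have hhat : hat ω s ≤ C * hat ω a := by
    refine (hd s ⟨hs0, hs1⟩).trans ?_
    have : 0 ≤ C := by linarith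
    gcongr
    refine hw.hat_anti ha0 ?_ (by linarith)
    linarith [le_max_left (2 * a - 1) 0]
  calc _ ≤ profileMeasure ω ({s} ∪ Set.Ioo s 1) := measure_mono hsub
    _ ≤ ENNReal.ofReal (hat ω s) := by
        refine (measure_union_le _ _).trans_eq ?_
        rw [hnull, zero_add, profileMeasure_Ioo hw hs0 hs1.le]
    _ ≤ ENNReal.ofReal C * ENNReal.ofReal (hat ω a) := by
        rw [← ENNReal.ofReal_mul (by linarith)]
        exact ENNReal.ofReal_le_ofReal hhat
    _ ≤ _ := by
        rw [← profileMeasure_Ioo hw ha0 ha1.le]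
        gcongr

/-! ### Sufficiency. -/

lemma continuousOn_pser_ball {b : ℕ → ℂ}
    (hb : ∀ t : ℝ, 0 ≤ t → t < 1 → Summable fun n => ‖b n‖ * t ^ n) :
    ContinuousOn (pser b) (Metric.ball 0 1) := by
  intro z hz
  have hz1 : ‖z‖ < 1 := mem_ball_zero_iff.1 hz
  obtain ⟨R, hR, hR1⟩ := exists_between hz1
  have hd : DifferentiableOn ℂ (pser b) (Metric.ball 0 R) := by
    refine Complex.differentiableOn_tsum_of_summable_norm
      (hb R ((norm_nonneg z).trans hR.le) hR1) (fun n => by fun_prop) Metric.isOpen_ball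
      fun n w hw => ?_
    rw [norm_mul, norm_pow]
    gcongr
    exact (mem_ball_zero_iff.1 hw).le
  exact (hd.continuousOn.continuousAt
    (Metric.isOpen_ball.mem_nhds (mem_ball_zero_iff.2 hR))).continuousWithinAt

lemma hasSum_taylorCoeff {f : ℂ → ℂ} (hf : AnalyticOnNhd ℂ f (Metric.ball 0 1)) {z : ℂ}
    (hz : ‖z‖ < 1) : HasSum (fun n => taylorCoeff f n * z ^ n) (f z) := by
  have := Complex.hasSum_taylorSeries_on_ball hf.differentiableOn (mem_ball_zero_iff.2 hz)
  have e : ∀ n, (n.factorial : ℂ)⁻¹ • (z - 0) ^ n • iteratedDeriv n f 0 =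
      taylorCoeff f n * z ^ n := fun n => by
    rw [taylorCoeff, sub_zero, smul_eq_mul, smul_eq_mul]
    ring
  simpa only [e] using this

lemma summable_taylorCoeff {f : ℂ → ℂ} (hf : AnalyticOnNhd ℂ f (Metric.ball 0 1)) {t : ℝ}
    (ht0 : 0 ≤ t) (ht1 : t < 1) : Summable fun n => ‖taylorCoeff f n‖ * t ^ n := by
  have := (hasSum_taylorCoeff hf (z := t) (by simpa [abs_of_nonneg ht0])).summable.norm
  simpa [abs_of_nonneg ht0] using this

lemma fracDeriv_eq_pser (μ : ℝ → ℝ) (f : ℂ → ℂ) :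
    fracDeriv μ f = pser fun n => taylorCoeff f n * (((oddMoment μ n)⁻¹ : ℝ) : ℂ) := by
  ext z
  simp only [fracDeriv, pser, oddMoment, div_eq_mul_inv]
  push_cast
  rfl

lemma pmean_congr {p : ℝ} {F G : ℂ → ℂ} {r : ℝ} (h : ∀ z : ℂ, ‖z‖ = |r| → F z = G z) :
    pmean p F r = pmean p G r := by
  unfold pmean
  congr 1; ext t
  rw [h _ (by simp)]

lemma aemeasurable_hat_rpow_mul {ω μ : ℝ → ℝ} (hω : IsRadialWeight ω) (hμ : IsRadialWeight μ)
    (p : ℝ) : AEMeasurable (fun r => hat μ r ^ p * ω r) (volume.restrict (Set.Ioo 0 1)) := by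
  refine AEMeasurable.mul (AEMeasurable.pow_const ?_ p) hω.aemeasurable
  exact aemeasurable_restrict_of_antitoneOn measurableSet_Ioo fun r hr s hs hrs =>
    hμ.hat_anti hr.1.le hrs hs.2.le

lemma exists_LPInequality {ω μ : ℝ → ℝ} {p : ℝ} (hp : 0 < p) (hω : ω ∈ DHat) (hμ : μ ∈ DClass) :
    ∃ C : ℝ, 0 < C ∧ ∀ f : ℂ → ℂ, AnalyticOnNhd ℂ f (Metric.ball (0 : ℂ) 1) →
      LPInequality p ω μ C f := by
  obtain ⟨C₁, hC₁, hmean⟩ := pmean_mul_inv_oddMoment_le hμ hp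
  obtain ⟨C₂, hC₂, hdil⟩ := lintegral_comp_half_le hω
  refine ⟨C₁ * C₂, by positivity, fun f hf => ?_⟩
  have hcoef : ∀ t : ℝ, 0 ≤ t → t < 1 → Summable fun n => ‖taylorCoeff f n‖ * t ^ n :=
    fun t h0 h1 => summable_taylorCoeff hf h0 h1
  have hfp : ∀ z : ℂ, ‖z‖ < 1 → pser (taylorCoeff f) z = f z := fun z hz =>
    (hasSum_taylorCoeff hf hz).tsum_eq
  have hwm := aemeasurable_hat_rpow_mul hω.1 hμ.1.1 p
  -- The polar Jacobian `2r` is kept inside `H`: it preserves monotonicity, and `r ≤ (1 + r)/2`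
  -- inserts the dilated Jacobian at the end.
  set H : ℝ → ℝ := fun r => 2 * r * pmean p f r with hH
  have hmono : MonotoneOn H (Set.Ico 0 1) := fun r hr s hs hrs => by
    have hcl : DiffContOnCl ℂ f (Metric.ball 0 s) := by
      refine DifferentiableOn.diffContOnCl (hf.differentiableOn.mono ?_)
      refine Metric.closure_ball_subset_closedBall.trans fun z hz => ?_
      exact mem_ball_zero_iff.2 ((mem_closedBall_zero_iff.1 hz).trans_lt hs.2)
    have := pmean_mono hp hcl hr.1 hrs
    have h0 := pmean_nonneg p f r
    have hr0 := hr.1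
    have hs0 := hs.1
    simp only [hH]
    gcongr
  have hH0 : ∀ r ∈ Set.Ico (0 : ℝ) 1, 0 ≤ H r := fun r hr =>
    mul_nonneg (mul_nonneg two_pos.le hr.1) (pmean_nonneg _ _ _)
  rw [LPInequality, fracDeriv_eq_pser, weightedIntegral_eq hp hwm (continuousOn_pser_ball
    fun t h0 h1 => (hmean _ hcoef t h0 h1).1), weightedIntegral_eq hp hω.1.aemeasurable
    hf.continuousOn, ENNReal.ofReal_mul hC₁.le, mul_assoc]
  refine le_trans ?_ (mul_le_mul_right (hdil H hmono hH0) _)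
  rw [← lintegral_const_mul' _ _ ENNReal.ofReal_ne_top]
  refine setLIntegral_mono_ae' measurableSet_Ioo (Filter.Eventually.of_forall fun r hr => ?_)
  have hr0 := hr.1
  have hr1 := hr.2
  have hω0 := hω.1.nonneg_Ioo le_rfl hr
  have hμ0 := (hμ.1.1.hat_pos r ⟨hr.1.le, hr.2⟩).le
  have h1 := (hmean _ hcoef r hr.1.le hr.2).2
  rw [pmean_congr fun z hz => hfp z (by rw [hz, abs_of_pos] <;> linarith)] at h1
  have h2 := pmean_nonneg p f ((1 + r) / 2)
  rw [ENNReal.ofReal_mul (p := hat μ r ^ p) (by positivity), ← mul_assoc, ← mul_assoc,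
    ← ENNReal.ofReal_mul hC₁.le]
  gcongr
  rw [← ENNReal.ofReal_mul (mul_nonneg (by positivity) (pmean_nonneg _ _ _))]
  refine ENNReal.ofReal_le_ofReal ?_
  simp only [hH]
  calc _ = 2 * r * (pmean p (pser fun n => taylorCoeff f n * (((oddMoment μ n)⁻¹ : ℝ) : ℂ)) r *
        hat μ r ^ p) := by ring
    _ ≤ 2 * r * (C₁ * pmean p f ((1 + r) / 2)) := by gcongr
    _ ≤ 2 * ((1 + r) / 2) * (C₁ * pmean p f ((1 + r) / 2)) := by gcongr; linarith
    _ = _ := by ring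

/-! ### Necessity, by testing on monomials. -/

lemma taylorCoeff_pow (n m : ℕ) : taylorCoeff (fun z => z ^ n) m = if m = n then 1 else 0 := by
  rw [taylorCoeff, iteratedDeriv_fun_pow_zero]
  split_ifs with h
  · subst h
    exact div_self (Nat.cast_ne_zero.2 (Nat.factorial_ne_zero _))
  · simp

lemma fracDeriv_pow (μ : ℝ → ℝ) (n : ℕ) :
    fracDeriv μ (fun z => z ^ n) = fun z => (((oddMoment μ n)⁻¹ : ℝ) : ℂ) * z ^ n := by
  rw [fracDeriv_eq_pser]
  ext z
  rw [pser, tsum_eq_single n fun m hm => by rw [taylorCoeff_pow, if_neg hm]; simp,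
    taylorCoeff_pow, if_pos rfl, one_mul]

lemma pmean_const_mul_pow (p : ℝ) {c r : ℝ} (hc : 0 ≤ c) (hr : 0 ≤ r) (n : ℕ) :
    pmean p (fun z => (c : ℂ) * z ^ n) r = c ^ p * r ^ (n * p) := by
  have h : ∀ t : UCirc, ‖(c : ℂ) * (r * ev t) ^ n‖ ^ p = c ^ p * r ^ (n * p) := fun t => by
    rw [norm_mul, norm_pow, norm_mul, norm_ev, mul_one, Complex.norm_real, Complex.norm_real,
      Real.norm_of_nonneg hc, Real.norm_of_nonneg hr, Real.mul_rpow hc (pow_nonneg hr n),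
      Real.rpow_mul hr, Real.rpow_natCast]
  simp only [pmean, h, integral_const, probReal_univ, one_smul]

lemma ae_profileMeasure (ω : ℝ → ℝ) : ∀ᵐ r ∂profileMeasure ω, r ∈ Set.Ioo (0 : ℝ) 1 :=
  (withDensity_absolutelyContinuous _ _).ae_le (ae_restrict_mem measurableSet_Ioo)

/-- The radial density of `|z ^ n| ^ p dA`. -/
noncomputable def monomialDensity (p : ℝ) (n : ℕ) (r : ℝ) : ENNReal :=
  ENNReal.ofReal (2 * r * r ^ (n * p))

lemma measurable_monomialDensity (p : ℝ) (n : ℕ) : Measurable (monomialDensity p n) := by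
  unfold monomialDensity; fun_prop

lemma weightedIntegral_pow {ω : ℝ → ℝ} (hω : IsRadialWeight ω) {p : ℝ} (hp : 0 < p) (n : ℕ) :
    weightedIntegral p ω (fun z => z ^ n) = ∫⁻ r, monomialDensity p n r ∂profileMeasure ω := by
  rw [weightedIntegral_eq hp hω.aemeasurable (by fun_prop),
    lintegral_profileMeasure hω (measurable_monomialDensity p n).aemeasurable]
  refine setLIntegral_congr_fun measurableSet_Ioo fun r hr => ?_
  have := pmean_const_mul_pow p zero_le_one hr.1.le n
  simp only [Complex.ofReal_one, one_mul, Real.one_rpow] at this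
  simp only [monomialDensity, this]

lemma weightedIntegral_fracDeriv_pow {ω μ : ℝ → ℝ} (hω : IsRadialWeight ω)
    (hμ : IsRadialWeight μ) {p : ℝ} (hp : 0 < p) (n : ℕ) :
    weightedIntegral p (fun r => hat μ r ^ p * ω r) (fracDeriv μ fun z => z ^ n) =
      ∫⁻ r, ENNReal.ofReal ((hat μ r / oddMoment μ n) ^ p) * monomialDensity p n r
        ∂profileMeasure ω := by
  have hM : 0 < oddMoment μ n := oddMoment_pos hμ n
  have hm : AEMeasurable (hat μ) (volume.restrict (Set.Ioo 0 1)) :=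
    aemeasurable_restrict_of_antitoneOn measurableSet_Ioo fun r hr s hs hrs =>
      hμ.hat_anti hr.1.le hrs hs.2.le
  rw [fracDeriv_pow, weightedIntegral_eq hp (aemeasurable_hat_rpow_mul hω hμ p) (by fun_prop),
    lintegral_profileMeasure hω (g := fun r => ENNReal.ofReal ((hat μ r / oddMoment μ n) ^ p) *
      monomialDensity p n r) (((hm.div_const _).pow_const p).ennreal_ofReal.mul
      (measurable_monomialDensity p n).aemeasurable)]
  refine setLIntegral_congr_fun measurableSet_Ioo fun r hr => ?_
  have h1 := (hμ.hat_pos r ⟨hr.1.le, hr.2⟩).le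
  have h2 := hr.1
  simp only [monomialDensity]
  rw [pmean_const_mul_pow p (inv_nonneg.2 hM.le) hr.1.le n,
    ENNReal.ofReal_mul (p := hat μ r ^ p) (by positivity), ← mul_assoc,
    div_eq_mul_inv, Real.mul_rpow h1 (by positivity)]
  congr 1
  rw [← ENNReal.ofReal_mul (by positivity), ← ENNReal.ofReal_mul (by positivity)]
  congr 1; ring

/-- If the inequality holds for `z ^ n`, then the mass of `|z ^ n| ^ p ω` on a disc where `hat μ`
is large compared with the odd moment is controlled by the mass outside. -/
lemma lintegral_monomialDensity_le {ω μ : ℝ → ℝ} (hω : IsRadialWeight ω) (hμ : IsRadialWeight μ)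
    {p : ℝ} (hp : 0 < p) {C : ℝ} (hC : 0 < C) {n : ℕ} (h : LPInequality p ω μ C fun z => z ^ n)
    {s : ℝ} (hs1 : s < 1) (hsC : 2 * C ≤ (hat μ s / oddMoment μ n) ^ p) (hs0 : 0 ≤ s) :
    ∫⁻ r in Set.Iio s, monomialDensity p n r ∂profileMeasure ω ≤
      2 * ENNReal.ofReal (hat ω s) := by
  have hM : 0 < oddMoment μ n := oddMoment_pos hμ n
  set m := profileMeasure ω with hm
  set X := ∫⁻ r in Set.Iio s, monomialDensity p n r ∂m with hX
  set Y := ∫⁻ r in (Set.Iio s)ᶜ, monomialDensity p n r ∂m with hY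
  rw [LPInequality, weightedIntegral_fracDeriv_pow hω hμ hp, weightedIntegral_pow hω hp,
    ← lintegral_add_compl (monomialDensity p n) (measurableSet_Iio (a := s))] at h
  have hmfin : m Set.univ ≠ ⊤ := by
    rw [hm, ← profileMeasure_inter_Ioo, Set.univ_inter, profileMeasure_Ioo hω le_rfl zero_le_one]
    exact ENNReal.ofReal_ne_top
  have hle : ∀ᵐ r ∂m, monomialDensity p n r ≤ 2 := (ae_profileMeasure ω).mono fun r hr => by
    rw [monomialDensity, ← ENNReal.ofReal_ofNat]
    refine ENNReal.ofReal_le_ofReal ?_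
    have h1 : r ^ (n * p) ≤ 1 := Real.rpow_le_one hr.1.le hr.2.le (by positivity)
    have h2 := hr.1
    have h3 := hr.2
    calc 2 * r * r ^ (n * p) ≤ 2 * 1 * 1 := by gcongr
      _ = _ := by norm_num
  -- Finiteness is what permits cancelling `X` at the end.
  have hXfin : X ≠ ⊤ := by
    refine ne_top_of_le_ne_top (ENNReal.mul_ne_top ENNReal.ofNat_ne_top hmfin : 2 * m Set.univ ≠ ⊤) ?_
    calc X ≤ ∫⁻ _, 2 ∂m := (setLIntegral_le_lintegral _ _).trans (lintegral_mono_ae hle)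
      _ = _ := by rw [lintegral_const]
  have hYle : Y ≤ 2 * ENNReal.ofReal (hat ω s) := by
    calc Y ≤ ∫⁻ _ in (Set.Iio s)ᶜ, 2 ∂m := lintegral_mono_ae (ae_restrict_of_ae hle)
      _ = 2 * m (Set.Ici s) := by rw [setLIntegral_const, Set.compl_Iio]
      _ ≤ 2 * m ({s} ∪ Set.Ioo s 1) := by
          rw [hm, ← profileMeasure_inter_Ioo ω (Set.Ici s)]
          gcongr
          intro r hr
          rcases (show s ≤ r from hr.1).eq_or_lt with h | h
          · exact Or.inl h.symm
          · exact Or.inr ⟨h, hr.2.2⟩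
      _ ≤ 2 * (m {s} + m (Set.Ioo s 1)) := by gcongr; exact measure_union_le _ _
      _ = _ := by
          have : m {s} = 0 := withDensity_absolutelyContinuous _ _ (by simp)
          rw [this, zero_add, hm, profileMeasure_Ioo hω hs0 hs1.le]
  refine le_trans ?_ hYle
  have hC' : ENNReal.ofReal C ≠ 0 := by simpa using hC
  -- On `r < s` the factor `(μ̂(r)/μ_{2n+1})^p` is at least `2C`, so the inequality gives `2C X ≤ C
  -- (X + Y)`, that is, `X ≤ Y`.
  have key : ENNReal.ofReal (2 * C) * X ≤ ENNReal.ofReal C * (X + Y) := by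
    refine le_trans ?_ h
    rw [hX, ← lintegral_const_mul _ (measurable_monomialDensity p n)]
    refine le_trans (lintegral_mono_ae ?_) (setLIntegral_le_lintegral (Set.Iio s) _)
    filter_upwards [ae_restrict_mem measurableSet_Iio, ae_restrict_of_ae (ae_profileMeasure ω)]
      with r hr hr2
    gcongr
    refine hsC.trans ?_
    have h1 : hat μ s ≤ hat μ r := hμ.hat_anti hr2.1.le hr.le hs1.le
    have h2 := (hμ.hat_pos s ⟨hs0, hs1⟩).le
    gcongr
  rw [mul_comm 2 C, ENNReal.ofReal_mul hC.le, mul_assoc,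
    ENNReal.mul_le_mul_iff_right hC' ENNReal.ofReal_ne_top, ENNReal.ofReal_ofNat, two_mul] at key
  exact (ENNReal.add_le_add_iff_left hXfin).1 key

/-- The monomial density is at least `a` on `(s', s)`, so the mass of `ω` there is at most `2/a`
times its tail from `s`. -/
lemma hat_le_of_LPInequality {ω μ : ℝ → ℝ} (hω : IsRadialWeight ω) (hμ : IsRadialWeight μ)
    {p : ℝ} (hp : 0 < p) {C : ℝ} (hC : 0 < C) {n : ℕ} (h : LPInequality p ω μ C fun z => z ^ n)
    {s s' a : ℝ} (hs0 : 0 < s') (hss : s' ≤ s) (hs1 : s < 1)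
    (hsC : 2 * C ≤ (hat μ s / oddMoment μ n) ^ p) (ha : 0 < a) (has : a ≤ 2 * s' * s' ^ (n * p)) :
    hat ω s' ≤ (1 + 2 / a) * hat ω s := by
  have h1 := lintegral_monomialDensity_le hω hμ hp hC h hs1 hsC (hs0.le.trans hss)
  have hsub : ENNReal.ofReal a * profileMeasure ω (Set.Ioo s' s) ≤ 2 * ENNReal.ofReal (hat ω s) := by
    refine le_trans ?_ h1
    rw [← setLIntegral_const]
    refine (setLIntegral_mono' measurableSet_Ioo fun r hr => ?_).trans
      (lintegral_mono_set Set.Ioo_subset_Iio_self)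
    refine ENNReal.ofReal_le_ofReal (has.trans ?_)
    have h1 := hr.1
    have h2 : 0 < r := hs0.trans h1
    gcongr
  have hms : profileMeasure ω (Set.Ioo s' 1) ≤
      profileMeasure ω (Set.Ioo s' s) + profileMeasure ω (Set.Ioo s 1) := by
    have hnull : profileMeasure ω {s} = 0 := withDensity_absolutelyContinuous _ _ (by simp)
    rw [← zero_add (profileMeasure ω (Set.Ioo s' s)), ← hnull]
    refine le_trans (measure_mono ?_) ((measure_union_le ({s} ∪ Set.Ioo s' s) (Set.Ioo s 1)).trans
      (add_le_add_left (measure_union_le _ _) _))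
    intro r hr
    rcases lt_trichotomy r s with h | h | h
    · exact Or.inl (Or.inr ⟨hr.1, h⟩)
    · exact Or.inl (Or.inl h)
    · exact Or.inr ⟨h, hr.2⟩
  rw [profileMeasure_Ioo hω hs0.le (hss.trans hs1.le),
    profileMeasure_Ioo hω (hs0.le.trans hss) hs1.le] at hms
  have hpos := hω.hat_pos s ⟨hs0.le.trans hss, hs1⟩
  have h2 : ENNReal.ofReal (a * hat ω s') ≤ ENNReal.ofReal (2 * hat ω s + a * hat ω s) := by
    rw [ENNReal.ofReal_mul ha.le, ENNReal.ofReal_add (by positivity) (by positivity),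
      ENNReal.ofReal_mul two_pos.le, ENNReal.ofReal_mul ha.le, ENNReal.ofReal_ofNat]
    calc _ ≤ ENNReal.ofReal a * (profileMeasure ω (Set.Ioo s' s) + ENNReal.ofReal (hat ω s)) := by
          gcongr
      _ ≤ _ := by rw [mul_add]; gcongr
  rw [ENNReal.ofReal_le_ofReal_iff (by positivity)] at h2
  rw [← mul_le_mul_iff_right₀ ha]
  refine h2.trans_eq ?_
  field_simp; ring

/-- The inequality for monomials forces the weight to be doubling. -/
lemma mem_DHat_of_LPInequality_pow {ω μ : ℝ → ℝ} {p : ℝ} (hω : IsRadialWeight ω) (hp : 0 < p)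
    (hμ : μ ∈ DClass) {C : ℝ} (hC : 0 < C) (h : ∀ n : ℕ, LPInequality p ω μ C fun z => z ^ n) :
    ω ∈ DHat := by
  obtain ⟨B, hB, hmom⟩ := moment_le_hat hμ.1
  obtain ⟨hμw, k, c, hk, hc, hd⟩ := hμ.2
  have hiter : ∀ (m : ℕ) (t : ℝ), 0 < t → t * k ^ m ≤ 1 →
      c ^ m * hat μ (1 - t) ≤ hat μ (1 - t * k ^ m) := fun m => by
    induction m with
    | zero => intro t _ _; simp
    | succ m ih =>
      intro t ht htm
      have h1 : 1 ≤ k ^ m := one_le_pow₀ hk.le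
      have h2 := hd (1 - t * k ^ (m + 1)) ⟨by linarith, by
        have : 0 < t * k ^ (m + 1) := by positivity
        linarith⟩
      have e : (1 - (1 - t * k ^ (m + 1))) / k = t * k ^ m := by field_simp; ring
      rw [e] at h2
      have h3 : t * k ^ m ≤ t * k ^ (m + 1) := by
        gcongr
        · exact hk.le
        · exact Nat.le_succ m
      have h4 := ih t ht (h3.trans htm)
      calc _ = c * (c ^ m * hat μ (1 - t)) := by ring
        _ ≤ c * hat μ (1 - t * k ^ m) := by gcongr
        _ ≤ _ := h2
  -- Here `m` is the number of lower doubling steps after which `μ̂(1 - K/N)` exceeds `(2C)^{1/p}`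
  -- times the odd moment; `B` converts the moment into a tail of `μ`.
  obtain ⟨m, hm⟩ := pow_unbounded_of_one_lt ((2 * C) ^ p⁻¹ * B) hc
  set K : ℝ := k ^ m with hK
  have hK1 : 1 ≤ K := one_le_pow₀ hk.le
  set A : ℝ := 1 + 2 / Real.exp (-(8 * K * p)) with hA
  have hA0 : 1 ≤ A := le_add_of_nonneg_right (by positivity)
  -- For `N ≥ 8K` the point `y = 4K/N` is at most `1/2`, so `1 - y ≥ e^{-2y}` and `(1 - y)^{np} ≥
  -- e^{-8Kp}`. This is the lower bound used for the density, as `2(1 - y) ≥ 1`.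
  have hstep : ∀ N : ℕ, 8 * K ≤ (N + 1 : ℕ) →
      hat ω (1 - 4 * K / (N + 1 : ℕ)) ≤ A * hat ω (1 - K / (N + 1 : ℕ)) := fun n hn => by
    set N : ℝ := ((n + 1 : ℕ) : ℝ) with hN
    have hN0 : 0 < N := by positivity
    have hKN : K / N ≤ 1 / 8 := by rw [div_le_div_iff₀ hN0 (by norm_num)]; linarith
    have hKN0 : 0 < K / N := by positivity
    have hM := oddMoment_pos hμw n
    refine hat_le_of_LPInequality hω hμw hp hC (h n) (by rw [mul_div_assoc]; linarith)
      (by rw [mul_div_assoc]; linarith) (by linarith) ?_ (Real.exp_pos _) ?_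
    · have h1 : (2 * C) ^ p⁻¹ * oddMoment μ n ≤ hat μ (1 - K / N) := by
        have h2 := hiter m (1 / N) (by positivity) (by rw [one_div_mul_eq_div]; linarith)
        rw [one_div_mul_eq_div] at h2
        refine le_trans ?_ h2
        have h3 := (oddMoment_le_moment hμw n).trans (hmom n)
        have h4 : ((n : ℝ) + 1) = N := by rw [hN]; push_cast; rfl
        rw [h4] at h3
        have h5 : 0 < hat μ (1 - 1 / N) := hμw.hat_pos _ ⟨by
          have : 1 / N ≤ K / N := by gcongr
          linarith, by
          have : 0 < 1 / N := by positivity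
          linarith⟩
        calc _ ≤ (2 * C) ^ p⁻¹ * (B * hat μ (1 - 1 / N)) := by gcongr
          _ = (2 * C) ^ p⁻¹ * B * hat μ (1 - 1 / N) := by ring
          _ ≤ _ := by gcongr
      calc 2 * C = ((2 * C) ^ p⁻¹) ^ p := by
            rw [← Real.rpow_mul (by positivity), inv_mul_cancel₀ hp.ne', Real.rpow_one]
        _ ≤ _ := by
            refine Real.rpow_le_rpow (by positivity) ?_ hp.le
            rwa [le_div_iff₀ hM]
    · set y : ℝ := 4 * K / N with hy
      have hy1 : y ≤ 1 / 2 := by rw [hy, mul_div_assoc]; linarith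
      have hy0 : 0 < y := by positivity
      have h1 : Real.exp (-(2 * y)) ≤ 1 - y := by
        have h2 : (1 + y) * (1 - y) ≥ 0 := by nlinarith
        have h3 : Real.exp (-(2 * y)) * (1 + 2 * y) ≤ 1 := by
          calc _ ≤ Real.exp (-(2 * y)) * Real.exp (2 * y) := by
                gcongr; linarith [Real.add_one_le_exp (2 * y)]
            _ = 1 := by rw [← Real.exp_add]; simp
        have h4 : 1 ≤ (1 - y) * (1 + 2 * y) := by nlinarith
        exact le_of_mul_le_mul_right (h3.trans h4) (by linarith)
      have h2 : Real.exp (-(8 * K * p)) ≤ (1 - y) ^ (n * p) := by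
        calc _ ≤ Real.exp (-(2 * y)) ^ (n * p) := by
              rw [← Real.exp_mul]
              refine Real.exp_le_exp.2 ?_
              have h3 : y * n ≤ 4 * K := by
                rw [hy, div_mul_eq_mul_div, div_le_iff₀ hN0]
                gcongr
                rw [hN]; push_cast; linarith
              nlinarith
          _ ≤ _ := by gcongr
      calc _ ≤ 1 * (1 - y) ^ (n * p) := by rwa [one_mul]
        _ ≤ _ := by
          have : 0 ≤ (1 - y) ^ (n * p) := Real.rpow_nonneg (by linarith) _
          gcongr; linarith
  have hpos0 := hω.hat_pos 0 ⟨le_rfl, one_pos⟩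
  have hpos1 := hω.hat_pos (7 / 8) ⟨by norm_num, by norm_num⟩
  -- The second summand handles `r ≤ 3/4`, where the tail from `7/8` is a lower bound for the right
  -- side; `A` handles `r` near `1`.
  refine ⟨hω, A + hat ω 0 / hat ω (7 / 8), by
    have : 0 < hat ω 0 / hat ω (7 / 8) := by positivity
    linarith, fun r hr => ?_⟩
  have hr0 := hr.1
  have hr1 := hr.2
  have hpos := hω.hat_pos ((1 + r) / 2) ⟨by linarith, by linarith⟩
  rw [add_mul]
  rcases le_total r (3 / 4) with hr2 | hr2
  · have h1 : hat ω r ≤ hat ω 0 := hω.hat_anti le_rfl hr0 hr1.le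
    have h2 : hat ω (7 / 8) ≤ hat ω ((1 + r) / 2) :=
      hω.hat_anti (by linarith) (by linarith) (by norm_num)
    have h3 : hat ω 0 ≤ hat ω 0 / hat ω (7 / 8) * hat ω ((1 + r) / 2) := by
      rw [div_mul_eq_mul_div, le_div_iff₀ hpos1]
      gcongr
    have : 0 ≤ A * hat ω ((1 + r) / 2) := by positivity
    linarith
  · set t := 1 - r with ht
    have ht0 : 0 < t := by linarith
    -- With `N` the ceiling of `2K/t`, both `K/N ≤ t/2` and `t ≤ 4K/N` hold. The ratio `4`, rather
    -- than `2`, leaves room for the rounding.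
    obtain ⟨n, hn⟩ : ∃ n, ⌈2 * K / t⌉₊ = n + 1 :=
      Nat.exists_eq_succ_of_ne_zero (Nat.ceil_pos.2 (by positivity)).ne'
    have hN1 : 2 * K / t ≤ (n + 1 : ℕ) := by rw [← hn]; exact Nat.le_ceil _
    have hN2 : ((n + 1 : ℕ) : ℝ) < 2 * K / t + 1 := by
      rw [← hn]; exact Nat.ceil_lt_add_one (by positivity)
    have h8 : 8 * K ≤ 2 * K / t := by
      rw [le_div_iff₀ ht0]; nlinarith
    have h3 := hstep n (h8.trans hN1)
    have hN0 : (0 : ℝ) < (n + 1 : ℕ) := by positivity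
    have h4 : t ≤ 4 * K / (n + 1 : ℕ) := by
      rw [le_div_iff₀ hN0]
      have : t * (n + 1 : ℕ) ≤ t * (2 * K / t + 1) := by gcongr
      rw [mul_add, mul_div_cancel₀ _ ht0.ne'] at this
      linarith
    have h5 : K / (n + 1 : ℕ) ≤ t / 2 := by
      rw [div_le_iff₀ ht0] at hN1
      rw [div_le_div_iff₀ hN0 two_pos]; linarith
    have h6 : 4 * K / (n + 1 : ℕ) ≤ 1 := by rw [mul_div_assoc]; linarith
    have h7 : hat ω r ≤ hat ω (1 - 4 * K / (n + 1 : ℕ)) :=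
      hω.hat_anti (by linarith) (by linarith) hr1.le
    have h9 : hat ω (1 - K / (n + 1 : ℕ)) ≤ hat ω ((1 + r) / 2) :=
      hω.hat_anti (by linarith) (by linarith) (by
        have : 0 < K / (n + 1 : ℕ) := by positivity
        linarith)
    have h10 : A * hat ω (1 - K / (n + 1 : ℕ)) ≤ A * hat ω ((1 + r) / 2) := by gcongr
    have : 0 ≤ hat ω 0 / hat ω (7 / 8) * hat ω ((1 + r) / 2) := by positivity
    linarith

end RadialBergman

theorem theorem2 (ω μ : ℝ → ℝ) (p : ℝ) (hω : RadialBergman.IsRadialWeight ω) (hp : 0 < p)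
    (hμ : μ ∈ RadialBergman.DClass) :
    ((∃ C : ℝ, 0 < C ∧ ∀ f : ℂ → ℂ, AnalyticOnNhd ℂ f (Metric.ball (0 : ℂ) 1) →
        RadialBergman.LPInequality p ω μ C f) ↔ ω ∈ RadialBergman.DHat) ∧
    ((∃ C : ℝ, 0 < C ∧ ∀ f : ℂ → ℂ, AnalyticOnNhd ℂ f (Metric.ball (0 : ℂ) 1) →
        RadialBergman.LPInequality p ω μ C f) ↔
      ∃ C : ℝ, 0 < C ∧ ∀ n : ℕ, RadialBergman.LPInequality p ω μ C (fun z => z ^ n)) := by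
  have hsuff := fun hd => RadialBergman.exists_LPInequality (ω := ω) hp hd hμ
  have hpow : (∃ C : ℝ, 0 < C ∧ ∀ f : ℂ → ℂ, AnalyticOnNhd ℂ f (Metric.ball (0 : ℂ) 1) →
      RadialBergman.LPInequality p ω μ C f) →
      ∃ C : ℝ, 0 < C ∧ ∀ n : ℕ, RadialBergman.LPInequality p ω μ C (fun z => z ^ n) :=
    fun ⟨C, hC, h⟩ => ⟨C, hC, fun n => h _ fun z _ => analyticAt_id.pow n⟩
  have hnec : (∃ C : ℝ, 0 < C ∧ ∀ n : ℕ, RadialBergman.LPInequality p ω μ C (fun z => z ^ n)) →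
      ω ∈ RadialBergman.DHat :=
    fun ⟨_, hC, h⟩ => RadialBergman.mem_DHat_of_LPInequality_pow hω hp hμ hC h
  exact ⟨⟨fun h => hnec (hpow h), hsuff⟩, ⟨hpow, fun h => hsuff (hnec h)⟩⟩
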